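/- Let $\Theta\subset\mathbb R^d$ be open, convex and bounded, let $\mathbb T\subset\mathbb R$ be an interval (finite or infinite), and let $\lambda(\vartheta,t)>0$, $\vartheta\in\Theta$, $t\in\mathbb T$, be measurable in $t$ with $\int_{\mathbb T}\lambda(\vartheta,t)\,dt<\infty$. Let $\vartheta_0\in\Theta$ and let $X_1,X_2,\dots$ be independent inhomogeneous Poisson processes on $\mathbb T$, all with the intensity function $\lambda(\vartheta_0,\cdot)$. Write $\ell=\ln\lambda$, let a dot denote the gradient with respect to $\vartheta$, and let $$\mathbb I(\vartheta)=\int_{\mathbb T}\dot\lambda(\vartheta,t)\,\dot\lambda(\vartheta,t)^{\top}\lambda(\vartheta,t)^{-1}\,dt$$ be the Fisher information matrix. Suppose the following. * ($\mathcal L_0$) For each $t\in\mathbb T$ the function $\ell(\cdot,t)$ has derivatives of orders $1,2,3$ on $\Theta$, which are continuous in $\vartheta$ and bounded on $\Theta\times\mathbb T$; and $\inf_{\vartheta\in\Theta}\inf_{|\mu|=1}\mu^{\top}\mathbb I(\vartheta)\mu>0$. * ($\mathcal P_0$) For each $m$ there is given an estimator $\bar\vartheta_m$, a measurable function of $(X_1,\dots,X_m)$,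 such that $\bar\vartheta_m\to\vartheta_0$ in probability as $m\to\infty$ and $\sqrt m\,(\bar\vartheta_m-\vartheta_0)$ is bounded in probability. Let $\delta\in(1/3,1/2]$, $s\in(0,1]$, $N=[n^\delta]$, $k=[sn]$, where $[\cdot]$ is the integer part, and define the second preliminary estimator and the two-step MLE by $$\bar\vartheta_{k,n}=\bar\vartheta_N+\mathbb I(\bar\vartheta_N)^{-1}\frac1k\sum_{j=N+1}^{k}\int_{\mathbb T}\dot\ell(\bar\vartheta_N,t)\,[dX_j(t)-\lambda(\bar\vartheta_N,t)\,dt],$$ $$\vartheta^{\star\star}_{k,n}=\bar\vartheta_{k,n}+\mathbb I(\bar\vartheta_N)^{-1}\frac1k\sum_{j=N+1}^{k}\int_{\mathbb T}\dot\ell(\bar\vartheta_N,t)\,[dX_j(t)-\lambda(\bar\vartheta_{k,n},t)\,dt],$$ where a correction term is replaced by $0$ if an estimate occurring in it lies outside $\Theta$. Then, as $n\to\infty$, the probability that both $\bar\vartheta_N$ and $\bar\vartheta_{k,n}$ lie in $\Theta$ tends to $1$, and $$\sqrt k\,(\vartheta^{\star\star}_{k,n}-\vartheta_0)\Longrightarrow\mathcal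 N\big(0,\mathbb I(\vartheta_0)^{-1}\big).$$ -/

import Mathlib

open MeasureTheory ProbabilityTheory Filter Topology

/-- `X` is an inhomogeneous Poisson process observed on `T ⊆ ℝ` with intensity `lam` there. A path
is recorded as a right-continuous nondecreasing counting function on the whole line, starting from
`0` at `-∞` and growing only on `T`: `X ω t` is the number of events in `T` up to time `t`. The
increments over disjoint intervals are independent, and the increment over `(t₁, t₂]` has the
Poisson law with mean `∫_{(t₁, t₂] ∩ T} lam`. -/
structure IsPoissonProcess {Ω : Type*} [MeasurableSpace Ω] (P : Measure Ω) (T : Set ℝ)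
    (lam : ℝ → ℝ) (X : Ω → StieltjesFunction ℝ) : Prop where
  measurable : ∀ t : ℝ, Measurable fun ω => X ω t
  counting : ∀ ω t, ∃ m : ℕ, X ω t = m
  start_zero : ∀ ω, Tendsto (X ω) atBot (𝓝 0)
  indep_increments : HasIndepIncrements (fun (t : ℝ) (ω : Ω) => X ω t) P
  increment_law : ∀ t₁ t₂ : ℝ, t₁ < t₂ → ∀ m : ℕ,
    P {ω | X ω t₂ - X ω t₁ = m} =
      ENNReal.ofReal ((∫ t in Set.Ioc t₁ t₂ ∩ T, lam t) ^ m / (m.factorial : ℝ) *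
        Real.exp (-∫ t in Set.Ioc t₁ t₂ ∩ T, lam t))

/-- The σ-algebra generated by the first `m` observed processes `X 0, …, X (m - 1)`. -/
abbrev observedSigma {Ω : Type*} (X : ℕ → Ω → StieltjesFunction ℝ) (m : ℕ) : MeasurableSpace Ω :=
  ⨆ j ∈ Finset.range m, ⨆ t : ℝ, MeasurableSpace.comap (fun ω => X j ω t) inferInstance

section Model

variable {d : ℕ}

/-- `lam ϑ t`, for `ϑ ∈ Θ` and `t ∈ T`, is a family of intensity functions: positive, measurable in
`t` and with finite total mass on `T`. -/
structure IsIntensityFamily (Θ : Set (EuclideanSpace ℝ (Fin d))) (T : Set ℝ)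
    (lam : EuclideanSpace ℝ (Fin d) → ℝ → ℝ) : Prop where
  pos : ∀ ϑ ∈ Θ, ∀ t ∈ T, 0 < lam ϑ t
  measurable : ∀ ϑ ∈ Θ, Measurable fun t : T => lam ϑ t
  integrable : ∀ ϑ ∈ Θ, IntegrableOn (lam ϑ) T

/-- The score `∂ log lam(ϑ, t) / ∂ϑ` (gradient with respect to `ϑ`). -/
noncomputable def score (lam : EuclideanSpace ℝ (Fin d) → ℝ → ℝ)
    (ϑ : EuclideanSpace ℝ (Fin d)) (t : ℝ) : EuclideanSpace ℝ (Fin d) :=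
  gradient (fun θ => Real.log (lam θ t)) ϑ

/-- Fisher information matrix: the integral over `T` of the gradient of `lam` in `ϑ` times its
transpose, divided by `lam`. -/
noncomputable def fisherInfo (T : Set ℝ) (lam : EuclideanSpace ℝ (Fin d) → ℝ → ℝ)
    (ϑ : EuclideanSpace ℝ (Fin d)) : Matrix (Fin d) (Fin d) ℝ :=
  Matrix.of fun l k => ∫ t in T,
    gradient (fun θ => lam θ t) ϑ l * gradient (fun θ => lam θ t) ϑ k / lam ϑ t

/-- Regularity: `log lam` has three derivatives in `ϑ ∈ Θ`, continuous in `ϑ` and bounded on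
`Θ × T`, and the Fisher information is nondegenerate uniformly on `Θ`. -/
structure IsRegularModel (Θ : Set (EuclideanSpace ℝ (Fin d))) (T : Set ℝ)
    (lam : EuclideanSpace ℝ (Fin d) → ℝ → ℝ) : Prop where
  contDiff : ∀ t ∈ T, ContDiffOn ℝ 3 (fun θ => Real.log (lam θ t)) Θ
  bounded : ∃ C : ℝ, ∀ ϑ ∈ Θ, ∀ t ∈ T, ∀ m : ℕ, 1 ≤ m → m ≤ 3 →
    ‖iteratedFDeriv ℝ m (fun θ => Real.log (lam θ t)) ϑ‖ ≤ C
  nondegenerate : ∃ c : ℝ, 0 < c ∧ ∀ ϑ ∈ Θ, ∀ u : EuclideanSpace ℝ (Fin d), ‖u‖ = 1 →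
    c ≤ u ⬝ᵥ (fisherInfo T lam ϑ).mulVec u

/-- Preliminary estimators: `ϑbar m` is a function of the first `m` observations, the sequence is
consistent for `ϑ₀`, and `√m (ϑbar m - ϑ₀)` is bounded in probability. -/
structure IsPreliminaryEstimator {Ω : Type*} [MeasurableSpace Ω] (P : Measure Ω)
    (X : ℕ → Ω → StieltjesFunction ℝ) (ϑbar : ℕ → Ω → EuclideanSpace ℝ (Fin d))
    (ϑ₀ : EuclideanSpace ℝ (Fin d)) : Prop where
  measurable : ∀ m, Measurable[observedSigma X m] (ϑbar m)
  consistent : TendstoInMeasure P ϑbar atTop fun _ => ϑ₀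
  bounded_in_prob : ∀ ε : ℝ, 0 < ε → ∃ M : ℝ, ∀ m : ℕ,
    P {ω | M < √(m : ℝ) * ‖ϑbar m ω - ϑ₀‖} ≤ ENNReal.ofReal ε

/-- `∫_T score(ϑ, t) [dx(t) - lam(ϑ', t) dt]` for one observed path `x`. -/
noncomputable def scoreIntegral (T : Set ℝ) (lam : EuclideanSpace ℝ (Fin d) → ℝ → ℝ)
    (ϑ ϑ' : EuclideanSpace ℝ (Fin d)) (x : StieltjesFunction ℝ) : EuclideanSpace ℝ (Fin d) :=
  (∫ t in T, score lam ϑ t ∂x.measure) - ∫ t in T, lam ϑ' t • score lam ϑ t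

open scoped Classical in
/-- The scoring correction
`I(ϑ)⁻¹ (1/k) ∑_{j = N+1}^k ∫_T score(ϑ, t) [dX_j(t) - lam(ϑ', t) dt]`,
where `x j` is the path of the observation number `j + 1`. The model is only defined on `Θ`, so no
correction is made if `ϑ` or `ϑ'` is outside `Θ`. -/
noncomputable def scoringCorrection (Θ : Set (EuclideanSpace ℝ (Fin d))) (T : Set ℝ)
    (lam : EuclideanSpace ℝ (Fin d) → ℝ → ℝ) (N k : ℕ) (x : ℕ → StieltjesFunction ℝ)
    (ϑ ϑ' : EuclideanSpace ℝ (Fin d)) : EuclideanSpace ℝ (Fin d) :=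
  if ϑ ∈ Θ ∧ ϑ' ∈ Θ then
    Matrix.toEuclideanCLM (𝕜 := ℝ) (fisherInfo T lam ϑ)⁻¹
      ((1 / (k : ℝ)) • ∑ j ∈ Finset.Ico N k, scoreIntegral T lam ϑ ϑ' (x j))
  else 0

/-- The second preliminary (one-step) estimate computed from the value `ϑ` of the first one. -/
noncomputable def secondPreliminary (Θ : Set (EuclideanSpace ℝ (Fin d))) (T : Set ℝ)
    (lam : EuclideanSpace ℝ (Fin d) → ℝ → ℝ) (N k : ℕ) (x : ℕ → StieltjesFunction ℝ)
    (ϑ : EuclideanSpace ℝ (Fin d)) : EuclideanSpace ℝ (Fin d) :=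
  ϑ + scoringCorrection Θ T lam N k x ϑ ϑ

/-- The two-step MLE computed from the value `ϑ` of the first preliminary estimate: in the second
correction the Fisher information and the score are still taken at `ϑ`, and only the compensator is
taken at the second preliminary estimate. -/
noncomputable def twoStepMLE (Θ : Set (EuclideanSpace ℝ (Fin d))) (T : Set ℝ)
    (lam : EuclideanSpace ℝ (Fin d) → ℝ → ℝ) (N k : ℕ) (x : ℕ → StieltjesFunction ℝ)
    (ϑ : EuclideanSpace ℝ (Fin d)) : EuclideanSpace ℝ (Fin d) :=
  secondPreliminary Θ T lam N k x ϑ +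
    scoringCorrection Θ T lam N k x ϑ (secondPreliminary Θ T lam N k x ϑ)

end Model

/-! Write p = k^(-1/2) and q = N^(-1/2). Centered at the true intensity, a score integral is a
mean-zero Poisson statistic minus ∫ (λ(ϑ') - λ(ϑ₀)) ℓ̇(ϑ), and this difference of compensators
equals I(ϑ)(ϑ' - ϑ₀) up to order (‖ϑ' - ϑ‖ + ‖ϑ₀ - ϑ‖) ‖ϑ' - ϑ₀‖. After multiplication by I(ϑ)⁻¹ it
cancels ϑ' - ϑ₀, except for the fraction N/k of observations spent on the learning sample
(`norm_add_scoringCorrection_sub_le`). From an initial error of order q the first correction reaches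
p + q²; the second leaves, beside the linear statistic, a remainder of order (p²/q² + p + q + q²)(p
+ q²) (`exists_expansion_bound`). Divided by p this vanishes when p²/q² = N/k and q³/p = √k/N^(3/2)
tend to 0; the latter is what δ > 1/3 provides (`tendsto_expansion_rate`,
`tendsto_floor_rpow_rates`).

The linear statistic is a sum over the observations N+1, ..., k of scores at the random point ϑ̄_N.
Since ϑ̄_N depends on the first N observations only, its value can be frozen; the score is Lipschitz
in ϑ, so Chebyshev's inequality shows that replacing ϑ̄_N by ϑ₀ changes the normalized sum by o(1)
in probability (`measure_le_norm_sum_scoreStat_sub`). Likewise I(ϑ̄_N)⁻¹ may be replaced by I(ϑ₀)⁻¹,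
and adding back the N missing summands costs a variance of order N/k.

What remains is a central limit theorem for i.i.d. linear statistics of Poisson paths. The
increments determine the law of a path (`map_eq`) and its first two moment measures, Λ and Λ ⊗ Λ
plus the image of Λ on the diagonal (`jumpKernel_comp`, `jumpKernel_prod_comp`). Hence a centered
statistic of f has variance ∫ f² dΛ. Characteristic functions reduce the vector case to the scalar
one, and the limiting covariance is I⁻¹ I I⁻¹ = I⁻¹. -/

section

open scoped ENNReal NNReal RealInnerProductSpace

open StieltjesFunction

/-- The σ-algebra on paths generated by the evaluations at all times. -/
instance StieltjesFunction.instMeasurableSpaceReal : MeasurableSpace (StieltjesFunction ℝ) :=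
  MeasurableSpace.comap (fun x t => x t) MeasurableSpace.pi

/-! ### Measurable structure on paths and the jump measure as a kernel -/

namespace StieltjesFunction

lemma measurable_coe_real :
    Measurable (fun (x : StieltjesFunction ℝ) (t : ℝ) => x t) :=
  comap_measurable _

lemma measurable_eval_real (t : ℝ) : Measurable (fun x : StieltjesFunction ℝ => x t) :=
  (measurable_pi_apply t).comp measurable_coe_real

lemma measurable_of_eval {α : Type*} [MeasurableSpace α] {X : α → StieltjesFunction ℝ}
    (h : ∀ t, Measurable fun a => X a t) : Measurable X :=
  measurable_comap_iff.2 (measurable_pi_lambda _ h)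

lemma tendsto_measure_Ioc_Iic (μ : Measure ℝ) (a : ℝ) :
    Tendsto (fun n : ℕ => μ (Set.Ioc (-(n : ℝ)) a)) atTop (𝓝 (μ (Set.Iic a))) := by
  have h : Set.Iic a = ⋃ n : ℕ, Set.Ioc (-(n : ℝ)) a := by
    ext t
    simp only [Set.mem_Iic, Set.mem_iUnion, Set.mem_Ioc, exists_and_right]
    refine ⟨fun ht => ⟨?_, ht⟩, fun ht => ht.2⟩
    obtain ⟨n, hn⟩ := exists_nat_gt (-t)
    exact ⟨n, by linarith⟩
  rw [h]
  refine tendsto_measure_iUnion_atTop fun m n hmn => Set.Ioc_subset_Ioc_left ?_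
  exact neg_le_neg (Nat.cast_le.2 hmn)

lemma measurable_measure_Iic (a : ℝ) :
    Measurable fun x : StieltjesFunction ℝ => x.measure (Set.Iic a) := by
  refine measurable_of_tendsto_metrizable (f := fun (n : ℕ) (x : StieltjesFunction ℝ) =>
    x.measure (Set.Ioc (-(n : ℝ)) a)) (fun n => ?_) ?_
  · simp only [measure_Ioc]
    exact ((measurable_eval_real _).sub (measurable_eval_real _)).ennreal_ofReal
  · exact tendsto_pi_nhds.2 fun _ => tendsto_measure_Ioc_Iic _ a

lemma tendsto_measure_Iic_univ (μ : Measure ℝ) :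
    Tendsto (fun n : ℕ => μ (Set.Iic (n : ℝ))) atTop (𝓝 (μ Set.univ)) :=
  (tendsto_measure_Iic_atTop μ).comp tendsto_natCast_atTop_atTop

lemma measurable_measure_univ :
    Measurable fun x : StieltjesFunction ℝ => x.measure Set.univ :=
  measurable_of_tendsto_metrizable (fun n : ℕ => measurable_measure_Iic (n : ℝ))
    (tendsto_pi_nhds.2 fun _ => tendsto_measure_Iic_univ _)

open scoped Classical in
/-- The jump measure of a path with finitely many jumps, and `0` for other paths. -/
noncomputable def jumpMeasure (x : StieltjesFunction ℝ) : Measure ℝ :=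
  if x.measure Set.univ < ∞ then x.measure else 0

instance (x : StieltjesFunction ℝ) : IsFiniteMeasure (jumpMeasure x) := by
  unfold jumpMeasure
  split_ifs with h
  · exact ⟨h⟩
  · infer_instance

lemma jumpMeasure_of_lt_top {x : StieltjesFunction ℝ} (h : x.measure Set.univ < ∞) :
    jumpMeasure x = x.measure := if_pos h

/-- Half-lines form a generating π-system, and the masses of half-lines are limits of differences of
evaluations. -/
lemma measurable_jumpMeasure : Measurable jumpMeasure := by
  have hs : MeasurableSet {x : StieltjesFunction ℝ | x.measure Set.univ < ∞} :=
    measurableSet_lt measurable_measure_univ measurable_const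
  have key : ∀ A : Set ℝ, Measurable (fun x : StieltjesFunction ℝ => x.measure A) →
      Measurable fun x => jumpMeasure x A := by
    intro A hA
    have : (fun x => jumpMeasure x A) =
        {x : StieltjesFunction ℝ | x.measure Set.univ < ∞}.indicator fun x => x.measure A := by
      ext x
      by_cases h : x.measure Set.univ < ∞
      · rw [jumpMeasure_of_lt_top h, Set.indicator_of_mem (by exact h)]
      · rw [jumpMeasure, if_neg h, Set.indicator_of_notMem (by exact h)]
        rfl
    rw [this]
    exact hA.indicator hs
  refine Measurable.measure_of_isPiSystem (S := Set.range Set.Iic) ?_ isPiSystem_Iic ?_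
    (key _ measurable_measure_univ)
  · rw [← borel_eq_generateFrom_Iic]
    exact BorelSpace.measurable_eq
  · rintro _ ⟨a, rfl⟩
    exact key _ (measurable_measure_Iic a)

/-- The jump measure of a path as a kernel. -/
noncomputable def jumpKernel : Kernel (StieltjesFunction ℝ) ℝ :=
  ⟨jumpMeasure, measurable_jumpMeasure⟩

@[simp]
lemma jumpKernel_apply (x : StieltjesFunction ℝ) : jumpKernel x = jumpMeasure x := rfl

/-- Every fibre is finite, but the total mass is unbounded over paths. Cutting path space according
to the integer part of the mass gives countably many finite kernels. -/
instance : IsSFiniteKernel jumpKernel := by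
  have key : ∀ n : ℕ, MeasurableSet {x | ⌊(jumpMeasure x).real Set.univ⌋₊ = n} := by
    intro n
    have h : Measurable fun x => (jumpMeasure x).real Set.univ :=
      ((Measure.measurable_coe MeasurableSet.univ).comp measurable_jumpMeasure).ennreal_toReal
    exact h.nat_floor (measurableSet_singleton n)
  classical
  refine ⟨fun n => Kernel.piecewise (key n) jumpKernel 0, fun n => ?_, ?_⟩
  · refine ⟨⟨ENNReal.ofReal (n + 1), ENNReal.ofReal_lt_top, fun x => ?_⟩⟩
    rw [Kernel.piecewise_apply]
    split_ifs with h
    · rw [jumpKernel_apply, ← ofReal_measureReal]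
      refine ENNReal.ofReal_le_ofReal ?_
      have := Nat.lt_floor_add_one ((jumpMeasure x).real Set.univ)
      rw [Set.mem_ofPred_eq] at h
      rw [h] at this
      exact this.le
    · simp
  · ext x s hs
    rw [Kernel.sum_apply' _ _ hs, tsum_eq_single ⌊(jumpMeasure x).real Set.univ⌋₊]
    · rw [Kernel.piecewise_apply, if_pos (by rfl)]
    · intro n hn
      rw [Kernel.piecewise_apply, if_neg]
      · simp
      · exact fun h => hn h.symm

end StieltjesFunction

/-! ### Moments of the Poisson distribution -/

section PoissonMoments

lemma lintegral_poissonMeasure (r : ℝ≥0) (g : ℕ → ℝ≥0∞) :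
    ∫⁻ n, g n ∂(poissonMeasure r) =
      ∑' n : ℕ, ENNReal.ofReal (Real.exp (-r) * r ^ n / (n.factorial : ℝ)) * g n := by
  rw [lintegral_countable']
  exact tsum_congr fun n => by rw [poissonMeasure_singleton, mul_comm]

/-- The Chen–Stein identity. -/
lemma lintegral_poissonMeasure_natCast_mul (r : ℝ≥0) (g : ℕ → ℝ≥0∞) :
    ∫⁻ n : ℕ, (n : ℝ≥0∞) * g n ∂(poissonMeasure r) =
      r * ∫⁻ n, g (n + 1) ∂(poissonMeasure r) := by
  rw [lintegral_poissonMeasure, lintegral_poissonMeasure,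
    tsum_eq_zero_add' ENNReal.summable, ← ENNReal.tsum_mul_left]
  simp only [Nat.cast_zero, zero_mul, mul_zero, zero_add]
  refine tsum_congr fun n => ?_
  have h : ENNReal.ofReal (Real.exp (-r) * r ^ (n + 1) / ((n + 1).factorial : ℝ)) *
      ((n + 1 : ℕ) : ℝ≥0∞) =
      r * ENNReal.ofReal (Real.exp (-r) * r ^ n / (n.factorial : ℝ)) := by
    rw [← ENNReal.ofReal_natCast, ← ENNReal.ofReal_mul (by positivity),
      ← ENNReal.ofReal_coe_nnreal, ← ENNReal.ofReal_mul (by positivity), Nat.factorial_succ]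
    congr 1
    push_cast
    field_simp
    ring
  rw [← mul_assoc, h, mul_assoc]

lemma lintegral_natCast_poissonMeasure (r : ℝ≥0) :
    ∫⁻ n : ℕ, (n : ℝ≥0∞) ∂(poissonMeasure r) = r := by
  simpa using lintegral_poissonMeasure_natCast_mul r 1

lemma lintegral_natCast_sq_poissonMeasure (r : ℝ≥0) :
    ∫⁻ n : ℕ, (n : ℝ≥0∞) * n ∂(poissonMeasure r) = r + r * r := by
  rw [lintegral_poissonMeasure_natCast_mul]
  simp only [Nat.cast_add, Nat.cast_one]
  rw [lintegral_add_right _ measurable_const, lintegral_natCast_poissonMeasure]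
  simp
  ring

end PoissonMoments

/-! ### Poisson paths with a given mean measure -/

section PoissonPath

variable {Ω : Type*} [MeasurableSpace Ω]

/-- `X` is a random path starting from `0` with independent increments, the increment over
`(a, b]` having the Poisson law with mean `Λ (a, b]`. -/
structure IsPoissonPath (P : Measure Ω) (Λ : Measure ℝ) (X : Ω → StieltjesFunction ℝ) :
    Prop where
  measurable : Measurable X
  start_zero : ∀ ω, Tendsto (X ω) atBot (𝓝 0)
  indep_increments : HasIndepIncrements (fun (t : ℝ) (ω : Ω) => X ω t) P
  map_increment : ∀ a b, a ≤ b → ∃ Y : Ω → ℕ, Measurable Y ∧ (∀ ω, X ω b - X ω a = Y ω) ∧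
    P.map Y = poissonMeasure (Λ (Set.Ioc a b)).toNNReal

namespace IsPoissonPath

variable {P : Measure Ω} {Λ : Measure ℝ} {X : Ω → StieltjesFunction ℝ}

lemma measurable_eval (hX : IsPoissonPath P Λ X) (t : ℝ) : Measurable fun ω => X ω t :=
  (measurable_eval_real t).comp hX.measurable

lemma measurable_measure_Iic_comp (hX : IsPoissonPath P Λ X) (a : ℝ) :
    Measurable fun ω => (X ω).measure (Set.Iic a) :=
  (measurable_measure_Iic a).comp hX.measurable

lemma measurable_measure_Ioc_comp (hX : IsPoissonPath P Λ X) (a b : ℝ) :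
    Measurable fun ω => (X ω).measure (Set.Ioc a b) := by
  simp only [measure_Ioc]
  exact ((hX.measurable_eval _).sub (hX.measurable_eval _)).ennreal_ofReal

variable [IsFiniteMeasure Λ]

lemma lintegral_measure_Ioc (hX : IsPoissonPath P Λ X) {a b : ℝ} (hab : a ≤ b) :
    ∫⁻ ω, (X ω).measure (Set.Ioc a b) ∂P = Λ (Set.Ioc a b) := by
  obtain ⟨Y, hY, hXY, hl⟩ := hX.map_increment a b hab
  simp only [measure_Ioc, hXY, ENNReal.ofReal_natCast]
  rw [← lintegral_map (f := fun n : ℕ => (n : ℝ≥0∞)) .of_discrete hY, hl,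
    lintegral_natCast_poissonMeasure, ENNReal.coe_toNNReal (measure_ne_top _ _)]

lemma lintegral_measure_Ioc_sq (hX : IsPoissonPath P Λ X) {a b : ℝ} (hab : a ≤ b) :
    ∫⁻ ω, (X ω).measure (Set.Ioc a b) * (X ω).measure (Set.Ioc a b) ∂P =
      Λ (Set.Ioc a b) + Λ (Set.Ioc a b) * Λ (Set.Ioc a b) := by
  obtain ⟨Y, hY, hXY, hl⟩ := hX.map_increment a b hab
  simp only [measure_Ioc, hXY, ENNReal.ofReal_natCast]
  rw [← lintegral_map (f := fun n : ℕ => (n : ℝ≥0∞) * n) .of_discrete hY, hl,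
    lintegral_natCast_sq_poissonMeasure, ENNReal.coe_toNNReal (measure_ne_top _ _)]

lemma lintegral_measure_Ioc_mul (hX : IsPoissonPath P Λ X) {a b c : ℝ} (hab : a ≤ b)
    (hbc : b ≤ c) :
    ∫⁻ ω, (X ω).measure (Set.Ioc a b) * (X ω).measure (Set.Ioc b c) ∂P =
      Λ (Set.Ioc a b) * Λ (Set.Ioc b c) := by
  rw [← hX.lintegral_measure_Ioc hab, ← hX.lintegral_measure_Ioc hbc]
  have hi := (hX.indep_increments.indepFun_sub_sub hab hbc).comp
    ENNReal.measurable_ofReal ENNReal.measurable_ofReal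
  have hm : ∀ s t : ℝ, Measurable fun ω => (X ω).measure (Set.Ioc s t) := fun s t => by
    simp only [measure_Ioc]
    exact ((hX.measurable_eval _).sub (hX.measurable_eval _)).ennreal_ofReal
  refine lintegral_mul_eq_lintegral_mul_lintegral_of_indepFun (hm a b) (hm b c) ?_
  simpa [measure_Ioc, Function.comp_def] using hi

lemma lintegral_measure_Iic (hX : IsPoissonPath P Λ X) (a : ℝ) :
    ∫⁻ ω, (X ω).measure (Set.Iic a) ∂P = Λ (Set.Iic a) := by
  have h1 : Tendsto (fun n : ℕ => ∫⁻ ω, (X ω).measure (Set.Ioc (-(n : ℝ)) a) ∂P) atTop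
      (𝓝 (∫⁻ ω, (X ω).measure (Set.Iic a) ∂P)) := by
    refine lintegral_tendsto_of_tendsto_of_monotone
      (fun n => (hX.measurable_measure_Ioc_comp _ _).aemeasurable) ?_ ?_
    · refine .of_forall fun ω m n hmn => measure_mono (Set.Ioc_subset_Ioc_left ?_)
      exact neg_le_neg (Nat.cast_le.2 hmn)
    · exact .of_forall fun ω => tendsto_measure_Ioc_Iic _ a
  refine tendsto_nhds_unique h1 ((tendsto_measure_Ioc_Iic Λ a).congr' ?_)
  filter_upwards [eventually_ge_atTop ⌈-a⌉₊] with n hn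
  rw [hX.lintegral_measure_Ioc]
  have := Nat.ceil_le.1 hn
  linarith

lemma lintegral_measure_univ (hX : IsPoissonPath P Λ X) :
    ∫⁻ ω, (X ω).measure Set.univ ∂P = Λ Set.univ := by
  have h1 : Tendsto (fun n : ℕ => ∫⁻ ω, (X ω).measure (Set.Iic (n : ℝ)) ∂P) atTop
      (𝓝 (∫⁻ ω, (X ω).measure Set.univ ∂P)) := by
    refine lintegral_tendsto_of_tendsto_of_monotone
      (fun n => (hX.measurable_measure_Iic_comp _).aemeasurable) ?_ ?_
    · refine .of_forall fun ω m n hmn => measure_mono (Set.Iic_subset_Iic.2 ?_)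
      exact Nat.cast_le.2 hmn
    · exact .of_forall fun ω => tendsto_measure_Iic_univ _
  refine tendsto_nhds_unique h1 ((tendsto_measure_Iic_univ Λ).congr fun n => ?_)
  rw [hX.lintegral_measure_Iic]

lemma ae_measure_univ_lt_top (hX : IsPoissonPath P Λ X) :
    ∀ᵐ ω ∂P, (X ω).measure Set.univ < ∞ := by
  refine ae_lt_top (measurable_measure_univ.comp hX.measurable) ?_
  rw [hX.lintegral_measure_univ]
  exact measure_ne_top _ _

lemma ae_jumpMeasure_eq (hX : IsPoissonPath P Λ X) :
    ∀ᵐ ω ∂P, jumpMeasure (X ω) = (X ω).measure := by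
  filter_upwards [hX.ae_measure_univ_lt_top] with ω h using jumpMeasure_of_lt_top h

/-- Laws are prescribed only for increments over bounded intervals, so (-∞, a] is exhausted by (-n,
a] and monotone convergence applies. Splitting (-∞, b] at a leaves the square of one Poisson
increment and a product of independent ones; the square produces the extra term Λ(-∞, a]. -/
lemma lintegral_measure_Iic_mul (hX : IsPoissonPath P Λ X) {a b : ℝ} (hab : a ≤ b) :
    ∫⁻ ω, (X ω).measure (Set.Iic a) * (X ω).measure (Set.Iic b) ∂P =
      Λ (Set.Iic a) + Λ (Set.Iic a) * Λ (Set.Iic b) := by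
  have split : ∀ μ : Measure ℝ, μ (Set.Iic b) = μ (Set.Iic a) + μ (Set.Ioc a b) := fun μ => by
    rw [← Set.Iic_union_Ioc_eq_Iic hab, measure_union (Set.Iic_disjoint_Ioc le_rfl)
      measurableSet_Ioc]
  let F : ℕ → Measure ℝ → ℝ≥0∞ := fun n μ =>
    μ (Set.Ioc (-(n : ℝ)) a) * (μ (Set.Ioc (-(n : ℝ)) a) + μ (Set.Ioc a b))
  have hlt : ∀ x : StieltjesFunction ℝ, x.measure (Set.Ioc a b) ≠ ∞ := fun x => by
    rw [measure_Ioc]; exact ENNReal.ofReal_ne_top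
  have hmono : ∀ (μ : Measure ℝ), Monotone fun n : ℕ => μ (Set.Ioc (-(n : ℝ)) a) :=
    fun μ m n hmn => measure_mono (Set.Ioc_subset_Ioc_left (neg_le_neg (Nat.cast_le.2 hmn)))
  have hfin := hX.ae_measure_univ_lt_top
  have h1 : Tendsto (fun n : ℕ => ∫⁻ ω, F n (X ω).measure ∂P) atTop
      (𝓝 (∫⁻ ω, (X ω).measure (Set.Iic a) * (X ω).measure (Set.Iic b) ∂P)) := by
    refine lintegral_tendsto_of_tendsto_of_monotone (fun n => ?_) ?_ ?_
    · have h := hX.measurable_measure_Ioc_comp (-(n : ℝ)) a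
      exact (h.mul (h.add (hX.measurable_measure_Ioc_comp a b))).aemeasurable
    · refine .of_forall fun ω m n hmn => ?_
      have := hmono (X ω).measure hmn
      exact mul_le_mul' this (add_le_add this le_rfl)
    · filter_upwards [hfin] with ω hω
      have hne : ∀ s, (X ω).measure s ≠ ∞ := fun s =>
        ((measure_mono (Set.subset_univ s)).trans_lt hω).ne
      have ht := tendsto_measure_Ioc_Iic (X ω).measure a
      rw [split (X ω).measure]
      exact ENNReal.Tendsto.mul ht (.inr (by simp [hne])) (ht.add_const _) (.inr (hne _))
  have h2 : Tendsto (fun n : ℕ => Λ (Set.Ioc (-(n : ℝ)) a) + F n Λ) atTop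
      (𝓝 (Λ (Set.Iic a) + Λ (Set.Iic a) * Λ (Set.Iic b))) := by
    have ht := tendsto_measure_Ioc_Iic Λ a
    rw [split Λ]
    exact ht.add (ENNReal.Tendsto.mul ht (.inr (by simp)) (ht.add_const _)
      (.inr (measure_ne_top _ _)))
  refine tendsto_nhds_unique h1 (h2.congr' ?_)
  filter_upwards [eventually_ge_atTop ⌈-a⌉₊] with n hn
  have hna : -(n : ℝ) ≤ a := by
    have := Nat.ceil_le.1 hn
    linarith
  have hm := hX.measurable_measure_Ioc_comp (-(n : ℝ)) a
  simp only [F, mul_add]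
  rw [lintegral_add_left (by fun_prop), hX.lintegral_measure_Ioc_sq hna,
    hX.lintegral_measure_Ioc_mul hna hab, add_assoc]

lemma lintegral_measure_Iic_mul' (hX : IsPoissonPath P Λ X) (a b : ℝ) :
    ∫⁻ ω, (X ω).measure (Set.Iic a) * (X ω).measure (Set.Iic b) ∂P =
      Λ (Set.Iic (a ⊓ b)) + Λ (Set.Iic a) * Λ (Set.Iic b) := by
  rcases le_total a b with h | h
  · rw [inf_eq_left.2 h, hX.lintegral_measure_Iic_mul h]
  · rw [inf_eq_right.2 h, mul_comm (Λ _), ← hX.lintegral_measure_Iic_mul h]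
    simp only [mul_comm]

/-- Campbell's formula: the mean of the jump measure. -/
lemma jumpKernel_comp (hX : IsPoissonPath P Λ X) : jumpKernel ∘ₘ (P.map X) = Λ := by
  have hb : ∀ s, MeasurableSet s → (jumpKernel ∘ₘ (P.map X)) s =
      ∫⁻ ω, (X ω).measure s ∂P := fun s hs => by
    rw [Measure.bind_apply hs jumpKernel.measurable.aemeasurable,
      lintegral_map (jumpKernel.measurable_coe hs) hX.measurable]
    refine lintegral_congr_ae ?_
    filter_upwards [hX.ae_jumpMeasure_eq] with ω hω
    rw [jumpKernel_apply, hω]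
  symm
  refine ext_of_generate_finite _ (BorelSpace.measurable_eq.trans
    (borel_eq_generateFrom_Iic ℝ)) isPiSystem_Iic ?_ ?_
  · rintro _ ⟨a, rfl⟩
    rw [hb _ measurableSet_Iic, hX.lintegral_measure_Iic]
  · rw [hb _ .univ, hX.lintegral_measure_univ]

/-- The second moment measure of a Poisson path. -/
lemma jumpKernel_prod_comp (hX : IsPoissonPath P Λ X) :
    (jumpKernel ×ₖ jumpKernel) ∘ₘ (P.map X) = Λ.prod Λ + Λ.map (fun t => (t, t)) := by
  have hd : Measurable fun t : ℝ => (t, t) := by fun_prop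
  have hb : ∀ a b, ((jumpKernel ×ₖ jumpKernel) ∘ₘ (P.map X)) (Set.Iic a ×ˢ Set.Iic b) =
      (Λ.prod Λ + Λ.map (fun t => (t, t))) (Set.Iic a ×ˢ Set.Iic b) := fun a b => by
    have hs : MeasurableSet (Set.Iic a ×ˢ Set.Iic b) := measurableSet_Iic.prod measurableSet_Iic
    rw [Measure.bind_apply hs (jumpKernel ×ₖ jumpKernel).measurable.aemeasurable,
      lintegral_map ((jumpKernel ×ₖ jumpKernel).measurable_coe hs) hX.measurable,
      Measure.add_apply, Measure.prod_prod, Measure.map_apply hd hs]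
    have : (fun t : ℝ => (t, t)) ⁻¹' (Set.Iic a ×ˢ Set.Iic b) = Set.Iic (a ⊓ b) := by
      ext t; simp
    rw [this, add_comm, ← hX.lintegral_measure_Iic_mul']
    refine lintegral_congr_ae ?_
    filter_upwards [hX.ae_jumpMeasure_eq] with ω hω
    rw [Kernel.prod_apply, jumpKernel_apply, Measure.prod_prod, hω]
  have hspan : IsCountablySpanning (Set.range (Set.Iic : ℝ → Set ℝ)) := by
    refine ⟨fun n : ℕ => Set.Iic (n : ℝ), fun n => ⟨_, rfl⟩, ?_⟩
    ext t
    simp [exists_nat_ge t]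
  have hgen : MeasurableSpace.generateFrom (Set.range (Set.Iic : ℝ → Set ℝ)) =
      Real.measurableSpace := (BorelSpace.measurable_eq.trans (borel_eq_generateFrom_Iic ℝ)).symm
  refine Measure.ext_of_generateFrom_of_iUnion _
    (fun n : ℕ => Set.Iic (n : ℝ) ×ˢ Set.Iic (n : ℝ))
    (generateFrom_eq_prod hgen hgen hspan hspan).symm
    (isPiSystem_Iic.prod isPiSystem_Iic) ?_ ?_ ?_ ?_
  · ext ⟨s, t⟩
    simp only [Set.mem_iUnion, Set.mem_prod, Set.mem_Iic, Set.mem_univ, iff_true]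
    obtain ⟨n, hn⟩ := exists_nat_ge (s ⊔ t)
    exact ⟨n, le_sup_left.trans hn, le_sup_right.trans hn⟩
  · exact fun n => ⟨_, ⟨_, rfl⟩, _, ⟨_, rfl⟩, rfl⟩
  · intro n
    rw [hb]
    exact measure_ne_top _ _
  · rintro _ ⟨_, ⟨a, rfl⟩, _, ⟨b, rfl⟩, rfl⟩
    exact hb a b

end IsPoissonPath

end PoissonPath

/-! ### Moments of linear statistics, uniqueness of the law, Poisson processes as Poisson paths -/

section PoissonPathIntegral

variable {Ω : Type*} [MeasurableSpace Ω]

namespace IsPoissonPath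

variable {P : Measure Ω} {Λ : Measure ℝ} {X : Ω → StieltjesFunction ℝ}

/-- Campbell's formula for the mean of a linear statistic of a Poisson path. -/
lemma integral_integral_jumpMeasure [IsFiniteMeasure Λ] [IsFiniteMeasure P]
    (hX : IsPoissonPath P Λ X) {f : ℝ → ℝ}
    (hf : Measurable f) {C : ℝ} (hC : ∀ t, |f t| ≤ C) :
    ∫ ω, ∫ t, f t ∂(jumpMeasure (X ω)) ∂P = ∫ t, f t ∂Λ := by
  have hi : Integrable f Λ := .of_bound hf.aestronglyMeasurable C (.of_forall hC)
  have hm : StronglyMeasurable fun x : StieltjesFunction ℝ => ∫ t, f t ∂(jumpKernel x) :=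
    hf.stronglyMeasurable.integral_kernel
  have := Kernel.integral_comp (κ := Kernel.const Unit (P.map X)) (a := ()) (η := jumpKernel)
    (f := f) (by rwa [← Measure.comp_eq_comp_const_apply, hX.jumpKernel_comp])
  rw [← Measure.comp_eq_comp_const_apply, hX.jumpKernel_comp, Kernel.const_apply,
    integral_map hX.measurable.aemeasurable hm.aestronglyMeasurable] at this
  exact this.symm

/-- The squared statistic is the integral of f ⊗ f against the product of the jump measure with
itself, so its mean is read off the second moment measure; the diagonal part yields ∫ f² dΛ. -/
lemma integrable_integral_jumpMeasure_sq [IsFiniteMeasure Λ] [IsFiniteMeasure P]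
    (hX : IsPoissonPath P Λ X)
    {f : ℝ → ℝ} (hf : Measurable f) {C : ℝ} (hC : ∀ t, |f t| ≤ C) :
    Integrable (fun ω => (∫ t, f t ∂(jumpMeasure (X ω))) ^ 2) P ∧
    ∫ ω, (∫ t, f t ∂(jumpMeasure (X ω))) ^ 2 ∂P = (∫ t, f t ∂Λ) ^ 2 + ∫ t, f t ^ 2 ∂Λ := by
  let F : ℝ × ℝ → ℝ := fun p => f p.1 * f p.2
  have hF : Measurable F := by fun_prop
  have hFC : ∀ p, ‖F p‖ ≤ C * C := fun p => by
    rw [norm_mul]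
    exact mul_le_mul (hC _) (hC _) (norm_nonneg _) ((abs_nonneg _).trans (hC p.1))
  have hFi : ∀ (μ : Measure (ℝ × ℝ)) [IsFiniteMeasure μ], Integrable F μ := fun μ _ =>
    .of_bound hF.aestronglyMeasurable _ (.of_forall hFC)
  have hsq : ∀ μ : Measure ℝ, [IsFiniteMeasure μ] →
      ∫ p, F p ∂(μ.prod μ) = (∫ t, f t ∂μ) ^ 2 := fun μ _ => by
    rw [integral_prod_mul, sq]
  have hi : Integrable F (((jumpKernel ×ₖ jumpKernel) ∘ₖ Kernel.const Unit (P.map X)) ()) := by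
    rw [← Measure.comp_eq_comp_const_apply, hX.jumpKernel_prod_comp]
    exact hFi _
  have hm : StronglyMeasurable fun x : StieltjesFunction ℝ =>
      ∫ p, F p ∂((jumpKernel ×ₖ jumpKernel) x) := hF.stronglyMeasurable.integral_kernel
  have hpt : ∀ x : StieltjesFunction ℝ, ∫ p, F p ∂((jumpKernel ×ₖ jumpKernel) x) =
      (∫ t, f t ∂(jumpMeasure x)) ^ 2 := fun x => by
    rw [Kernel.prod_apply, jumpKernel_apply, hsq]
  have h1 := hi.integral_comp
  have h2 := Kernel.integral_comp hi
  rw [Kernel.const_apply, integrable_map_measure hm.aestronglyMeasurable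
    hX.measurable.aemeasurable] at h1
  rw [← Measure.comp_eq_comp_const_apply, hX.jumpKernel_prod_comp, Kernel.const_apply,
    integral_map hX.measurable.aemeasurable hm.aestronglyMeasurable,
    integral_add_measure (hFi _) (hFi _), hsq,
    integral_map (by fun_prop) hF.aestronglyMeasurable] at h2
  simp only [Function.comp_def, hpt] at h1 h2
  refine ⟨h1, h2.symm.trans ?_⟩
  simp only [F, sq]

/-- Two Poisson paths with the same mean measure have the same law. -/
lemma map_eq [IsProbabilityMeasure P] (hX : IsPoissonPath P Λ X) {Y : Ω → StieltjesFunction ℝ}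
    (hY : IsPoissonPath P Λ Y) : P.map X = P.map Y := by
  suffices h : P.map (fun ω t => X ω t) = P.map (fun ω t => Y ω t) by
    ext s hs
    obtain ⟨s', hs', rfl⟩ := hs
    have hms := measurable_coe_real hs'
    rw [Measure.map_apply hX.measurable hms, Measure.map_apply hY.measurable hms]
    have : P.map (fun ω t => X ω t) s' = P.map (fun ω t => Y ω t) s' := by rw [h]
    have hXm : Measurable fun ω t => X ω t := measurable_coe_real.comp hX.measurable
    have hYm : Measurable fun ω t => Y ω t := measurable_coe_real.comp hY.measurable
    rwa [Measure.map_apply hXm hs', Measure.map_apply hYm hs'] at this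
  rw [map_eq_iff_forall_finset_map_restrict_eq (X := fun t ω => X ω t) (Y := fun t ω => Y ω t)
    (measurable_coe_real.comp hX.measurable).aemeasurable
    (measurable_coe_real.comp hY.measurable).aemeasurable]
  intro I
  obtain ⟨m, hm⟩ := I.bddBelow
  have hmI : ∀ (n : ℕ) (t : I), m - n ≤ t := fun n t =>
    (sub_le_self _ (Nat.cast_nonneg n)).trans (hm t.2)
  -- The reference time m - n lies to the left of all of `I`. Put in front as index 0, it turns each
  -- Z(t) - Z(m - n) into a sum of consecutive independent increments with prescribed laws.
  let τ : ℕ → Fin (I.card + 1) → ℝ := fun n => Fin.cons (m - n) (I.orderEmbOfFin rfl)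
  have hτ : ∀ n, Monotone (τ n) := fun n => by
    intro i j hij
    rcases Fin.eq_zero_or_eq_succ i with rfl | ⟨i, rfl⟩
    · rcases Fin.eq_zero_or_eq_succ j with rfl | ⟨j, rfl⟩
      · exact le_rfl
      · simp only [τ, Fin.cons_zero, Fin.cons_succ]
        exact hmI n ⟨_, I.orderEmbOfFin_mem rfl j⟩
    · rcases Fin.eq_zero_or_eq_succ j with rfl | ⟨j, rfl⟩
      · simp at hij
      · simp only [τ, Fin.cons_succ]
        exact (I.orderEmbOfFin rfl).monotone (by simpa using hij)
  have key : ∀ {Z : Ω → StieltjesFunction ℝ}, IsPoissonPath P Λ Z → ∀ n : ℕ,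
      P.map (fun ω (t : I) => Z ω t - Z ω (m - n)) =
        (Measure.pi fun i : Fin I.card => ((poissonMeasure
          (Λ (Set.Ioc (τ n i.castSucc) (τ n i.succ))).toNNReal).map (fun j : ℕ => (j : ℝ)))).map
          (fun x (t : I) => ∑ j ≤ (I.orderIsoOfFin rfl).symm t, x j) := by
    intro Z hZ n
    have hmeas : ∀ i : Fin I.card, Measurable fun ω => Z ω (τ n i.succ) - Z ω (τ n i.castSucc) :=
      fun i => (hZ.measurable_eval _).sub (hZ.measurable_eval _)
    have h1 := (iIndepFun_iff_map_fun_eq_pi_map fun i => (hmeas i).aemeasurable).1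
      (hZ.indep_increments _ (τ n) (hτ n))
    have h2 : ∀ i : Fin I.card, P.map (fun ω => Z ω (τ n i.succ) - Z ω (τ n i.castSucc)) =
        (poissonMeasure (Λ (Set.Ioc (τ n i.castSucc) (τ n i.succ))).toNNReal).map
          (fun j : ℕ => (j : ℝ)) := fun i => by
      obtain ⟨N, hN, hZN, hl⟩ := hZ.map_increment _ _ (hτ n (Fin.castSucc_le_succ i))
      rw [← hl, Measure.map_map .of_discrete hN]
      exact congrArg (P.map ·) (funext hZN)
    simp only [h2] at h1
    rw [← h1, Measure.map_map (by fun_prop) (measurable_pi_lambda _ hmeas)]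
    congr 1
    ext ω t
    simp only [Function.comp_apply]
    rw [Fin.sum_Iic_sub _ (fun j => Z ω (τ n j))]
    congr 2
    simp only [τ, Fin.cons_succ]
    rw [← Finset.coe_orderIsoOfFin_apply, OrderIso.apply_symm_apply]
  -- Since paths start from 0 at -∞, the reference value disappears as n → ∞; the equality of laws
  -- for each n then passes to the limit.
  have lim : ∀ {Z : Ω → StieltjesFunction ℝ}, IsPoissonPath P Λ Z →
      TendstoInDistribution (fun (n : ℕ) ω (t : I) => Z ω t - Z ω (m - n)) atTop
        (fun ω (t : I) => Z ω t) (fun _ => P) P := fun {Z} hZ => by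
    refine tendstoInDistribution_of_ae_tendsto (fun n => ?_) ?_ (.of_forall fun ω => ?_)
    · exact (measurable_pi_lambda _ fun t =>
        (hZ.measurable_eval _).sub (hZ.measurable_eval _)).aemeasurable
    · exact (measurable_pi_lambda _ fun t => hZ.measurable_eval _).aemeasurable
    · refine tendsto_pi_nhds.2 fun t => ?_
      have : Tendsto (fun n : ℕ => m - (n : ℝ)) atTop atBot :=
        tendsto_atBot_add_const_left _ m
          (tendsto_neg_atTop_atBot.comp tendsto_natCast_atTop_atTop)
      simpa using ((hZ.start_zero ω).comp this).const_sub (Z ω t)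
  have hXl := lim hX
  have hYl : TendstoInDistribution (fun (n : ℕ) ω (t : I) => X ω t - X ω (m - n)) atTop
        (fun ω (t : I) => Y ω t) (fun _ => P) P := by
    exact ⟨hXl.forall_aemeasurable, (lim hY).aemeasurable_limit, (lim hY).tendsto.congr
      fun n => Subtype.ext ((key hY n).trans (key hX n).symm)⟩
  exact tendstoInDistribution_unique _ hXl hYl

end IsPoissonPath

/-- The mean measure on `T` with intensity `lam`. -/
noncomputable def intensityMeasure (T : Set ℝ) (lam : ℝ → ℝ) : Measure ℝ :=
  (volume.restrict T).withDensity fun t => ENNReal.ofReal (lam t)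

lemma isFiniteMeasure_intensityMeasure {T : Set ℝ} {lam : ℝ → ℝ} (hi : IntegrableOn lam T) :
    IsFiniteMeasure (intensityMeasure T lam) :=
  isFiniteMeasure_withDensity_ofReal hi.2

lemma intensityMeasure_apply {T : Set ℝ} (hT : MeasurableSet T) {lam : ℝ → ℝ}
    (hi : IntegrableOn lam T) (hpos : ∀ t ∈ T, 0 < lam t) {s : Set ℝ} (hs : MeasurableSet s) :
    intensityMeasure T lam s = ENNReal.ofReal (∫ t in s ∩ T, lam t) := by
  rw [intensityMeasure, withDensity_apply _ hs, Measure.restrict_restrict hs,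
    ofReal_integral_eq_lintegral_ofReal (hi.mono_set Set.inter_subset_right)]
  exact (ae_restrict_iff' (hs.inter hT)).2 (.of_forall fun t ht => (hpos t ht.2).le)

lemma integral_intensityMeasure {T : Set ℝ} (hT : MeasurableSet T) {lam : ℝ → ℝ}
    (hi : IntegrableOn lam T) (hpos : ∀ t ∈ T, 0 < lam t) {E : Type*} [NormedAddCommGroup E]
    [NormedSpace ℝ E] (f : ℝ → E) :
    ∫ t, f t ∂(intensityMeasure T lam) = ∫ t in T, lam t • f t := by
  rw [intensityMeasure, integral_withDensity_eq_integral_toReal_smul₀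
    hi.1.aemeasurable.ennreal_ofReal (.of_forall fun t => ENNReal.ofReal_lt_top)]
  refine setIntegral_congr_fun hT fun t ht => ?_
  simp only [ENNReal.toReal_ofReal (hpos t ht).le]

lemma IsPoissonProcess.isPoissonPath {P : Measure Ω} [IsProbabilityMeasure P] {T : Set ℝ}
    (hT : MeasurableSet T) {lam : ℝ → ℝ} (hi : IntegrableOn lam T) (hpos : ∀ t ∈ T, 0 < lam t)
    {X : Ω → StieltjesFunction ℝ} (hX : IsPoissonProcess P T lam X) :
    IsPoissonPath P (intensityMeasure T lam) X where
  measurable := measurable_of_eval hX.measurable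
  start_zero := hX.start_zero
  indep_increments := hX.indep_increments
  map_increment a b hab := by
    have hd : Measurable fun ω => X ω b - X ω a := (hX.measurable b).sub (hX.measurable a)
    have hY : ∀ ω, X ω b - X ω a = (⌊X ω b - X ω a⌋₊ : ℕ) := fun ω => by
      obtain ⟨m, hm⟩ := hX.counting ω b
      obtain ⟨k, hk⟩ := hX.counting ω a
      have hle : k ≤ m := by
        have := (X ω).mono hab
        rw [hm, hk] at this
        exact_mod_cast this
      rw [hm, hk, ← Nat.cast_sub hle, Nat.floor_natCast]
    refine ⟨fun ω => ⌊X ω b - X ω a⌋₊, hd.nat_floor, hY, ?_⟩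
    refine Measure.ext_of_singleton fun m => ?_
    rw [Measure.map_apply hd.nat_floor (measurableSet_singleton m), poissonMeasure_singleton]
    have hset : (fun ω => ⌊X ω b - X ω a⌋₊) ⁻¹' {m} = {ω | X ω b - X ω a = m} := by
      ext ω
      simp only [Set.mem_preimage, Set.mem_singleton_iff, Set.mem_ofPred_eq]
      refine ⟨fun h => by rw [hY, h], fun h => by rw [h, Nat.floor_natCast]⟩
    rw [hset]
    have hnn : 0 ≤ ∫ t in Set.Ioc a b ∩ T, lam t :=
      setIntegral_nonneg (measurableSet_Ioc.inter hT) fun t ht => (hpos t ht.2).le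
    -- The prescribed law covers only t₁ < t₂; the empty interval has zero increment and mean 0.
    rcases hab.lt_or_eq with hlt | rfl
    · rw [hX.increment_law a b hlt, intensityMeasure_apply hT hi hpos measurableSet_Ioc]
      have hr : ((ENNReal.ofReal (∫ t in Set.Ioc a b ∩ T, lam t)).toNNReal : ℝ) =
          ∫ t in Set.Ioc a b ∩ T, lam t := ENNReal.toReal_ofReal hnn
      rw [hr]
      congr 1
      ring
    · simp only [sub_self, Set.Ioc_self, measure_empty, ENNReal.toNNReal_zero, NNReal.coe_zero,
        neg_zero, Real.exp_zero, one_mul]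
      rcases m with _ | m
      · simp
      · have : (0 : ℝ) ≠ ((m + 1 : ℕ) : ℝ) := (Nat.cast_pos.2 m.succ_pos).ne
        simp only [this]
        simp

end PoissonPathIntegral

/-! ### Bounds on the intensity and the score from bounded log-derivatives -/

section ModelBounds

variable {d : ℕ}

lemma Real.abs_exp_sub_one_sub_id_le_sq_mul_exp (x : ℝ) :
    |Real.exp x - 1 - x| ≤ x ^ 2 * Real.exp |x| := by
  have h := Complex.norm_exp_sub_sum_le_norm_mul_exp (x : ℂ) 2
  simp only [Finset.sum_range_succ, Finset.range_zero, Finset.sum_empty, pow_zero, pow_one,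
    Nat.factorial_zero, Nat.factorial_one, Nat.cast_one, div_one, zero_add, Complex.norm_real,
    Real.norm_eq_abs, sq_abs] at h
  rw [← sub_sub] at h
  exact_mod_cast h

/-- Lipschitz and growth bounds for a family of intensities and its score. -/
structure ScoreBounds (Θ : Set (EuclideanSpace ℝ (Fin d))) (T : Set ℝ)
    (lam : EuclideanSpace ℝ (Fin d) → ℝ → ℝ) (ϑ₀ : EuclideanSpace ℝ (Fin d)) (K : ℝ) : Prop where
  nonneg : 0 ≤ K
  norm_score_le : ∀ ϑ ∈ Θ, ∀ t ∈ T, ‖score lam ϑ t‖ ≤ K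
  norm_score_sub_le : ∀ ϑ ∈ Θ, ∀ ϑ' ∈ Θ, ∀ t ∈ T,
    ‖score lam ϑ t - score lam ϑ' t‖ ≤ K * ‖ϑ - ϑ'‖
  le_mul : ∀ ϑ ∈ Θ, ∀ t ∈ T, lam ϑ t ≤ K * lam ϑ₀ t
  abs_sub_le : ∀ ϑ ∈ Θ, ∀ ϑ' ∈ Θ, ∀ t ∈ T,
    |lam ϑ' t - lam ϑ t| ≤ K * lam ϑ₀ t * ‖ϑ' - ϑ‖
  abs_sub_sub_le : ∀ ϑ ∈ Θ, ∀ ϑ' ∈ Θ, ∀ t ∈ T,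
    |lam ϑ' t - lam ϑ t - lam ϑ t * ⟪score lam ϑ t, ϑ' - ϑ⟫| ≤ K * lam ϑ₀ t * ‖ϑ' - ϑ‖ ^ 2

variable {Θ : Set (EuclideanSpace ℝ (Fin d))} {T : Set ℝ}
  {lam : EuclideanSpace ℝ (Fin d) → ℝ → ℝ} {ϑ₀ : EuclideanSpace ℝ (Fin d)}

lemma IsRegularModel.hasGradientAt_log (hreg : IsRegularModel Θ T lam) (hΘo : IsOpen Θ)
    {ϑ : EuclideanSpace ℝ (Fin d)} (hϑ : ϑ ∈ Θ) {t : ℝ} (ht : t ∈ T) :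
    HasGradientAt (fun θ => Real.log (lam θ t)) (score lam ϑ t) ϑ :=
  (((hreg.contDiff t ht).contDiffAt (hΘo.mem_nhds hϑ)).differentiableAt
    (by norm_num)).hasGradientAt

/-- Differentiate λ = exp(log λ), an identity valid near ϑ because Θ is open and λ is positive
there. -/
lemma IsRegularModel.gradient_eq (hreg : IsRegularModel Θ T lam) (hlam : IsIntensityFamily Θ T lam)
    (hΘo : IsOpen Θ) {ϑ : EuclideanSpace ℝ (Fin d)} (hϑ : ϑ ∈ Θ) {t : ℝ} (ht : t ∈ T) :
    gradient (fun θ => lam θ t) ϑ = lam ϑ t • score lam ϑ t := by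
  have h := (hasGradientAt_iff_hasFDerivAt.1 (hreg.hasGradientAt_log hΘo hϑ ht)).exp
  refine HasGradientAt.gradient (hasGradientAt_iff_hasFDerivAt.2 ?_)
  rw [Real.exp_log (hlam.pos ϑ hϑ t ht)] at h
  rw [map_smul]
  refine h.congr_of_eventuallyEq ?_
  filter_upwards [hΘo.mem_nhds hϑ] with θ hθ using (Real.exp_log (hlam.pos θ hθ t ht)).symm

/-- The mean value inequality on the convex set Θ, applied to log λ and to its derivative. -/
lemma IsRegularModel.exists_score_bound (hreg : IsRegularModel Θ T lam) (hΘo : IsOpen Θ)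
    (hΘc : Convex ℝ Θ) :
    ∃ C : ℝ, 0 ≤ C ∧ ∀ t ∈ T, ∀ ϑ ∈ Θ, ∀ ϑ' ∈ Θ,
      ‖score lam ϑ t‖ ≤ C ∧
      ‖score lam ϑ t - score lam ϑ' t‖ ≤ C * ‖ϑ - ϑ'‖ ∧
      |Real.log (lam ϑ' t) - Real.log (lam ϑ t)| ≤ C * ‖ϑ' - ϑ‖ ∧
      |Real.log (lam ϑ' t) - Real.log (lam ϑ t) - ⟪score lam ϑ t, ϑ' - ϑ⟫| ≤
        C * ‖ϑ' - ϑ‖ ^ 2 := by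
  obtain ⟨C, hC⟩ := hreg.bounded
  refine ⟨|C|, abs_nonneg C, fun t ht => ?_⟩
  let f : EuclideanSpace ℝ (Fin d) → ℝ := fun θ => Real.log (lam θ t)
  have hf : ∀ x ∈ Θ, ContDiffAt ℝ 3 f x := fun x hx =>
    (hreg.contDiff t ht).contDiffAt (hΘo.mem_nhds hx)
  have hd : ∀ x ∈ Θ, DifferentiableAt ℝ f x := fun x hx => (hf x hx).differentiableAt (by norm_num)
  have h1 : ∀ x ∈ Θ, ‖fderiv ℝ f x‖ ≤ |C| := fun x hx => by
    rw [← norm_iteratedFDeriv_one]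
    exact (hC x hx t ht 1 le_rfl (by norm_num)).trans (le_abs_self C)
  have hd2 : ∀ x ∈ Θ, DifferentiableAt ℝ (fderiv ℝ f) x := fun x hx =>
    ((hf x hx).fderiv_right (m := 1) (by norm_num)).differentiableAt (by norm_num)
  have h2 : ∀ x ∈ Θ, ‖fderiv ℝ (fderiv ℝ f) x‖ ≤ |C| := fun x hx => by
    rw [← norm_iteratedFDeriv_one, norm_iteratedFDeriv_fderiv]
    exact (hC x hx t ht 2 (by norm_num) (by norm_num)).trans (le_abs_self C)
  have hlip : ∀ x ∈ Θ, ∀ y ∈ Θ, ‖fderiv ℝ f y - fderiv ℝ f x‖ ≤ |C| * ‖y - x‖ :=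
    fun x hx y hy => hΘc.norm_image_sub_le_of_norm_fderiv_le hd2 h2 hx hy
  have hs : ∀ x, score lam x t =
      (InnerProductSpace.toDual ℝ (EuclideanSpace ℝ (Fin d))).symm (fderiv ℝ f x) :=
    fun x => rfl
  intro ϑ hϑ ϑ' hϑ'
  refine ⟨?_, ?_, ?_, ?_⟩
  · rw [hs, LinearIsometryEquiv.norm_map]
    exact h1 ϑ hϑ
  · rw [hs, hs, ← map_sub, LinearIsometryEquiv.norm_map]
    exact hlip _ hϑ' _ hϑ
  · exact hΘc.norm_image_sub_le_of_norm_fderiv_le hd h1 hϑ hϑ'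
  -- Along the segment the derivative stays within |C| ‖ϑ' - ϑ‖ of its value at ϑ; the mean value
  -- inequality with that linear map subtracted gives the quadratic bound.
  · have hseg : segment ℝ ϑ ϑ' ⊆ Θ := hΘc.segment_subset hϑ hϑ'
    have := (convex_segment ϑ ϑ').norm_image_sub_le_of_norm_hasFDerivWithin_le' (f := f)
      (f' := fderiv ℝ f) (φ := fderiv ℝ f ϑ) (C := |C| * ‖ϑ' - ϑ‖)
      (fun x hx => (hd x (hseg hx)).hasFDerivAt.hasFDerivWithinAt)
      (fun x hx => (hlip _ hϑ _ (hseg hx)).trans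
        (mul_le_mul_of_nonneg_left (norm_sub_le_of_mem_segment hx) (abs_nonneg C)))
      (left_mem_segment ℝ ϑ ϑ') (right_mem_segment ℝ ϑ ϑ')
    rw [hs, InnerProductSpace.toDual_symm_apply, sq, ← mul_assoc]
    exact this

/-- Only log λ is controlled by hypothesis. As Θ is bounded, log-ratios of intensities are bounded,
so every intensity is dominated by a multiple of the one at ϑ₀, which is integrable. -/
lemma IsRegularModel.exists_scoreBounds (hreg : IsRegularModel Θ T lam)
    (hlam : IsIntensityFamily Θ T lam) (hΘo : IsOpen Θ) (hΘc : Convex ℝ Θ)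
    (hΘb : Bornology.IsBounded Θ) (hϑ₀ : ϑ₀ ∈ Θ) :
    ∃ K : ℝ, ScoreBounds Θ T lam ϑ₀ K := by
  obtain ⟨C, hC0, hC⟩ := hreg.exists_score_bound hΘo hΘc
  obtain ⟨D, hD⟩ := hΘb.exists_norm_le
  have hD0 : 0 ≤ D := (norm_nonneg _).trans (hD ϑ₀ hϑ₀)
  have hdist : ∀ x ∈ Θ, ∀ y ∈ Θ, ‖x - y‖ ≤ 2 * D := fun x hx y hy => by
    have := norm_sub_le x y
    linarith [hD x hx, hD y hy]
  -- 2D bounds the diameter of Θ, so `R` bounds the ratio of any two intensities of the family.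
  set R := Real.exp (C * (2 * D)) with hR
  have hR1 : 1 ≤ R := Real.one_le_exp (by positivity)
  have hlog : ∀ x ∈ Θ, ∀ y ∈ Θ, ∀ t ∈ T,
      |Real.log (lam x t) - Real.log (lam y t)| ≤ C * (2 * D) := fun x hx y hy t ht =>
    (hC t ht y hy x hx).2.2.1.trans (mul_le_mul_of_nonneg_left (hdist _ hx _ hy) hC0)
  have hratio : ∀ x ∈ Θ, ∀ y ∈ Θ, ∀ t ∈ T,
      lam x t = lam y t * Real.exp (Real.log (lam x t) - Real.log (lam y t)) :=
    fun x hx y hy t ht => by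
      rw [Real.exp_sub, Real.exp_log (hlam.pos x hx t ht), Real.exp_log (hlam.pos y hy t ht)]
      rw [mul_div_cancel₀ _ (hlam.pos y hy t ht).ne']
  have hle : ∀ x ∈ Θ, ∀ t ∈ T, lam x t ≤ R * lam ϑ₀ t := fun x hx t ht => by
    rw [hratio x hx ϑ₀ hϑ₀ t ht, mul_comm]
    exact mul_le_mul_of_nonneg_right
      (Real.exp_le_exp.2 ((le_abs_self _).trans (hlog x hx ϑ₀ hϑ₀ t ht)))
      (hlam.pos ϑ₀ hϑ₀ t ht).le
  have htaylor : ∀ ϑ ∈ Θ, ∀ ϑ' ∈ Θ, ∀ t ∈ T,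
      |lam ϑ' t - lam ϑ t - lam ϑ t * ⟪score lam ϑ t, ϑ' - ϑ⟫| ≤
        R * (C ^ 2 * R + C) * lam ϑ₀ t * ‖ϑ' - ϑ‖ ^ 2 := fun ϑ hϑ ϑ' hϑ' t ht => by
    have hp := hlam.pos ϑ hϑ t ht
    set x := Real.log (lam ϑ' t) - Real.log (lam ϑ t) with hx
    -- With x the log-ratio, λ(ϑ') = λ(ϑ) eˣ. The error splits into the remainder of the exponential
    -- and the Taylor remainder of log λ, both quadratic in ϑ' - ϑ.
    have e1 : lam ϑ' t - lam ϑ t - lam ϑ t * ⟪score lam ϑ t, ϑ' - ϑ⟫ =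
        lam ϑ t * ((Real.exp x - 1 - x) + (x - ⟪score lam ϑ t, ϑ' - ϑ⟫)) := by
      rw [hratio ϑ' hϑ' ϑ hϑ t ht]
      ring
    have hx1 : |x| ≤ C * ‖ϑ' - ϑ‖ := (hC t ht ϑ hϑ ϑ' hϑ').2.2.1
    have hx2 : |x| ≤ C * (2 * D) := hlog ϑ' hϑ' ϑ hϑ t ht
    have e2 : |Real.exp x - 1 - x| ≤ C ^ 2 * R * ‖ϑ' - ϑ‖ ^ 2 := by
      refine (Real.abs_exp_sub_one_sub_id_le_sq_mul_exp x).trans ?_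
      have : x ^ 2 ≤ (C * ‖ϑ' - ϑ‖) ^ 2 := by
        rw [← sq_abs x]
        exact pow_le_pow_left₀ (abs_nonneg x) hx1 2
      calc x ^ 2 * Real.exp |x| ≤ (C * ‖ϑ' - ϑ‖) ^ 2 * R :=
            mul_le_mul this (Real.exp_le_exp.2 hx2) (Real.exp_pos _).le (sq_nonneg _)
        _ = C ^ 2 * R * ‖ϑ' - ϑ‖ ^ 2 := by ring
    have e3 := (hC t ht ϑ hϑ ϑ' hϑ').2.2.2
    rw [e1, abs_mul, abs_of_pos hp]
    calc lam ϑ t * |(Real.exp x - 1 - x) + (x - ⟪score lam ϑ t, ϑ' - ϑ⟫)|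
        ≤ (R * lam ϑ₀ t) * (C ^ 2 * R * ‖ϑ' - ϑ‖ ^ 2 + C * ‖ϑ' - ϑ‖ ^ 2) :=
          mul_le_mul (hle ϑ hϑ t ht) ((abs_add_le _ _).trans (add_le_add e2 e3)) (abs_nonneg _)
            (mul_nonneg (by positivity) (hlam.pos ϑ₀ hϑ₀ t ht).le)
      _ = _ := by ring
  set Q := R * (C ^ 2 * R + C) with hQ
  have hQ0 : 0 ≤ Q := by positivity
  -- One constant for all five bounds: C serves the score, R the domination, Q the Taylor bound, and
  -- Q * (2D) + R * C the Lipschitz bound, obtained from the Taylor bound and the diameter.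
  refine ⟨C + R + Q + (Q * (2 * D) + R * C), by positivity, fun ϑ hϑ t ht => ?_,
    fun ϑ hϑ ϑ' hϑ' t ht => ?_, fun ϑ hϑ t ht => ?_, fun ϑ hϑ ϑ' hϑ' t ht => ?_,
    fun ϑ hϑ ϑ' hϑ' t ht => ?_⟩
  · refine (hC t ht ϑ hϑ ϑ hϑ).1.trans ?_
    have : 0 ≤ R + Q + (Q * (2 * D) + R * C) := by positivity
    linarith
  · refine (hC t ht ϑ hϑ ϑ' hϑ').2.1.trans (mul_le_mul_of_nonneg_right ?_ (norm_nonneg _))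
    have : 0 ≤ R + Q + (Q * (2 * D) + R * C) := by positivity
    linarith
  · refine (hle ϑ hϑ t ht).trans
      (mul_le_mul_of_nonneg_right ?_ (hlam.pos ϑ₀ hϑ₀ t ht).le)
    have : 0 ≤ C + Q + (Q * (2 * D) + R * C) := by positivity
    linarith
  · have hp := (hlam.pos ϑ₀ hϑ₀ t ht).le
    have h1 := htaylor ϑ hϑ ϑ' hϑ' t ht
    have h2 : |lam ϑ t * ⟪score lam ϑ t, ϑ' - ϑ⟫| ≤ R * lam ϑ₀ t * (C * ‖ϑ' - ϑ‖) := by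
      rw [abs_mul, abs_of_pos (hlam.pos ϑ hϑ t ht)]
      refine mul_le_mul (hle ϑ hϑ t ht) ((abs_real_inner_le_norm _ _).trans ?_) (abs_nonneg _)
        (mul_nonneg (by positivity) hp)
      exact mul_le_mul_of_nonneg_right (hC t ht ϑ hϑ ϑ hϑ).1 (norm_nonneg _)
    have h3 : Q * lam ϑ₀ t * ‖ϑ' - ϑ‖ ^ 2 ≤ Q * lam ϑ₀ t * ((2 * D) * ‖ϑ' - ϑ‖) := by
      refine mul_le_mul_of_nonneg_left ?_ (mul_nonneg hQ0 hp)
      rw [sq]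
      exact mul_le_mul_of_nonneg_right (hdist _ hϑ' _ hϑ) (norm_nonneg _)
    have h4 : |lam ϑ' t - lam ϑ t| ≤
        Q * lam ϑ₀ t * ((2 * D) * ‖ϑ' - ϑ‖) + R * lam ϑ₀ t * (C * ‖ϑ' - ϑ‖) := by
      have := abs_add_le (lam ϑ' t - lam ϑ t - lam ϑ t * ⟪score lam ϑ t, ϑ' - ϑ⟫)
        (lam ϑ t * ⟪score lam ϑ t, ϑ' - ϑ⟫)
      rw [sub_add_cancel] at this
      linarith
    have h5 : 0 ≤ (C + R + Q) * lam ϑ₀ t * ‖ϑ' - ϑ‖ := by positivity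
    linarith
  · refine (htaylor ϑ hϑ ϑ' hϑ' t ht).trans ?_
    have hp := (hlam.pos ϑ₀ hϑ₀ t ht).le
    have h5 : 0 ≤ (C + R + (Q * (2 * D) + R * C)) * lam ϑ₀ t * ‖ϑ' - ϑ‖ ^ 2 := by positivity
    linarith

/-- Each coordinate is a pointwise limit of difference quotients of log λ, which are measurable in
t. -/
lemma IsRegularModel.measurable_score (hreg : IsRegularModel Θ T lam)
    (hlam : IsIntensityFamily Θ T lam) (hΘo : IsOpen Θ) {ϑ : EuclideanSpace ℝ (Fin d)}
    (hϑ : ϑ ∈ Θ) :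
    Measurable fun t : T => score lam ϑ t := by
  have hcoord : ∀ i, Measurable fun t : T => (score lam ϑ t) i := by
    intro i
    let v : EuclideanSpace ℝ (Fin d) := EuclideanSpace.single i 1
    have hlim : Tendsto (fun n : ℕ => ϑ + (n : ℝ)⁻¹ • v) atTop (𝓝 ϑ) := by
      have : Tendsto (fun n : ℕ => ϑ + (n : ℝ)⁻¹ • v) atTop (𝓝 (ϑ + (0 : ℝ) • v)) :=
        (tendsto_inv_atTop_nhds_zero_nat.smul_const v).const_add ϑ
      simpa using this
    -- The index is shifted by N so that every difference quotient uses points of Θ, where λ is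
    -- known to be measurable.
    obtain ⟨N, hN⟩ := eventually_atTop.1 (hlim.eventually (hΘo.mem_nhds hϑ))
    refine measurable_of_tendsto_metrizable (f := fun (n : ℕ) (t : T) =>
      ((n + N : ℕ) : ℝ) • (Real.log (lam (ϑ + ((n + N : ℕ) : ℝ)⁻¹ • v) t) -
        Real.log (lam ϑ t))) (fun n => ?_) (tendsto_pi_nhds.2 fun t => ?_)
    · have h1 := hlam.measurable _ (hN (n + N) (Nat.le_add_left N n))
      have h2 := hlam.measurable ϑ hϑ
      simp only [smul_eq_mul]
      exact (h1.log.sub h2.log).const_mul _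
    · have h := (hasGradientAt_iff_hasFDerivAt.1 (hreg.hasGradientAt_log hΘo hϑ t.2)).lim v
        (c := fun n : ℕ => ((n + N : ℕ) : ℝ)) (l := atTop) (by
          simp only [Real.norm_natCast]
          exact tendsto_natCast_atTop_atTop.comp (tendsto_add_atTop_nat N))
      rw [InnerProductSpace.toDual_apply_apply] at h
      have e : ⟪score lam ϑ t, v⟫ = (score lam ϑ t) i := by
        simp [v, EuclideanSpace.inner_single_right]
      rwa [e] at h
  have := (WithLp.measurable_toLp 2 (Fin d → ℝ)).comp (measurable_pi_lambda _ hcoord)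
  exact this

end ModelBounds

/-! ### Fisher information as an operator: Lipschitz bounds and expansion of the compensator -/

section FisherOperator

variable {d : ℕ}

/-- The Fisher information as an operator. -/
noncomputable def fisherOp (T : Set ℝ) (lam : EuclideanSpace ℝ (Fin d) → ℝ → ℝ)
    (ϑ : EuclideanSpace ℝ (Fin d)) : EuclideanSpace ℝ (Fin d) →L[ℝ] EuclideanSpace ℝ (Fin d) :=
  Matrix.toEuclideanCLM (𝕜 := ℝ) (fisherInfo T lam ϑ)

/-- The inverse Fisher information as an operator. -/
noncomputable def fisherInvOp (T : Set ℝ) (lam : EuclideanSpace ℝ (Fin d) → ℝ → ℝ)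
    (ϑ : EuclideanSpace ℝ (Fin d)) : EuclideanSpace ℝ (Fin d) →L[ℝ] EuclideanSpace ℝ (Fin d) :=
  Matrix.toEuclideanCLM (𝕜 := ℝ) (fisherInfo T lam ϑ)⁻¹

/-- A family of intensities on an open set with all the bounds that the asymptotics need. -/
structure IsBoundedModel (Θ : Set (EuclideanSpace ℝ (Fin d))) (T : Set ℝ)
    (lam : EuclideanSpace ℝ (Fin d) → ℝ → ℝ) (ϑ₀ : EuclideanSpace ℝ (Fin d)) (K : ℝ) : Prop where
  isOpen : IsOpen Θ
  mem : ϑ₀ ∈ Θ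
  measurableSet : MeasurableSet T
  family : IsIntensityFamily Θ T lam
  regular : IsRegularModel Θ T lam
  bounds : ScoreBounds Θ T lam ϑ₀ K

variable {Θ : Set (EuclideanSpace ℝ (Fin d))} {T : Set ℝ} {lam : EuclideanSpace ℝ (Fin d) → ℝ → ℝ}
  {ϑ₀ : EuclideanSpace ℝ (Fin d)} {K : ℝ}

namespace IsBoundedModel

lemma aestronglyMeasurable_score (hM : IsBoundedModel Θ T lam ϑ₀ K)
    {ϑ : EuclideanSpace ℝ (Fin d)} (hϑ : ϑ ∈ Θ) :
    AEStronglyMeasurable (score lam ϑ) (volume.restrict T) :=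
  (aemeasurable_restrict_of_measurable_subtype hM.measurableSet
    (hM.regular.measurable_score hM.family hM.isOpen hϑ)).aestronglyMeasurable

lemma aestronglyMeasurable_lam (hM : IsBoundedModel Θ T lam ϑ₀ K)
    {ϑ : EuclideanSpace ℝ (Fin d)} (hϑ : ϑ ∈ Θ) :
    AEStronglyMeasurable (lam ϑ) (volume.restrict T) :=
  (hM.family.integrable ϑ hϑ).1

lemma integrableOn_of_norm_le (hM : IsBoundedModel Θ T lam ϑ₀ K) {F : Type*}
    [NormedAddCommGroup F] {f : ℝ → F} (hf : AEStronglyMeasurable f (volume.restrict T)) {C : ℝ}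
    (hC : ∀ t ∈ T, ‖f t‖ ≤ C * lam ϑ₀ t) : IntegrableOn f T :=
  ((hM.family.integrable ϑ₀ hM.mem).const_mul C).mono' hf
    ((ae_restrict_iff' hM.measurableSet).2 (.of_forall hC))

lemma norm_setIntegral_le (hM : IsBoundedModel Θ T lam ϑ₀ K) {F : Type*}
    [NormedAddCommGroup F] [NormedSpace ℝ F] {f : ℝ → F} {C : ℝ}
    (hC : ∀ t ∈ T, ‖f t‖ ≤ C * lam ϑ₀ t) :
    ‖∫ t in T, f t‖ ≤ C * ∫ t in T, lam ϑ₀ t := by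
  rw [← integral_const_mul]
  exact norm_integral_le_of_norm_le ((hM.family.integrable ϑ₀ hM.mem).const_mul C)
    ((ae_restrict_iff' hM.measurableSet).2 (.of_forall hC))

lemma integral_lam_nonneg (hM : IsBoundedModel Θ T lam ϑ₀ K) : 0 ≤ ∫ t in T, lam ϑ₀ t :=
  setIntegral_nonneg hM.measurableSet fun t ht => (hM.family.pos ϑ₀ hM.mem t ht).le

lemma integrableOn_lam_smul_score (hM : IsBoundedModel Θ T lam ϑ₀ K)
    {ϑ ϑ' : EuclideanSpace ℝ (Fin d)} (hϑ : ϑ ∈ Θ) (hϑ' : ϑ' ∈ Θ) :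
    IntegrableOn (fun t => lam ϑ' t • score lam ϑ t) T := by
  refine hM.integrableOn_of_norm_le (C := K * K)
    ((hM.aestronglyMeasurable_lam hϑ').smul (hM.aestronglyMeasurable_score hϑ)) fun t ht => ?_
  rw [norm_smul, Real.norm_of_nonneg (hM.family.pos ϑ' hϑ' t ht).le]
  calc lam ϑ' t * ‖score lam ϑ t‖ ≤ (K * lam ϑ₀ t) * K :=
        mul_le_mul (hM.bounds.le_mul ϑ' hϑ' t ht) (hM.bounds.norm_score_le ϑ hϑ t ht)
          (norm_nonneg _) (mul_nonneg hM.bounds.nonneg (hM.family.pos ϑ₀ hM.mem t ht).le)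
    _ = K * K * lam ϑ₀ t := by ring

lemma integrableOn_fisher (hM : IsBoundedModel Θ T lam ϑ₀ K)
    {ϑ : EuclideanSpace ℝ (Fin d)} (hϑ : ϑ ∈ Θ) (u : EuclideanSpace ℝ (Fin d)) :
    IntegrableOn (fun t => (lam ϑ t * ⟪score lam ϑ t, u⟫) • score lam ϑ t) T := by
  have hS := hM.aestronglyMeasurable_score hϑ
  have hL := hM.aestronglyMeasurable_lam hϑ
  refine hM.integrableOn_of_norm_le (C := K * (K * ‖u‖) * K)
    ((hL.mul (hS.inner aestronglyMeasurable_const)).smul hS) fun t ht => ?_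
  have hK := hM.bounds.nonneg
  have hp := (hM.family.pos ϑ₀ hM.mem t ht).le
  have hs := hM.bounds.norm_score_le ϑ hϑ t ht
  rw [norm_smul, norm_mul, Real.norm_of_nonneg (hM.family.pos ϑ hϑ t ht).le]
  calc lam ϑ t * ‖⟪score lam ϑ t, u⟫‖ * ‖score lam ϑ t‖
      ≤ (K * lam ϑ₀ t) * (K * ‖u‖) * K := by
        gcongr
        · exact hM.bounds.le_mul ϑ hϑ t ht
        · exact (norm_inner_le_norm _ _).trans (by gcongr)
    _ = _ := by ring

/-- As ∇λ = λ ℓ̇, the integrand ∇λ ∇λᵀ / λ is λ ℓ̇ ℓ̇ᵀ. All later estimates use this vector integral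
instead of matrix entries. -/
lemma fisherOp_apply (hM : IsBoundedModel Θ T lam ϑ₀ K)
    {ϑ : EuclideanSpace ℝ (Fin d)} (hϑ : ϑ ∈ Θ) (u : EuclideanSpace ℝ (Fin d)) :
    fisherOp T lam ϑ u = ∫ t in T, (lam ϑ t * ⟪score lam ϑ t, u⟫) • score lam ϑ t := by
  ext l
  have hproj :=
    (EuclideanSpace.proj (𝕜 := ℝ) l : EuclideanSpace ℝ (Fin d) →L[ℝ] ℝ).integral_comp_comm
    (hM.integrableOn_fisher hϑ u)
  simp only [PiLp.proj_apply, PiLp.smul_apply, smul_eq_mul] at hproj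
  rw [← hproj, fisherOp, Matrix.ofLp_toEuclideanCLM, Matrix.mulVec, dotProduct]
  simp only [fisherInfo, Matrix.of_apply]
  simp_rw [← integral_mul_const]
  have hint : ∀ k, IntegrableOn (fun t => lam ϑ t * score lam ϑ t l * score lam ϑ t k) T := by
    intro k
    have h := (EuclideanSpace.proj (𝕜 := ℝ) l :
      EuclideanSpace ℝ (Fin d) →L[ℝ] ℝ).integrable_comp
        (hM.integrableOn_fisher hϑ (EuclideanSpace.single k 1))
    refine h.congr (.of_forall fun t => ?_)
    simp [EuclideanSpace.inner_single_right]
    ring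
  have heq : ∀ k, ∀ t ∈ T, gradient (fun θ => lam θ t) ϑ l * gradient (fun θ => lam θ t) ϑ k /
      lam ϑ t * u k = lam ϑ t * score lam ϑ t l * score lam ϑ t k * u k := fun k t ht => by
    rw [hM.regular.gradient_eq hM.family hM.isOpen hϑ ht]
    simp only [PiLp.smul_apply, smul_eq_mul]
    have := (hM.family.pos ϑ hϑ t ht).ne'
    field_simp
  rw [Finset.sum_congr rfl fun k _ => setIntegral_congr_fun hM.measurableSet (heq k),
    ← integral_finsetSum _ fun k _ => (hint k).mul_const (u k)]
  refine integral_congr_ae (.of_forall fun t => ?_)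
  simp only [PiLp.inner_apply, RCLike.inner_apply, conj_trivial]
  rw [Finset.mul_sum, Finset.sum_mul]
  exact Finset.sum_congr rfl fun k _ => by ring

lemma inner_fisherOp (hM : IsBoundedModel Θ T lam ϑ₀ K)
    {ϑ : EuclideanSpace ℝ (Fin d)} (hϑ : ϑ ∈ Θ) (u v : EuclideanSpace ℝ (Fin d)) :
    ⟪v, fisherOp T lam ϑ u⟫ =
      ∫ t in T, lam ϑ t * (⟪v, score lam ϑ t⟫ * ⟪score lam ϑ t, u⟫) := by
  rw [hM.fisherOp_apply hϑ, ← integral_inner (hM.integrableOn_fisher hϑ u)]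
  refine integral_congr_ae (.of_forall fun t => ?_)
  simp only [inner_smul_right]
  ring

lemma norm_fisherOp_sub_le (hM : IsBoundedModel Θ T lam ϑ₀ K)
    {ϑ ϑ' : EuclideanSpace ℝ (Fin d)} (hϑ : ϑ ∈ Θ) (hϑ' : ϑ' ∈ Θ) (u : EuclideanSpace ℝ (Fin d)) :
    ‖fisherOp T lam ϑ' u - fisherOp T lam ϑ u‖ ≤
      (3 * K ^ 3 * ∫ t in T, lam ϑ₀ t) * ‖ϑ' - ϑ‖ * ‖u‖ := by
  rw [hM.fisherOp_apply hϑ, hM.fisherOp_apply hϑ',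
    ← integral_sub (hM.integrableOn_fisher hϑ' u) (hM.integrableOn_fisher hϑ u)]
  refine (hM.norm_setIntegral_le (C := 3 * K ^ 3 * ‖ϑ' - ϑ‖ * ‖u‖) fun t ht => ?_).trans_eq
    (by ring)
  have hK := hM.bounds.nonneg
  have hp := (hM.family.pos ϑ₀ hM.mem t ht).le
  have hs := hM.bounds.norm_score_le ϑ hϑ t ht
  have hs' := hM.bounds.norm_score_le ϑ' hϑ' t ht
  have hd := hM.bounds.norm_score_sub_le ϑ' hϑ' ϑ hϑ t ht
  have hl := hM.bounds.le_mul ϑ hϑ t ht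
  have hl' := hM.bounds.abs_sub_le ϑ hϑ ϑ' hϑ' t ht
  have hpl := (hM.family.pos ϑ hϑ t ht).le
  -- Telescoping: one of the three factors is moved from ϑ' to ϑ at a time.
  have e : (lam ϑ' t * ⟪score lam ϑ' t, u⟫) • score lam ϑ' t -
      (lam ϑ t * ⟪score lam ϑ t, u⟫) • score lam ϑ t =
      ((lam ϑ' t - lam ϑ t) * ⟪score lam ϑ' t, u⟫) • score lam ϑ' t +
      (lam ϑ t * ⟪score lam ϑ' t - score lam ϑ t, u⟫) • score lam ϑ' t +
      (lam ϑ t * ⟪score lam ϑ t, u⟫) • (score lam ϑ' t - score lam ϑ t) := by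
    rw [inner_sub_left]
    module
  have n1 : ‖((lam ϑ' t - lam ϑ t) * ⟪score lam ϑ' t, u⟫) • score lam ϑ' t‖ ≤
      (K * lam ϑ₀ t * ‖ϑ' - ϑ‖) * (K * ‖u‖) * K := by
    rw [norm_smul, norm_mul, Real.norm_eq_abs (_ - _)]
    gcongr
    exact (norm_inner_le_norm _ _).trans (by gcongr)
  have n2 : ‖(lam ϑ t * ⟪score lam ϑ' t - score lam ϑ t, u⟫) • score lam ϑ' t‖ ≤
      (K * lam ϑ₀ t) * ((K * ‖ϑ' - ϑ‖) * ‖u‖) * K := by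
    rw [norm_smul, norm_mul, Real.norm_of_nonneg hpl]
    gcongr
    exact (norm_inner_le_norm _ _).trans (by gcongr)
  have n3 : ‖(lam ϑ t * ⟪score lam ϑ t, u⟫) • (score lam ϑ' t - score lam ϑ t)‖ ≤
      (K * lam ϑ₀ t) * (K * ‖u‖) * (K * ‖ϑ' - ϑ‖) := by
    rw [norm_smul, norm_mul, Real.norm_of_nonneg hpl]
    gcongr
    exact (norm_inner_le_norm _ _).trans (by gcongr)
  rw [e]
  refine (norm_add₃_le.trans (add_le_add (add_le_add n1 n2) n3)).trans_eq ?_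
  ring

/-- The difference of the compensators, `∫_T (lam(ϑ₁, t) - lam(ϑ₂, t)) score(ϑ, t) dt`, is the
Fisher information applied to `ϑ₁ - ϑ₂`, up to a second order term. -/
lemma norm_integral_sub_fisherOp_le (hM : IsBoundedModel Θ T lam ϑ₀ K)
    {ϑ ϑ₁ ϑ₂ : EuclideanSpace ℝ (Fin d)} (hϑ : ϑ ∈ Θ) (h₁ : ϑ₁ ∈ Θ) (h₂ : ϑ₂ ∈ Θ) :
    ‖(∫ t in T, (lam ϑ₁ t - lam ϑ₂ t) • score lam ϑ t) - fisherOp T lam ϑ (ϑ₁ - ϑ₂)‖ ≤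
      (K * (K + 2 * K ^ 2) * ∫ t in T, lam ϑ₀ t) * (‖ϑ₁ - ϑ‖ + ‖ϑ₂ - ϑ‖) * ‖ϑ₁ - ϑ₂‖ := by
  have hint : IntegrableOn (fun t => (lam ϑ₁ t - lam ϑ₂ t) • score lam ϑ t) T := by
    simp only [sub_smul]
    exact (hM.integrableOn_lam_smul_score hϑ h₁).sub (hM.integrableOn_lam_smul_score hϑ h₂)
  rw [hM.fisherOp_apply hϑ, ← integral_sub hint (hM.integrableOn_fisher hϑ _)]
  refine (hM.norm_setIntegral_le
    (C := K * (K + 2 * K ^ 2) * (‖ϑ₁ - ϑ‖ + ‖ϑ₂ - ϑ‖) * ‖ϑ₁ - ϑ₂‖) fun t ht => ?_).trans_eq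
    (by ring)
  have hK := hM.bounds.nonneg
  have hp := (hM.family.pos ϑ₀ hM.mem t ht).le
  have hpl := (hM.family.pos ϑ hϑ t ht).le
  have hs := hM.bounds.norm_score_le ϑ hϑ t ht
  have hs₂ := hM.bounds.norm_score_le ϑ₂ h₂ t ht
  have hl := hM.bounds.le_mul ϑ hϑ t ht
  have htri : ‖ϑ₁ - ϑ₂‖ ≤ ‖ϑ₁ - ϑ‖ + ‖ϑ₂ - ϑ‖ := by
    rw [← sub_sub_sub_cancel_right ϑ₁ ϑ₂ ϑ]
    exact norm_sub_le _ _
  have n1 := hM.bounds.abs_sub_sub_le ϑ₂ h₂ ϑ₁ h₁ t ht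
  have n2 : |(lam ϑ₂ t - lam ϑ t) * ⟪score lam ϑ₂ t, ϑ₁ - ϑ₂⟫| ≤
      (K * lam ϑ₀ t * ‖ϑ₂ - ϑ‖) * (K * ‖ϑ₁ - ϑ₂‖) := by
    rw [abs_mul]
    have := hM.bounds.abs_sub_le ϑ hϑ ϑ₂ h₂ t ht
    gcongr
    exact (abs_real_inner_le_norm _ _).trans (by gcongr)
  have n3 : |lam ϑ t * ⟪score lam ϑ₂ t - score lam ϑ t, ϑ₁ - ϑ₂⟫| ≤
      (K * lam ϑ₀ t) * ((K * ‖ϑ₂ - ϑ‖) * ‖ϑ₁ - ϑ₂‖) := by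
    rw [abs_mul, abs_of_nonneg hpl]
    have := hM.bounds.norm_score_sub_le ϑ₂ h₂ ϑ hϑ t ht
    gcongr
    exact (abs_real_inner_le_norm _ _).trans (by gcongr)
  -- Taylor expansion at ϑ₂ in the direction ϑ₁ - ϑ₂; then the intensity and the score in the linear
  -- term are moved from ϑ₂ to ϑ.
  have e : (lam ϑ₁ t - lam ϑ₂ t) • score lam ϑ t -
      (lam ϑ t * ⟪score lam ϑ t, ϑ₁ - ϑ₂⟫) • score lam ϑ t =
      ((lam ϑ₁ t - lam ϑ₂ t - lam ϑ₂ t * ⟪score lam ϑ₂ t, ϑ₁ - ϑ₂⟫) +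
        (lam ϑ₂ t - lam ϑ t) * ⟪score lam ϑ₂ t, ϑ₁ - ϑ₂⟫ +
        lam ϑ t * ⟪score lam ϑ₂ t - score lam ϑ t, ϑ₁ - ϑ₂⟫) • score lam ϑ t := by
    rw [inner_sub_left]
    module
  have n4 : K * lam ϑ₀ t * ‖ϑ₁ - ϑ₂‖ ^ 2 + (K * lam ϑ₀ t * ‖ϑ₂ - ϑ‖) * (K * ‖ϑ₁ - ϑ₂‖) +
      (K * lam ϑ₀ t) * ((K * ‖ϑ₂ - ϑ‖) * ‖ϑ₁ - ϑ₂‖) ≤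
      (K + 2 * K ^ 2) * (‖ϑ₁ - ϑ‖ + ‖ϑ₂ - ϑ‖) * ‖ϑ₁ - ϑ₂‖ * lam ϑ₀ t := by
    have m1 : K * lam ϑ₀ t * ‖ϑ₁ - ϑ₂‖ ^ 2 ≤
        K * lam ϑ₀ t * ((‖ϑ₁ - ϑ‖ + ‖ϑ₂ - ϑ‖) * ‖ϑ₁ - ϑ₂‖) := by
      rw [sq]
      gcongr
    have m2 : 0 ≤ 2 * K ^ 2 * ‖ϑ₁ - ϑ‖ * ‖ϑ₁ - ϑ₂‖ * lam ϑ₀ t := by positivity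
    linarith
  rw [e, norm_smul, Real.norm_eq_abs]
  calc _ ≤ ((K + 2 * K ^ 2) * (‖ϑ₁ - ϑ‖ + ‖ϑ₂ - ϑ‖) * ‖ϑ₁ - ϑ₂‖ * lam ϑ₀ t) * K := by
        gcongr
        exact ((abs_add_three _ _ _).trans (add_le_add (add_le_add n1 n2) n3)).trans n4
    _ = _ := by ring

lemma norm_integral_lam_smul_score_sub_le (hM : IsBoundedModel Θ T lam ϑ₀ K)
    {ϑ₁ ϑ₁' ϑ₂ ϑ₂' : EuclideanSpace ℝ (Fin d)} (h₁ : ϑ₁ ∈ Θ) (h₁' : ϑ₁' ∈ Θ) (h₂ : ϑ₂ ∈ Θ)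
    (h₂' : ϑ₂' ∈ Θ) :
    ‖(∫ t in T, lam ϑ₁' t • score lam ϑ₁ t) - ∫ t in T, lam ϑ₂' t • score lam ϑ₂ t‖ ≤
      (K ^ 2 * ∫ t in T, lam ϑ₀ t) * (‖ϑ₁' - ϑ₂'‖ + ‖ϑ₁ - ϑ₂‖) := by
  rw [← integral_sub (hM.integrableOn_lam_smul_score h₁ h₁')
    (hM.integrableOn_lam_smul_score h₂ h₂')]
  refine (hM.norm_setIntegral_le
    (C := K ^ 2 * (‖ϑ₁' - ϑ₂'‖ + ‖ϑ₁ - ϑ₂‖)) fun t ht => ?_).trans_eq (by ring)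
  have hK := hM.bounds.nonneg
  have hp := (hM.family.pos ϑ₀ hM.mem t ht).le
  have e : lam ϑ₁' t • score lam ϑ₁ t - lam ϑ₂' t • score lam ϑ₂ t =
      (lam ϑ₁' t - lam ϑ₂' t) • score lam ϑ₁ t +
        lam ϑ₂' t • (score lam ϑ₁ t - score lam ϑ₂ t) := by module
  rw [e]
  have n1 : ‖(lam ϑ₁' t - lam ϑ₂' t) • score lam ϑ₁ t‖ ≤ (K * lam ϑ₀ t * ‖ϑ₁' - ϑ₂'‖) * K := by
    rw [norm_smul, Real.norm_eq_abs]
    have := hM.bounds.abs_sub_le ϑ₂' h₂' ϑ₁' h₁' t ht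
    have := hM.bounds.norm_score_le ϑ₁ h₁ t ht
    gcongr
  have n2 : ‖lam ϑ₂' t • (score lam ϑ₁ t - score lam ϑ₂ t)‖ ≤
      (K * lam ϑ₀ t) * (K * ‖ϑ₁ - ϑ₂‖) := by
    rw [norm_smul, Real.norm_of_nonneg (hM.family.pos ϑ₂' h₂' t ht).le]
    have := hM.bounds.le_mul ϑ₂' h₂' t ht
    have := hM.bounds.norm_score_sub_le ϑ₁ h₁ ϑ₂ h₂ t ht
    gcongr
  refine ((norm_add_le _ _).trans (add_le_add n1 n2)).trans_eq ?_
  ring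

end IsBoundedModel

/-! ### The inverse Fisher information -/

/-- Nondegeneracy on unit vectors extends by homogeneity. -/
lemma IsRegularModel.exists_le_inner_fisherOp (hreg : IsRegularModel Θ T lam) :
    ∃ c : ℝ, 0 < c ∧ ∀ ϑ ∈ Θ, ∀ u, c * ‖u‖ ^ 2 ≤ ⟪u, fisherOp T lam ϑ u⟫ := by
  obtain ⟨c, hc, h⟩ := hreg.nondegenerate
  refine ⟨c, hc, fun ϑ hϑ u => ?_⟩
  rcases eq_or_ne u 0 with rfl | hu
  · simp
  have hu' : ‖u‖ ≠ 0 := norm_ne_zero_iff.2 hu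
  have h1 := h ϑ hϑ (‖u‖⁻¹ • u) (by rw [norm_smul, norm_inv, norm_norm, inv_mul_cancel₀ hu'])
  rw [← Matrix.inner_toEuclideanCLM, map_smul, real_inner_smul_left, real_inner_smul_right] at h1
  change c ≤ ‖u‖⁻¹ * (‖u‖⁻¹ * ⟪u, fisherOp T lam ϑ u⟫) at h1
  calc c * ‖u‖ ^ 2 ≤ (‖u‖⁻¹ * (‖u‖⁻¹ * ⟪u, fisherOp T lam ϑ u⟫)) * ‖u‖ ^ 2 := by gcongr
    _ = _ := by field_simp

variable {c : ℝ}

/-- Coercivity forces a trivial kernel, which for a square matrix is invertibility. -/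
lemma isUnit_det_fisherInfo {ϑ : EuclideanSpace ℝ (Fin d)} (hc : 0 < c)
    (h : ∀ u, c * ‖u‖ ^ 2 ≤ ⟪u, fisherOp T lam ϑ u⟫) : IsUnit (fisherInfo T lam ϑ).det := by
  rw [← Matrix.isUnit_iff_isUnit_det, ← Matrix.mulVec_injective_iff_isUnit,
    ← Matrix.coe_mulVecLin]
  refine (injective_iff_map_eq_zero _).2 fun x hx => ?_
  have h1 := h (WithLp.toLp 2 x)
  rw [Matrix.mulVecLin_apply] at hx
  rw [fisherOp, Matrix.toEuclideanCLM_toLp, hx, WithLp.toLp_zero, inner_zero_right] at h1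
  have h2 : ‖WithLp.toLp 2 x‖ = 0 := by
    have : ‖WithLp.toLp 2 x‖ ^ 2 ≤ 0 := by
      by_contra hcon
      push Not at hcon
      nlinarith
    exact pow_eq_zero_iff (two_ne_zero) |>.1 (le_antisymm this (sq_nonneg _))
  have h3 := norm_eq_zero.1 h2
  have := congrArg WithLp.ofLp h3
  simpa using this

lemma fisherInvOp_fisherOp {ϑ : EuclideanSpace ℝ (Fin d)} (hc : 0 < c)
    (h : ∀ u, c * ‖u‖ ^ 2 ≤ ⟪u, fisherOp T lam ϑ u⟫) (u : EuclideanSpace ℝ (Fin d)) :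
    fisherInvOp T lam ϑ (fisherOp T lam ϑ u) = u := by
  have e : fisherInvOp T lam ϑ * fisherOp T lam ϑ = 1 := by
    rw [fisherInvOp, fisherOp, ← map_mul,
      Matrix.nonsing_inv_mul _ (isUnit_det_fisherInfo hc h), map_one]
  exact DFunLike.congr_fun e u

lemma fisherOp_fisherInvOp {ϑ : EuclideanSpace ℝ (Fin d)} (hc : 0 < c)
    (h : ∀ u, c * ‖u‖ ^ 2 ≤ ⟪u, fisherOp T lam ϑ u⟫) (u : EuclideanSpace ℝ (Fin d)) :
    fisherOp T lam ϑ (fisherInvOp T lam ϑ u) = u := by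
  have e : fisherOp T lam ϑ * fisherInvOp T lam ϑ = 1 := by
    rw [fisherInvOp, fisherOp, ← map_mul,
      Matrix.mul_nonsing_inv _ (isUnit_det_fisherInfo hc h), map_one]
  exact DFunLike.congr_fun e u

/-- For w = I⁻¹u coercivity gives c‖w‖² ≤ ⟨w, u⟩ ≤ ‖w‖ ‖u‖. -/
lemma norm_fisherInvOp_le {ϑ : EuclideanSpace ℝ (Fin d)} (hc : 0 < c)
    (h : ∀ u, c * ‖u‖ ^ 2 ≤ ⟪u, fisherOp T lam ϑ u⟫) (u : EuclideanSpace ℝ (Fin d)) :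
    ‖fisherInvOp T lam ϑ u‖ ≤ c⁻¹ * ‖u‖ := by
  set w := fisherInvOp T lam ϑ u with hw
  have h1 := h w
  rw [hw, fisherOp_fisherInvOp hc h, ← hw] at h1
  have h2 := h1.trans (real_inner_le_norm w u)
  rcases (norm_nonneg w).eq_or_lt with h0 | h0
  · rw [← h0]; positivity
  · rw [← div_eq_inv_mul, le_div_iff₀ hc]
    nlinarith

/-- The identity I(ϑ')⁻¹ - I(ϑ)⁻¹ = I(ϑ')⁻¹ (I(ϑ) - I(ϑ')) I(ϑ)⁻¹, with both inverses bounded by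
1/c. -/
lemma norm_fisherInvOp_sub_le (hM : IsBoundedModel Θ T lam ϑ₀ K) (hc : 0 < c)
    (h : ∀ ϑ ∈ Θ, ∀ u, c * ‖u‖ ^ 2 ≤ ⟪u, fisherOp T lam ϑ u⟫)
    {ϑ ϑ' : EuclideanSpace ℝ (Fin d)} (hϑ : ϑ ∈ Θ) (hϑ' : ϑ' ∈ Θ)
    (u : EuclideanSpace ℝ (Fin d)) :
    ‖fisherInvOp T lam ϑ' u - fisherInvOp T lam ϑ u‖ ≤
      (c⁻¹ * c⁻¹ * (3 * K ^ 3 * ∫ t in T, lam ϑ₀ t)) * ‖ϑ' - ϑ‖ * ‖u‖ := by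
  have e : fisherInvOp T lam ϑ' u - fisherInvOp T lam ϑ u = fisherInvOp T lam ϑ'
      (fisherOp T lam ϑ (fisherInvOp T lam ϑ u) - fisherOp T lam ϑ' (fisherInvOp T lam ϑ u)) := by
    rw [map_sub, fisherInvOp_fisherOp hc (h ϑ' hϑ'), fisherOp_fisherInvOp hc (h ϑ hϑ)]
  rw [e]
  have hL := hM.integral_lam_nonneg
  have hK := hM.bounds.nonneg
  calc _ ≤ c⁻¹ * ((3 * K ^ 3 * ∫ t in T, lam ϑ₀ t) * ‖ϑ - ϑ'‖ * (c⁻¹ * ‖u‖)) := by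
        refine (norm_fisherInvOp_le hc (h ϑ' hϑ') _).trans ?_
        gcongr
        refine (hM.norm_fisherOp_sub_le hϑ' hϑ _).trans ?_
        gcongr
        exact norm_fisherInvOp_le hc (h ϑ hϑ) u
    _ = _ := by rw [norm_sub_rev]; ring

end FisherOperator

/-! ### Measurability on a subset and freezing of an independent variable -/

section General

lemma Measurable.indicator_of_subtype {α β : Type*} [MeasurableSpace α] [MeasurableSpace β]
    [Zero β] {s : Set α} (hs : MeasurableSet s) {f : α → β} (hf : Measurable fun x : s => f x) :
    Measurable (s.indicator f) := by
  refine measurable_of_restrict_of_restrict_compl hs ?_ ?_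
  · have : s.domRestrict (s.indicator f) = fun x : s => f x :=
      funext fun x => Set.indicator_of_mem x.2 f
    rwa [this]
  · have : sᶜ.domRestrict (s.indicator f) = fun _ => 0 :=
      funext fun x => Set.indicator_of_notMem x.2 f
    rw [this]
    exact measurable_const

/-- The joint law is a product, so a bound uniform in the frozen value y integrates to itself. This
allows a random parameter to be treated as deterministic. -/
lemma measure_le_of_indepFun {Ω α β : Type*} [MeasurableSpace Ω] [MeasurableSpace α]
    [MeasurableSpace β] {P : Measure Ω} [IsProbabilityMeasure P] {Y : Ω → α} {W : Ω → β}
    (hY : Measurable Y) (hW : Measurable W) (hYW : IndepFun Y W P) {A : Set (α × β)}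
    (hA : MeasurableSet A) {η : ℝ≥0∞} (h : ∀ y, P {ω | (y, W ω) ∈ A} ≤ η) :
    P {ω | (Y ω, W ω) ∈ A} ≤ η := by
  have hmap := (indepFun_iff_map_prod_eq_prod_map_map hY.aemeasurable hW.aemeasurable).1 hYW
  have : IsProbabilityMeasure (P.map Y) := Measure.isProbabilityMeasure_map hY.aemeasurable
  have : IsProbabilityMeasure (P.map W) := Measure.isProbabilityMeasure_map hW.aemeasurable
  calc P {ω | (Y ω, W ω) ∈ A} = (P.map fun ω => (Y ω, W ω)) A :=
        (Measure.map_apply (hY.prodMk hW) hA).symm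
    _ = ∫⁻ y, P.map W (Prod.mk y ⁻¹' A) ∂(P.map Y) := by rw [hmap, Measure.prod_apply hA]
    _ ≤ ∫⁻ _, η ∂(P.map Y) := lintegral_mono fun y => by
        rw [Measure.map_apply hW (measurable_prodMk_left hA)]
        exact h y
    _ = η := by simp

end General

/-! ### Variance and Chebyshev bounds for centered statistics -/

section CenteredStatistic

variable {Ω : Type*} [MeasurableSpace Ω]

/-- The centered linear statistic `∫ f dx - ∫ f dΛ` of a path `x`. -/
noncomputable def centeredStat {F : Type*} [NormedAddCommGroup F] [NormedSpace ℝ F]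
    (Λ : Measure ℝ) (f : ℝ → F) (x : StieltjesFunction ℝ) : F :=
  (∫ t, f t ∂(jumpMeasure x)) - ∫ t, f t ∂Λ

lemma measurable_centeredStat {F : Type*} [NormedAddCommGroup F] [NormedSpace ℝ F]
    [MeasurableSpace F] [BorelSpace F] (Λ : Measure ℝ) {f : ℝ → F} (hf : StronglyMeasurable f) :
    Measurable (centeredStat Λ f) := by
  have : StronglyMeasurable fun x : StieltjesFunction ℝ => ∫ t, f t ∂(jumpKernel x) :=
    hf.integral_kernel
  exact (this.sub stronglyMeasurable_const).measurable

lemma ContinuousLinearMap.apply_centeredStat {F G : Type*} [NormedAddCommGroup F]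
    [NormedSpace ℝ F] [CompleteSpace F] [NormedAddCommGroup G] [NormedSpace ℝ G] [CompleteSpace G]
    {Λ : Measure ℝ} [IsFiniteMeasure Λ] (L : F →L[ℝ] G) {f : ℝ → F} (hf : StronglyMeasurable f)
    {B : ℝ} (hB : ∀ t, ‖f t‖ ≤ B) (x : StieltjesFunction ℝ) :
    L (centeredStat Λ f x) = centeredStat Λ (fun t => L (f t)) x := by
  have hi : ∀ μ : Measure ℝ, [IsFiniteMeasure μ] → Integrable f μ := fun μ _ =>
    .of_bound hf.aestronglyMeasurable B (.of_forall hB)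
  rw [centeredStat, centeredStat, map_sub, L.integral_comp_comm (hi _),
    L.integral_comp_comm (hi _)]

namespace IsPoissonPath

variable {P : Measure Ω} [IsProbabilityMeasure P] {Λ : Measure ℝ} [IsFiniteMeasure Λ]

lemma centeredStat_moments {X : Ω → StieltjesFunction ℝ} (hX : IsPoissonPath P Λ X) {f : ℝ → ℝ}
    (hf : Measurable f) {B : ℝ} (hB : ∀ t, ‖f t‖ ≤ B) :
    MemLp (fun ω => centeredStat Λ f (X ω)) 2 P ∧
    ∫ ω, centeredStat Λ f (X ω) ∂P = 0 ∧
    Var[fun ω => centeredStat Λ f (X ω); P] = ∫ t, f t ^ 2 ∂Λ := by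
  have hm : Measurable fun ω => ∫ t, f t ∂(jumpMeasure (X ω)) :=
    (hf.stronglyMeasurable.integral_kernel (κ := jumpKernel)).measurable.comp hX.measurable
  have h1 := hX.integral_integral_jumpMeasure hf hB
  obtain ⟨h2, h3⟩ := hX.integrable_integral_jumpMeasure_sq hf hB
  have hL : MemLp (fun ω => ∫ t, f t ∂(jumpMeasure (X ω))) 2 P :=
    (memLp_two_iff_integrable_sq hm.aestronglyMeasurable).2 h2
  refine ⟨hL.sub (memLp_const _), ?_, ?_⟩
  · simp only [centeredStat]
    rw [integral_sub (hL.integrable one_le_two) (integrable_const _), h1]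
    simp
  · simp only [centeredStat]
    rw [variance_sub_const hm.aestronglyMeasurable, variance_eq_sub hL]
    simp only [Pi.pow_apply]
    rw [h1, h3]
    ring

variable {X : ℕ → Ω → StieltjesFunction ℝ}

lemma variance_sum_centeredStat (hX : ∀ j, IsPoissonPath P Λ (X j)) (hind : iIndepFun X P)
    {f : ℝ → ℝ} (hf : Measurable f) {B : ℝ} (hB : ∀ t, ‖f t‖ ≤ B) (J : Finset ℕ) :
    MemLp (fun ω => ∑ j ∈ J, centeredStat Λ f (X j ω)) 2 P ∧
    ∫ ω, (∑ j ∈ J, centeredStat Λ f (X j ω)) ^ 2 ∂P = J.card * ∫ t, f t ^ 2 ∂Λ := by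
  have hmom := fun j => (hX j).centeredStat_moments hf hB
  have hsumL : MemLp (fun ω => ∑ j ∈ J, centeredStat Λ f (X j ω)) 2 P :=
    memLp_finsetSum J fun j _ => (hmom j).1
  refine ⟨hsumL, ?_⟩
  have hmean : ∫ ω, ∑ j ∈ J, centeredStat Λ f (X j ω) ∂P = 0 := by
    rw [integral_finsetSum _ fun j _ => (hmom j).1.integrable one_le_two]
    exact Finset.sum_eq_zero fun j _ => (hmom j).2.1
  have hind' : iIndepFun (fun j ω => centeredStat Λ f (X j ω)) P :=
    hind.comp (fun _ => centeredStat Λ f) fun _ =>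
      measurable_centeredStat Λ hf.stronglyMeasurable
  have hv := IndepFun.variance_sum (s := J) (X := fun j ω => centeredStat Λ f (X j ω))
    (fun j _ => (hmom j).1) (fun i _ j _ hij => hind'.indepFun hij)
  have hs : (∑ j ∈ J, fun ω => centeredStat Λ f (X j ω)) =
      fun ω => ∑ j ∈ J, centeredStat Λ f (X j ω) := by ext; simp
  rw [hs, variance_of_integral_eq_zero hsumL.1.aemeasurable hmean] at hv
  rw [hv, Finset.sum_congr rfl fun j _ => (hmom j).2.2]
  simp

/-- Chebyshev's inequality for a sum of centered statistics of independent Poisson paths. -/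
lemma measure_le_norm_sum_centeredStat {d : ℕ} (hX : ∀ j, IsPoissonPath P Λ (X j))
    (hind : iIndepFun X P) {f : ℝ → EuclideanSpace ℝ (Fin d)} (hf : Measurable f) {B : ℝ}
    (hB : ∀ t, ‖f t‖ ≤ B) (J : Finset ℕ) {a : ℝ} (ha : 0 < a) :
    P {ω | a ≤ ‖∑ j ∈ J, centeredStat Λ f (X j ω)‖} ≤
      ENNReal.ofReal (J.card * (B ^ 2 * Λ.real Set.univ) / a ^ 2) := by
  have hcoord : ∀ (i : Fin d) ω, (∑ j ∈ J, centeredStat Λ f (X j ω)) i =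
      ∑ j ∈ J, centeredStat Λ (fun t => f t i) (X j ω) := fun i ω => by
    have := fun x => (EuclideanSpace.proj (𝕜 := ℝ) i :
      EuclideanSpace ℝ (Fin d) →L[ℝ] ℝ).apply_centeredStat (Λ := Λ) hf.stronglyMeasurable hB x
    simp only [PiLp.proj_apply] at this
    simp [this]
  have hfi : ∀ i, Measurable fun t => f t i := fun i =>
    (EuclideanSpace.proj (𝕜 := ℝ) i : EuclideanSpace ℝ (Fin d) →L[ℝ] ℝ).measurable.comp hf
  have hBi : ∀ i t, ‖f t i‖ ≤ B := fun i t => (PiLp.norm_apply_le (f t) i).trans (hB t)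
  have hv := fun i => variance_sum_centeredStat hX hind (hfi i) (hBi i) J
  have hnorm : ∀ ω, ‖∑ j ∈ J, centeredStat Λ f (X j ω)‖ ^ 2 =
      ∑ i, (∑ j ∈ J, centeredStat Λ (fun t => f t i) (X j ω)) ^ 2 := fun ω => by
    rw [EuclideanSpace.norm_sq_eq]
    exact Finset.sum_congr rfl fun i _ => by rw [hcoord, Real.norm_eq_abs, sq_abs]
  have hint : Integrable (fun ω => ‖∑ j ∈ J, centeredStat Λ f (X j ω)‖ ^ 2) P := by
    simp only [hnorm]
    exact integrable_finsetSum _ fun i _ => (hv i).1.integrable_sq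
  have hval : ∫ ω, ‖∑ j ∈ J, centeredStat Λ f (X j ω)‖ ^ 2 ∂P ≤
      J.card * (B ^ 2 * Λ.real Set.univ) := by
    simp only [hnorm]
    rw [integral_finsetSum _ fun i _ => (hv i).1.integrable_sq,
      Finset.sum_congr rfl fun i _ => (hv i).2, ← Finset.mul_sum, ← integral_finsetSum]
    · refine mul_le_mul_of_nonneg_left ?_ (Nat.cast_nonneg _)
      -- The coordinates are summed before bounding, so no factor d appears.
      have hle : ∀ t, ‖∑ i, f t i ^ 2‖ ≤ B ^ 2 := fun t => by
        have : ∑ i, f t i ^ 2 = ‖f t‖ ^ 2 := by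
          rw [EuclideanSpace.norm_sq_eq]
          exact Finset.sum_congr rfl fun i _ => by rw [Real.norm_eq_abs, sq_abs]
        rw [this, Real.norm_of_nonneg (sq_nonneg _)]
        exact pow_le_pow_left₀ (norm_nonneg _) (hB t) 2
      exact (le_abs_self _).trans (norm_integral_le_of_norm_le_const (.of_forall hle))
    · refine fun i _ => .of_bound ((hfi i).pow_const 2).aestronglyMeasurable (B ^ 2)
        (.of_forall fun t => ?_)
      rw [norm_pow]
      exact pow_le_pow_left₀ (norm_nonneg _) (hBi i t) 2
  have hmark := mul_meas_ge_le_integral_of_nonneg (μ := P)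
    (f := fun ω => ‖∑ j ∈ J, centeredStat Λ f (X j ω)‖ ^ 2)
    (.of_forall fun ω => sq_nonneg _) hint (a ^ 2)
  have hset : {ω | a ≤ ‖∑ j ∈ J, centeredStat Λ f (X j ω)‖} =
      {ω | a ^ 2 ≤ ‖∑ j ∈ J, centeredStat Λ f (X j ω)‖ ^ 2} := by
    ext ω
    simp only [Set.mem_ofPred_eq]
    exact (pow_le_pow_iff_left₀ ha.le (norm_nonneg _) two_ne_zero).symm
  rw [hset, ← ofReal_measureReal]
  refine ENNReal.ofReal_le_ofReal ?_
  rw [le_div_iff₀ (by positivity), mul_comm]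
  exact hmark.trans hval

end IsPoissonPath

end CenteredStatistic

/-! ### Central limit theorem for Poisson statistics -/

section CentralLimit

variable {Ω : Type*} [MeasurableSpace Ω] {P : Measure Ω} {d : ℕ}

lemma charFun_map_eq_charFun_map_inner {V : Ω → EuclideanSpace ℝ (Fin d)} (hV : AEMeasurable V P)
    (u : EuclideanSpace ℝ (Fin d)) :
    charFun (P.map V) u = charFun (P.map fun ω => ⟪u, V ω⟫) 1 := by
  rw [charFun_apply, charFun_apply, integral_map hV (by fun_prop),
    integral_map (by fun_prop) (by fun_prop)]
  refine integral_congr_ae (.of_forall fun ω => ?_)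
  simp [real_inner_comm]

/-- The multivariate central limit theorem for centered statistics of independent Poisson
paths. -/
lemma IsPoissonPath.tendstoInDistribution_sum_centeredStat [IsProbabilityMeasure P]
    {Λ : Measure ℝ} [IsFiniteMeasure Λ]
    {X : ℕ → Ω → StieltjesFunction ℝ} (hX : ∀ j, IsPoissonPath P Λ (X j)) (hind : iIndepFun X P)
    {f : ℝ → EuclideanSpace ℝ (Fin d)} (hf : Measurable f) {B : ℝ} (hB : ∀ t, ‖f t‖ ≤ B)
    {S : Matrix (Fin d) (Fin d) ℝ} (hS : S.PosSemidef)
    (hfS : ∀ u : EuclideanSpace ℝ (Fin d), ∫ t, ⟪u, f t⟫ ^ 2 ∂Λ = u ⬝ᵥ S.mulVec u) :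
    TendstoInDistribution
      (fun (n : ℕ) ω => (√n)⁻¹ • ∑ j ∈ Finset.range n, centeredStat Λ f (X j ω)) atTop id
      (fun _ => P) (multivariateGaussian 0 S) := by
  have hm : ∀ n : ℕ, AEMeasurable
      (fun ω => (√n)⁻¹ • ∑ j ∈ Finset.range n, centeredStat Λ f (X j ω)) P := fun n => by
    have h : ∀ j, Measurable fun ω => centeredStat Λ f (X j ω) := fun j =>
      (measurable_centeredStat Λ hf.stronglyMeasurable).comp (hX j).measurable
    have hs : Measurable fun ω => ∑ j ∈ Finset.range n, centeredStat Λ f (X j ω) :=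
      Finset.measurable_fun_sum _ fun j _ => h j
    exact (hs.const_smul (√(n : ℝ))⁻¹).aemeasurable
  refine ⟨hm, aemeasurable_id, ProbabilityMeasure.tendsto_iff_tendsto_charFun.2 fun u => ?_⟩
  have hg : Measurable fun t => ⟪u, f t⟫ := by fun_prop
  have hgB : ∀ t, ‖⟪u, f t⟫‖ ≤ ‖u‖ * B := fun t =>
    (norm_inner_le_norm _ _).trans (mul_le_mul_of_nonneg_left (hB t) (norm_nonneg u))
  have hinner : ∀ x, ⟪u, centeredStat Λ f x⟫ = centeredStat Λ (fun t => ⟪u, f t⟫) x := fun x =>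
    (innerSL ℝ u).apply_centeredStat hf.stronglyMeasurable hB x
  have hmg := measurable_centeredStat Λ hg.stronglyMeasurable
  obtain ⟨hL, hmean, hvar⟩ := (hX 0).centeredStat_moments hg hgB
  rw [hfS u] at hvar
  -- Cramér–Wold: for fixed u the projections are i.i.d. scalars, and the characteristic function of
  -- the vector at u is that of its projection at 1.
  have hclt := tendstoInDistribution_inv_sqrt_mul_sum_sub (P := P)
    (P' := gaussianReal 0 (u ⬝ᵥ S.mulVec u).toNNReal)
    (X := fun j ω => centeredStat Λ (fun t => ⟪u, f t⟫) (X j ω)) (Y := id)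
    (by rw [hvar]; exact HasLaw.id) hL
    (hind.comp (fun _ => centeredStat Λ fun t => ⟪u, f t⟫) fun _ => hmg)
    (fun j => by
      have : IdentDistrib (X j) (X 0) P P :=
        ⟨(hX j).measurable.aemeasurable, (hX 0).measurable.aemeasurable, (hX j).map_eq (hX 0)⟩
      exact this.comp hmg)
  have hlim := ProbabilityMeasure.tendsto_iff_tendsto_charFun.1 hclt.tendsto 1
  simp only [ProbabilityMeasure.coe_mk, Measure.map_id, hmean, mul_zero, sub_zero] at hlim ⊢
  -- The scalar limit has variance `toNNReal` of the quadratic form, which is the form itself only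
  -- when nonnegative.
  have hquad : 0 ≤ u ⬝ᵥ S.mulVec u := by
    rw [← hfS u]
    exact integral_nonneg fun t => sq_nonneg _
  rw [charFun_gaussianReal] at hlim
  rw [charFun_multivariateGaussian hS]
  convert! hlim using 2
  · rename_i n
    rw [charFun_map_eq_charFun_map_inner (hm n)]
    congr 2
    ext ω
    rw [inner_smul_right, inner_sum, Finset.sum_congr rfl fun j _ => hinner _]
  · simp [Real.coe_toNNReal _ hquad]

end CentralLimit

/-! ### Deterministic expansion of the two scoring corrections -/

section Expansion

variable {d : ℕ} {Θ : Set (EuclideanSpace ℝ (Fin d))} {T : Set ℝ}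
  {lam : EuclideanSpace ℝ (Fin d) → ℝ → ℝ} {ϑ₀ : EuclideanSpace ℝ (Fin d)} {K : ℝ}

/-- The score at `ϑ` integrated against the path minus its compensator under `ϑ₀`. -/
noncomputable def scoreStat (T : Set ℝ) (lam : EuclideanSpace ℝ (Fin d) → ℝ → ℝ)
    (ϑ₀ ϑ : EuclideanSpace ℝ (Fin d)) (x : StieltjesFunction ℝ) : EuclideanSpace ℝ (Fin d) :=
  centeredStat (intensityMeasure T (lam ϑ₀)) (T.indicator (score lam ϑ)) x

namespace IsBoundedModel

lemma scoreStat_eq (hM : IsBoundedModel Θ T lam ϑ₀ K) (ϑ : EuclideanSpace ℝ (Fin d))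
    (x : StieltjesFunction ℝ) :
    scoreStat T lam ϑ₀ ϑ x = (∫ t in T, score lam ϑ t ∂(jumpMeasure x)) -
      ∫ t in T, lam ϑ₀ t • score lam ϑ t := by
  rw [scoreStat, centeredStat, integral_indicator hM.measurableSet,
    integral_intensityMeasure hM.measurableSet (hM.family.integrable ϑ₀ hM.mem)
      (hM.family.pos ϑ₀ hM.mem)]
  congr 1
  refine setIntegral_congr_fun hM.measurableSet fun t ht => ?_
  simp only [Set.indicator_of_mem ht]

/-- Recentering at the true compensator separates a statistic of mean zero from the deterministic
drift. -/
lemma scoreIntegral_eq (hM : IsBoundedModel Θ T lam ϑ₀ K) {ϑ ϑ' : EuclideanSpace ℝ (Fin d)}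
    (hϑ : ϑ ∈ Θ) (hϑ' : ϑ' ∈ Θ) {x : StieltjesFunction ℝ} (hx : x.measure Set.univ < ∞) :
    scoreIntegral T lam ϑ ϑ' x = scoreStat T lam ϑ₀ ϑ x -
      ∫ t in T, (lam ϑ' t - lam ϑ₀ t) • score lam ϑ t := by
  rw [hM.scoreStat_eq, scoreIntegral, jumpMeasure_of_lt_top hx]
  simp only [sub_smul]
  rw [integral_sub (hM.integrableOn_lam_smul_score hϑ hϑ')
    (hM.integrableOn_lam_smul_score hϑ hM.mem)]
  abel

lemma scoringCorrection_eq (hM : IsBoundedModel Θ T lam ϑ₀ K) {ϑ ϑ' : EuclideanSpace ℝ (Fin d)}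
    (hϑ : ϑ ∈ Θ) (hϑ' : ϑ' ∈ Θ) {x : ℕ → StieltjesFunction ℝ}
    (hx : ∀ j, (x j).measure Set.univ < ∞) {N k : ℕ} (hNk : N ≤ k) :
    scoringCorrection Θ T lam N k x ϑ ϑ' = fisherInvOp T lam ϑ
      ((1 / (k : ℝ)) • ∑ j ∈ Finset.Ico N k, scoreStat T lam ϑ₀ ϑ (x j) -
        (((k : ℝ) - N) / k) • ∫ t in T, (lam ϑ' t - lam ϑ₀ t) • score lam ϑ t) := by
  rw [scoringCorrection, if_pos ⟨hϑ, hϑ'⟩, fisherInvOp,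
    Finset.sum_congr rfl fun j _ => hM.scoreIntegral_eq hϑ hϑ' (hx j), Finset.sum_sub_distrib,
    Finset.sum_const, Nat.card_Ico, smul_sub, ← Nat.cast_smul_eq_nsmul ℝ, smul_smul,
    Nat.cast_sub hNk, one_div_mul_eq_div]

/-- A scoring correction of `ϑ'` reproduces `ϑ₀` plus the linear statistic, up to an error which
is quadratic in the deviations from `ϑ₀`. -/
lemma norm_add_scoringCorrection_sub_le (hM : IsBoundedModel Θ T lam ϑ₀ K) {c : ℝ} (hc : 0 < c)
    (h : ∀ ϑ ∈ Θ, ∀ u, c * ‖u‖ ^ 2 ≤ ⟪u, fisherOp T lam ϑ u⟫)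
    {ϑ ϑ' : EuclideanSpace ℝ (Fin d)} (hϑ : ϑ ∈ Θ) (hϑ' : ϑ' ∈ Θ) {x : ℕ → StieltjesFunction ℝ}
    (hx : ∀ j, (x j).measure Set.univ < ∞) {N k : ℕ} (hNk : N ≤ k) (hk : 0 < k) :
    ‖ϑ' + scoringCorrection Θ T lam N k x ϑ ϑ' - ϑ₀ - fisherInvOp T lam ϑ
      ((1 / (k : ℝ)) • ∑ j ∈ Finset.Ico N k, scoreStat T lam ϑ₀ ϑ (x j))‖ ≤
      (N / k : ℝ) * ‖ϑ' - ϑ₀‖ + c⁻¹ * ((K * (K + 2 * K ^ 2) * ∫ t in T, lam ϑ₀ t) *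
        (‖ϑ' - ϑ‖ + ‖ϑ₀ - ϑ‖) * ‖ϑ' - ϑ₀‖) := by
  have hkR : (0 : ℝ) < k := Nat.cast_pos.2 hk
  have hNkR : (N : ℝ) ≤ k := Nat.cast_le.2 hNk
  set D := ∫ t in T, (lam ϑ' t - lam ϑ₀ t) • score lam ϑ t with hD
  -- The drift `D` is close to I(ϑ)(ϑ' - ϑ₀) but enters with weight (k - N)/k, so N/k of ϑ' - ϑ₀
  -- survives the cancellation.
  have e : ϑ' + scoringCorrection Θ T lam N k x ϑ ϑ' - ϑ₀ - fisherInvOp T lam ϑ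
      ((1 / (k : ℝ)) • ∑ j ∈ Finset.Ico N k, scoreStat T lam ϑ₀ ϑ (x j)) =
      (N / k : ℝ) • (ϑ' - ϑ₀) - (((k : ℝ) - N) / k) •
        fisherInvOp T lam ϑ (D - fisherOp T lam ϑ (ϑ' - ϑ₀)) := by
    have hr : (N / k : ℝ) = 1 - ((k : ℝ) - N) / k := by
      field_simp
      ring
    rw [hM.scoringCorrection_eq hϑ hϑ' hx hNk, map_sub, map_sub _ D,
      fisherInvOp_fisherOp hc (h ϑ hϑ), map_smul _ (((k : ℝ) - N) / k), hr]
    module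
  rw [e]
  have hr0 : 0 ≤ ((k : ℝ) - N) / k := div_nonneg (sub_nonneg.2 hNkR) hkR.le
  have hr1 : ((k : ℝ) - N) / k ≤ 1 := (div_le_one hkR).2 (by linarith [Nat.cast_nonneg (α := ℝ) N])
  refine (norm_sub_le _ _).trans (add_le_add ?_ ?_)
  · rw [norm_smul, Real.norm_of_nonneg (by positivity)]
  · rw [norm_smul, Real.norm_of_nonneg hr0]
    refine (mul_le_of_le_one_left (norm_nonneg _) hr1).trans
      ((norm_fisherInvOp_le hc (h ϑ hϑ) _).trans ?_)
    exact mul_le_mul_of_nonneg_left (hM.norm_integral_sub_fisherOp_le hϑ hϑ' hM.mem)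
      (inv_nonneg.2 hc.le)

/-- The deviations of the two estimates when the first one and the linear statistic are of their
typical orders `q = N⁻¹ᐟ²` and `p = k⁻¹ᐟ²`. -/
lemma exists_expansion_bound (hM : IsBoundedModel Θ T lam ϑ₀ K) {c : ℝ} (hc : 0 < c)
    (h : ∀ ϑ ∈ Θ, ∀ u, c * ‖u‖ ^ 2 ≤ ⟪u, fisherOp T lam ϑ u⟫) {M : ℝ} (hM0 : 0 ≤ M) :
    ∃ C : ℝ, 0 ≤ C ∧ ∀ (N k : ℕ) (p q : ℝ) (x : ℕ → StieltjesFunction ℝ)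
      (ϑ : EuclideanSpace ℝ (Fin d)), N ≤ k → 0 < k → 0 < p → p ≤ q →
      (N / k : ℝ) = p ^ 2 / q ^ 2 → (∀ j, (x j).measure Set.univ < ∞) → ϑ ∈ Θ →
      ‖(1 / (k : ℝ)) • ∑ j ∈ Finset.Ico N k, scoreStat T lam ϑ₀ ϑ (x j)‖ ≤ M * p →
      ‖ϑ - ϑ₀‖ ≤ M * q →
      ‖secondPreliminary Θ T lam N k x ϑ - ϑ₀‖ ≤ C * (p + q ^ 2) ∧
      (secondPreliminary Θ T lam N k x ϑ ∈ Θ →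
        ‖twoStepMLE Θ T lam N k x ϑ - ϑ₀ - fisherInvOp T lam ϑ
          ((1 / (k : ℝ)) • ∑ j ∈ Finset.Ico N k, scoreStat T lam ϑ₀ ϑ (x j))‖ ≤
          C * (p ^ 2 / q ^ 2 + p + q + q ^ 2) * (p + q ^ 2)) := by
  have hK := hM.bounds.nonneg
  have hL0 := hM.integral_lam_nonneg
  set L := K * (K + 2 * K ^ 2) * ∫ t in T, lam ϑ₀ t with hL
  have hLn : 0 ≤ L := by positivity
  -- The three terms come from the linear statistic, the surviving fraction N/k, and the quadratic
  -- remainder at ‖ϑ - ϑ₀‖ ≤ M q.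
  set C₁ := c⁻¹ * M + M + c⁻¹ * (L * M ^ 2) with hC₁
  have hC₁0 : 0 ≤ C₁ := by positivity
  -- The first term is the surviving fraction times the new error of order p + q²; the second bounds
  -- the product of ‖ϑ₂ - ϑ‖ + ‖ϑ₀ - ϑ‖ with that new error.
  set C₂ := C₁ + c⁻¹ * L * (C₁ + 2 * M) * C₁ with hC₂
  have hC₁₂ : C₁ ≤ C₂ := by
    have : 0 ≤ c⁻¹ * L * (C₁ + 2 * M) * C₁ := by positivity
    linarith
  refine ⟨C₂, hC₁0.trans hC₁₂, ?_⟩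
  intro N k p q x ϑ hNk hk hp hpq hpq2 hx hϑ hU hϑM
  have hq : 0 < q := hp.trans_le hpq
  set U := (1 / (k : ℝ)) • ∑ j ∈ Finset.Ico N k, scoreStat T lam ϑ₀ ϑ (x j) with hUdef
  set ϑ₂ := secondPreliminary Θ T lam N k x ϑ with hϑ₂
  have hBU : ‖fisherInvOp T lam ϑ U‖ ≤ c⁻¹ * (M * p) :=
    (norm_fisherInvOp_le hc (h ϑ hϑ) U).trans (by gcongr)
  have h1 := hM.norm_add_scoringCorrection_sub_le hc h hϑ hϑ hx hNk hk
  rw [← hUdef, ← hL, hpq2, sub_self, norm_zero, zero_add, norm_sub_rev ϑ₀ ϑ] at h1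
  change ‖ϑ₂ - ϑ₀ - fisherInvOp T lam ϑ U‖ ≤ _ at h1
  have h2 : ‖ϑ₂ - ϑ₀‖ ≤ C₁ * (p + q ^ 2) := by
    have t1 : ‖ϑ₂ - ϑ₀‖ ≤ ‖ϑ₂ - ϑ₀ - fisherInvOp T lam ϑ U‖ + ‖fisherInvOp T lam ϑ U‖ := by
      simpa using norm_add_le (ϑ₂ - ϑ₀ - fisherInvOp T lam ϑ U) (fisherInvOp T lam ϑ U)
    have t2 : p ^ 2 / q ^ 2 * ‖ϑ - ϑ₀‖ ≤ M * p := by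
      calc p ^ 2 / q ^ 2 * ‖ϑ - ϑ₀‖ ≤ p ^ 2 / q ^ 2 * (M * q) := by gcongr
        _ = M * p * (p / q) := by field_simp
        _ ≤ M * p * 1 := by
            gcongr
            exact (div_le_one hq).2 hpq
        _ = M * p := mul_one _
    have t3 : c⁻¹ * (L * ‖ϑ - ϑ₀‖ * ‖ϑ - ϑ₀‖) ≤ c⁻¹ * (L * (M * q) * (M * q)) := by gcongr
    have t4 : 0 ≤ c⁻¹ * (L * M ^ 2) * p + (c⁻¹ * M + M) * q ^ 2 := by positivity
    calc ‖ϑ₂ - ϑ₀‖ ≤ (M * p + c⁻¹ * (L * (M * q) * (M * q))) + c⁻¹ * (M * p) := by linarith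
      _ ≤ C₁ * (p + q ^ 2) := by rw [hC₁]; linarith
  refine ⟨h2.trans (by gcongr), fun hϑ₂Θ => ?_⟩
  have h3 := hM.norm_add_scoringCorrection_sub_le hc h hϑ hϑ₂Θ hx hNk hk
  rw [← hUdef, ← hL, hpq2] at h3
  change ‖twoStepMLE Θ T lam N k x ϑ - ϑ₀ - fisherInvOp T lam ϑ U‖ ≤ _ at h3
  refine h3.trans ?_
  have t1 : ‖ϑ₂ - ϑ‖ + ‖ϑ₀ - ϑ‖ ≤ C₁ * (p + q ^ 2) + 2 * M * q := by
    have := norm_sub_le_norm_sub_add_norm_sub ϑ₂ ϑ₀ ϑ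
    rw [norm_sub_rev ϑ₀ ϑ] at this ⊢
    linarith
  calc p ^ 2 / q ^ 2 * ‖ϑ₂ - ϑ₀‖ + c⁻¹ * (L * (‖ϑ₂ - ϑ‖ + ‖ϑ₀ - ϑ‖) * ‖ϑ₂ - ϑ₀‖)
      ≤ p ^ 2 / q ^ 2 * (C₁ * (p + q ^ 2)) +
        c⁻¹ * (L * (C₁ * (p + q ^ 2) + 2 * M * q) * (C₁ * (p + q ^ 2))) := by gcongr
    _ ≤ C₁ * (p ^ 2 / q ^ 2 + p + q + q ^ 2) * (p + q ^ 2) + c⁻¹ * L * (C₁ + 2 * M) * C₁ *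
        (p ^ 2 / q ^ 2 + p + q + q ^ 2) * (p + q ^ 2) := by
        have u1 : p ^ 2 / q ^ 2 ≤ p ^ 2 / q ^ 2 + p + q + q ^ 2 := by
          have : 0 ≤ p + q + q ^ 2 := by positivity
          linarith
        have u2 : C₁ * (p + q ^ 2) + 2 * M * q ≤
            (C₁ + 2 * M) * (p ^ 2 / q ^ 2 + p + q + q ^ 2) := by
          have : 0 ≤ C₁ * (p ^ 2 / q ^ 2 + q) + 2 * M * (p ^ 2 / q ^ 2 + p + q ^ 2) := by
            positivity
          linarith
        calc _ ≤ (p ^ 2 / q ^ 2 + p + q + q ^ 2) * (C₁ * (p + q ^ 2)) +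
              c⁻¹ * (L * ((C₁ + 2 * M) * (p ^ 2 / q ^ 2 + p + q + q ^ 2)) *
                (C₁ * (p + q ^ 2))) := by gcongr
          _ = _ := by ring
    _ = C₂ * (p ^ 2 / q ^ 2 + p + q + q ^ 2) * (p + q ^ 2) := by rw [hC₂]; ring

end IsBoundedModel

end Expansion

/-! ### Joint measurability, and independence of the first estimate from later observations -/

section Decoupling

variable {Ω : Type*} [MeasurableSpace Ω] {P : Measure Ω}

lemma StieltjesFunction.iIndepFun_of_paths {X : ℕ → Ω → StieltjesFunction ℝ}
    (h : iIndepFun (fun (j : ℕ) (ω : Ω) (t : ℝ) => X j ω t) P) : iIndepFun X P := by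
  rw [iIndepFun_iff] at h ⊢
  intro s f' H
  refine h s fun i hi => ?_
  have := H i hi
  rwa [StieltjesFunction.instMeasurableSpaceReal, MeasurableSpace.comap_comp] at this

lemma indepFun_of_measurable_observedSigma [IsProbabilityMeasure P]
    {X : ℕ → Ω → StieltjesFunction ℝ} (hX : ∀ j, Measurable (X j)) (hind : iIndepFun X P)
    {β : Type*} [MeasurableSpace β] {N : ℕ} {Y : Ω → β} (hY : Measurable[observedSigma X N] Y)
    {J : Finset ℕ} (hJ : Disjoint (Finset.range N) J) :
    IndepFun Y (fun ω (j : J) => X j ω) P := by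
  have h := hind.indepFun_finset (Finset.range N) J hJ hX
  rw [IndepFun_iff_Indep] at h ⊢
  refine indep_of_indep_of_le_left h (hY.comap_le.trans ?_)
  refine iSup₂_le fun j hj => iSup_le fun t => ?_
  have hm : Measurable[MeasurableSpace.comap (fun ω (i : Finset.range N) => X i ω) inferInstance]
      fun ω => X j ω t :=
    Measurable.comp (g := fun w : Finset.range N → StieltjesFunction ℝ => w ⟨j, hj⟩ t)
      ((measurable_eval_real t).comp (measurable_pi_apply (⟨j, hj⟩ : Finset.range N)))
      (comap_measurable fun ω (i : Finset.range N) => X i ω)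
  exact hm.comap_le

lemma observedSigma_le {X : ℕ → Ω → StieltjesFunction ℝ} (hX : ∀ j, Measurable (X j)) (N : ℕ) :
    observedSigma X N ≤ ‹MeasurableSpace Ω› :=
  iSup₂_le fun j _ => iSup_le fun t => ((measurable_eval_real t).comp (hX j)).comap_le

variable {F : Type*} [NormedAddCommGroup F] [NormedSpace ℝ F] {Λ : Measure ℝ} [IsFiniteMeasure Λ]

lemma centeredStat_sub {f g : ℝ → F} (hf : StronglyMeasurable f) (hg : StronglyMeasurable g)
    {B : ℝ} (hfB : ∀ t, ‖f t‖ ≤ B) (hgB : ∀ t, ‖g t‖ ≤ B) (x : StieltjesFunction ℝ) :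
    centeredStat Λ f x - centeredStat Λ g x = centeredStat Λ (fun t => f t - g t) x := by
  rw [centeredStat, centeredStat, centeredStat,
    integral_sub (.of_bound hf.aestronglyMeasurable B (.of_forall hfB))
      (.of_bound hg.aestronglyMeasurable B (.of_forall hgB)),
    integral_sub (.of_bound hf.aestronglyMeasurable B (.of_forall hfB))
      (.of_bound hg.aestronglyMeasurable B (.of_forall hgB))]
  abel

lemma norm_centeredStat_le {f : ℝ → F} {B : ℝ} (hB : ∀ t, ‖f t‖ ≤ B) (x : StieltjesFunction ℝ) :
    ‖centeredStat Λ f x‖ ≤ ((jumpMeasure x).real Set.univ + Λ.real Set.univ) * B := by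
  refine (norm_sub_le _ _).trans ((add_le_add
    (norm_integral_le_of_norm_le_const (.of_forall hB))
    (norm_integral_le_of_norm_le_const (.of_forall hB))).trans_eq ?_)
  ring

variable {d : ℕ} {Θ : Set (EuclideanSpace ℝ (Fin d))} {T : Set ℝ}
  {lam : EuclideanSpace ℝ (Fin d) → ℝ → ℝ} {ϑ₀ : EuclideanSpace ℝ (Fin d)} {K : ℝ}

namespace IsBoundedModel

lemma isFiniteMeasure_intensityMeasure (hM : IsBoundedModel Θ T lam ϑ₀ K) :
    IsFiniteMeasure (intensityMeasure T (lam ϑ₀)) :=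
  _root_.isFiniteMeasure_intensityMeasure (hM.family.integrable ϑ₀ hM.mem)

lemma measurable_indicator_score (hM : IsBoundedModel Θ T lam ϑ₀ K)
    {ϑ : EuclideanSpace ℝ (Fin d)} (hϑ : ϑ ∈ Θ) : Measurable (T.indicator (score lam ϑ)) :=
  Measurable.indicator_of_subtype hM.measurableSet
    (hM.regular.measurable_score hM.family hM.isOpen hϑ)

lemma norm_indicator_score_le (hM : IsBoundedModel Θ T lam ϑ₀ K) {ϑ : EuclideanSpace ℝ (Fin d)}
    (hϑ : ϑ ∈ Θ) (t : ℝ) : ‖T.indicator (score lam ϑ) t‖ ≤ K := by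
  by_cases ht : t ∈ T
  · rw [Set.indicator_of_mem ht]
    exact hM.bounds.norm_score_le ϑ hϑ t ht
  · rw [Set.indicator_of_notMem ht, norm_zero]
    exact hM.bounds.nonneg

lemma norm_indicator_score_sub_le (hM : IsBoundedModel Θ T lam ϑ₀ K)
    {ϑ ϑ' : EuclideanSpace ℝ (Fin d)} (hϑ : ϑ ∈ Θ) (hϑ' : ϑ' ∈ Θ) (t : ℝ) :
    ‖T.indicator (score lam ϑ) t - T.indicator (score lam ϑ') t‖ ≤ K * ‖ϑ - ϑ'‖ := by
  by_cases ht : t ∈ T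
  · rw [Set.indicator_of_mem ht, Set.indicator_of_mem ht]
    exact hM.bounds.norm_score_sub_le ϑ hϑ ϑ' hϑ' t ht
  · rw [Set.indicator_of_notMem ht, Set.indicator_of_notMem ht, sub_self, norm_zero]
    exact mul_nonneg hM.bounds.nonneg (norm_nonneg _)

lemma scoreStat_sub (hM : IsBoundedModel Θ T lam ϑ₀ K) {ϑ ϑ' : EuclideanSpace ℝ (Fin d)}
    (hϑ : ϑ ∈ Θ) (hϑ' : ϑ' ∈ Θ) (x : StieltjesFunction ℝ) :
    scoreStat T lam ϑ₀ ϑ x - scoreStat T lam ϑ₀ ϑ' x =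
      centeredStat (intensityMeasure T (lam ϑ₀))
        (fun t => T.indicator (score lam ϑ) t - T.indicator (score lam ϑ') t) x := by
  have := hM.isFiniteMeasure_intensityMeasure
  exact centeredStat_sub (hM.measurable_indicator_score hϑ).stronglyMeasurable
    (hM.measurable_indicator_score hϑ').stronglyMeasurable (hM.norm_indicator_score_le hϑ)
    (hM.norm_indicator_score_le hϑ') x

lemma measurable_scoreStat (hM : IsBoundedModel Θ T lam ϑ₀ K) {ϑ : EuclideanSpace ℝ (Fin d)}
    (hϑ : ϑ ∈ Θ) : Measurable (scoreStat T lam ϑ₀ ϑ) :=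
  measurable_centeredStat _ (hM.measurable_indicator_score hϑ).stronglyMeasurable

/-- A Carathéodory function: Lipschitz in ϑ for a fixed path, since the jump measure is finite, and
measurable in the path for fixed ϑ. -/
lemma measurable_uncurry_scoreStat (hM : IsBoundedModel Θ T lam ϑ₀ K) :
    Measurable (Function.uncurry fun (ϑ : Θ) x => scoreStat T lam ϑ₀ ϑ x) := by
  have := hM.isFiniteMeasure_intensityMeasure
  refine measurable_uncurry_of_continuous_of_measurable (fun x => ?_)
    fun ϑ => hM.measurable_scoreStat ϑ.2
  refine (LipschitzWith.of_dist_le' (K := ((jumpMeasure x).real Set.univ +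
    (intensityMeasure T (lam ϑ₀)).real Set.univ) * K) fun ϑ ϑ' => ?_).continuous
  rw [dist_eq_norm, hM.scoreStat_sub ϑ.2 ϑ'.2, Subtype.dist_eq, dist_eq_norm, mul_assoc]
  exact norm_centeredStat_le (hM.norm_indicator_score_sub_le ϑ.2 ϑ'.2) x

lemma measurable_uncurry_fisherInvOp (hM : IsBoundedModel Θ T lam ϑ₀ K) {c : ℝ} (hc : 0 < c)
    (h : ∀ ϑ ∈ Θ, ∀ u, c * ‖u‖ ^ 2 ≤ ⟪u, fisherOp T lam ϑ u⟫) :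
    Measurable (Function.uncurry fun (ϑ : Θ) u => fisherInvOp T lam ϑ u) := by
  refine measurable_uncurry_of_continuous_of_measurable (fun u => ?_)
    fun ϑ => (fisherInvOp T lam ϑ).measurable
  refine (LipschitzWith.of_dist_le' (K := (c⁻¹ * c⁻¹ * (3 * K ^ 3 * ∫ t in T, lam ϑ₀ t)) * ‖u‖)
    fun ϑ ϑ' => ?_).continuous
  rw [dist_eq_norm, Subtype.dist_eq, dist_eq_norm]
  exact (norm_fisherInvOp_sub_le hM hc h ϑ'.2 ϑ.2 u).trans_eq (by ring)

lemma measurable_uncurry_integral_lam_smul_score (hM : IsBoundedModel Θ T lam ϑ₀ K) :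
    Measurable (Function.uncurry fun ϑ ϑ' : Θ =>
      ∫ t in T, (lam ϑ' t - lam ϑ₀ t) • score lam ϑ t) := by
  have e : ∀ ϑ ϑ' : Θ, ∫ t in T, (lam ϑ' t - lam ϑ₀ t) • score lam ϑ t =
      (∫ t in T, lam ϑ' t • score lam ϑ t) - ∫ t in T, lam ϑ₀ t • score lam ϑ t :=
    fun ϑ ϑ' => by
      simp only [sub_smul]
      exact integral_sub (hM.integrableOn_lam_smul_score ϑ.2 ϑ'.2)
        (hM.integrableOn_lam_smul_score ϑ.2 hM.mem)
  simp only [e]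
  have h₁ : ∀ {ϑ' : EuclideanSpace ℝ (Fin d)}, ϑ' ∈ Θ →
      Continuous fun ϑ : Θ => ∫ t in T, lam ϑ' t • score lam ϑ t := fun {ϑ'} hϑ' => by
    refine (LipschitzWith.of_dist_le' (K := K ^ 2 * ∫ t in T, lam ϑ₀ t) fun ϑ₁ ϑ₂ =>
      ?_).continuous
    rw [dist_eq_norm, Subtype.dist_eq, dist_eq_norm]
    exact (hM.norm_integral_lam_smul_score_sub_le ϑ₁.2 hϑ' ϑ₂.2 hϑ').trans_eq (by simp)
  refine measurable_uncurry_of_continuous_of_measurable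
    (fun ϑ' => (h₁ ϑ'.2).sub (h₁ hM.mem)) fun ϑ => ?_
  refine (Continuous.sub ?_ continuous_const).measurable
  refine (LipschitzWith.of_dist_le' (K := K ^ 2 * ∫ t in T, lam ϑ₀ t) fun ϑ₁ ϑ₂ =>
    ?_).continuous
  rw [dist_eq_norm, Subtype.dist_eq, dist_eq_norm]
  exact (hM.norm_integral_lam_smul_score_sub_le ϑ.2 ϑ₁.2 ϑ.2 ϑ₂.2).trans_eq (by simp)

lemma aemeasurable_scoringCorrection (hM : IsBoundedModel Θ T lam ϑ₀ K) {c : ℝ} (hc : 0 < c)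
    (h : ∀ ϑ ∈ Θ, ∀ u, c * ‖u‖ ^ 2 ≤ ⟪u, fisherOp T lam ϑ u⟫) {X : ℕ → Ω → StieltjesFunction ℝ}
    (hX : ∀ j, Measurable (X j)) (hXf : ∀ᵐ ω ∂P, ∀ j, (X j ω).measure Set.univ < ∞) (N k : ℕ)
    {a b : Ω → EuclideanSpace ℝ (Fin d)} (ha : Measurable a) (hb : AEMeasurable b P) :
    AEMeasurable (fun ω => scoringCorrection Θ T lam N k (fun j => X j ω) (a ω) (b ω)) P := by
  -- In the second correction `b` is itself an estimate known only to be a.e. measurable, so it is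
  -- replaced by a measurable version.
  wlog hbm : Measurable b generalizing b
  · refine (this hb.measurable_mk.aemeasurable hb.measurable_mk).congr ?_
    filter_upwards [hb.ae_eq_mk] with ω hω
    rw [hω]
  let A : Set Ω := {ω | a ω ∈ Θ ∧ b ω ∈ Θ}
  have hA : MeasurableSet A :=
    (ha hM.isOpen.measurableSet).inter (hbm hM.isOpen.measurableSet)
  let g : Ω → EuclideanSpace ℝ (Fin d) := fun ω => fisherInvOp T lam (a ω)
    ((1 / (k : ℝ)) • ∑ j ∈ Finset.Ico N k, (scoreStat T lam ϑ₀ (a ω) (X j ω) -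
      ∫ t in T, (lam (b ω) t - lam ϑ₀ t) • score lam (a ω) t))
  have hg : Measurable fun ω : A => g ω := by
    have haA : Measurable fun ω : A => (⟨a ω, ω.2.1⟩ : Θ) :=
      (ha.comp measurable_subtype_coe).subtype_mk
    have hbA : Measurable fun ω : A => (⟨b ω, ω.2.2⟩ : Θ) :=
      (hbm.comp measurable_subtype_coe).subtype_mk
    have hs : ∀ j, Measurable fun ω : A => scoreStat T lam ϑ₀ (a ω) (X j ω) -
        ∫ t in T, (lam (b ω) t - lam ϑ₀ t) • score lam (a ω) t := fun j =>
      (hM.measurable_uncurry_scoreStat.comp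
        (haA.prodMk ((hX j).comp measurable_subtype_coe))).sub
        (hM.measurable_uncurry_integral_lam_smul_score.comp (haA.prodMk hbA))
    have hsum : Measurable fun ω : A => ∑ j ∈ Finset.Ico N k,
        (scoreStat T lam ϑ₀ (a ω) (X j ω) -
        ∫ t in T, (lam (b ω) t - lam ϑ₀ t) • score lam (a ω) t) :=
      Finset.measurable_fun_sum _ fun j _ => hs j
    have hsk := haA.prodMk (hsum.const_smul (1 / (k : ℝ)))
    have := (hM.measurable_uncurry_fisherInvOp hc h).comp hsk
    simp only [Function.comp_def, Function.uncurry] at this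
    exact this
  refine ⟨A.indicator g, Measurable.indicator_of_subtype hA hg, ?_⟩
  filter_upwards [hXf] with ω hω
  by_cases hωA : ω ∈ A
  · rw [Set.indicator_of_mem hωA, scoringCorrection, if_pos (show a ω ∈ Θ ∧ b ω ∈ Θ from hωA),
      Finset.sum_congr rfl fun j _ => hM.scoreIntegral_eq hωA.1 hωA.2 (hω j)]
    rfl
  · rw [Set.indicator_of_notMem hωA, scoringCorrection, if_neg (show ¬(a ω ∈ Θ ∧ b ω ∈ Θ) from hωA)]

lemma aemeasurable_secondPreliminary (hM : IsBoundedModel Θ T lam ϑ₀ K) {c : ℝ} (hc : 0 < c)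
    (h : ∀ ϑ ∈ Θ, ∀ u, c * ‖u‖ ^ 2 ≤ ⟪u, fisherOp T lam ϑ u⟫) {X : ℕ → Ω → StieltjesFunction ℝ}
    (hX : ∀ j, Measurable (X j)) (hXf : ∀ᵐ ω ∂P, ∀ j, (X j ω).measure Set.univ < ∞) (N k : ℕ)
    {a : Ω → EuclideanSpace ℝ (Fin d)} (ha : Measurable a) :
    AEMeasurable (fun ω => secondPreliminary Θ T lam N k (fun j => X j ω) (a ω)) P :=
  ha.aemeasurable.add (hM.aemeasurable_scoringCorrection hc h hX hXf N k ha ha.aemeasurable)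

lemma aemeasurable_twoStepMLE (hM : IsBoundedModel Θ T lam ϑ₀ K) {c : ℝ} (hc : 0 < c)
    (h : ∀ ϑ ∈ Θ, ∀ u, c * ‖u‖ ^ 2 ≤ ⟪u, fisherOp T lam ϑ u⟫) {X : ℕ → Ω → StieltjesFunction ℝ}
    (hX : ∀ j, Measurable (X j)) (hXf : ∀ᵐ ω ∂P, ∀ j, (X j ω).measure Set.univ < ∞) (N k : ℕ)
    {a : Ω → EuclideanSpace ℝ (Fin d)} (ha : Measurable a) :
    AEMeasurable (fun ω => twoStepMLE Θ T lam N k (fun j => X j ω) (a ω)) P :=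
  have h₂ := hM.aemeasurable_secondPreliminary hc h hX hXf N k ha
  h₂.add (hM.aemeasurable_scoringCorrection hc h hX hXf N k ha h₂)

variable [IsProbabilityMeasure P]

/-- Chebyshev's inequality for the score statistic at `ϑ₀`. -/
lemma measure_le_norm_sum_scoreStat (hM : IsBoundedModel Θ T lam ϑ₀ K)
    {X : ℕ → Ω → StieltjesFunction ℝ}
    (hX : ∀ j, IsPoissonPath P (intensityMeasure T (lam ϑ₀)) (X j)) (hind : iIndepFun X P)
    (J : Finset ℕ) {a : ℝ} (ha : 0 < a) :
    P {ω | a ≤ ‖∑ j ∈ J, scoreStat T lam ϑ₀ ϑ₀ (X j ω)‖} ≤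
      ENNReal.ofReal (J.card * (K ^ 2 * (intensityMeasure T (lam ϑ₀)).real Set.univ) / a ^ 2) :=
  have := hM.isFiniteMeasure_intensityMeasure
  IsPoissonPath.measure_le_norm_sum_centeredStat hX hind (hM.measurable_indicator_score hM.mem)
    (hM.norm_indicator_score_le hM.mem) J ha

/-- The increment of the score statistic between `ϑ₀` and an estimate which is independent of the
observations of the statistic. -/
lemma measure_le_norm_sum_scoreStat_sub (hM : IsBoundedModel Θ T lam ϑ₀ K)
    {X : ℕ → Ω → StieltjesFunction ℝ}
    (hX : ∀ j, IsPoissonPath P (intensityMeasure T (lam ϑ₀)) (X j)) (hind : iIndepFun X P)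
    {N : ℕ} {Y : Ω → EuclideanSpace ℝ (Fin d)} (hY : Measurable[observedSigma X N] Y)
    {J : Finset ℕ} (hJ : Disjoint (Finset.range N) J) {r a : ℝ} (ha : 0 < a) :
    P {ω | (Y ω ∈ Θ ∧ ‖Y ω - ϑ₀‖ < r) ∧ a ≤ ‖∑ j ∈ J, (scoreStat T lam ϑ₀ (Y ω) (X j ω) -
      scoreStat T lam ϑ₀ ϑ₀ (X j ω))‖} ≤ ENNReal.ofReal
        (J.card * ((K * r) ^ 2 * (intensityMeasure T (lam ϑ₀)).real Set.univ) / a ^ 2) := by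
  have := hM.isFiniteMeasure_intensityMeasure
  have hXm := fun j => (hX j).measurable
  -- The increment as a function of a frozen parameter and of the paths in `J`. Its measurability is
  -- available over Θ only, hence the indicator.
  let g : EuclideanSpace ℝ (Fin d) × (J → StieltjesFunction ℝ) → EuclideanSpace ℝ (Fin d) :=
    fun p => ∑ j : J, (scoreStat T lam ϑ₀ p.1 (p.2 j) - scoreStat T lam ϑ₀ ϑ₀ (p.2 j))
  let s : Set (EuclideanSpace ℝ (Fin d) × (J → StieltjesFunction ℝ)) := {p | p.1 ∈ Θ}
  have hs : MeasurableSet s := measurable_fst hM.isOpen.measurableSet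
  have hg : Measurable (s.indicator g) := by
    refine Measurable.indicator_of_subtype hs (Finset.measurable_fun_sum _ fun j _ => ?_)
    have h1 : Measurable fun p : s => (⟨p.1.1, p.2⟩ : Θ) :=
      (measurable_fst.comp measurable_subtype_coe).subtype_mk
    have h2 : Measurable fun p : s => p.1.2 j :=
      (measurable_pi_apply j).comp (measurable_snd.comp measurable_subtype_coe)
    exact (hM.measurable_uncurry_scoreStat.comp (h1.prodMk h2)).sub
      ((hM.measurable_scoreStat hM.mem).comp h2)
  let A : Set (EuclideanSpace ℝ (Fin d) × (J → StieltjesFunction ℝ)) :=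
    {p | (p.1 ∈ Θ ∧ ‖p.1 - ϑ₀‖ < r) ∧ a ≤ ‖s.indicator g p‖}
  have hA : MeasurableSet A :=
    (hs.inter (measurableSet_lt (measurable_fst.sub_const ϑ₀).norm measurable_const)).inter
      (measurableSet_le measurable_const hg.norm)
  have key := measure_le_of_indepFun (hY.mono (observedSigma_le hXm N) le_rfl)
    (measurable_pi_lambda _ fun j : J => hXm j)
    (indepFun_of_measurable_observedSigma hXm hind hY hJ) hA
    (η := ENNReal.ofReal
        (J.card * ((K * r) ^ 2 * (intensityMeasure T (lam ϑ₀)).real Set.univ) / a ^ 2))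
    fun y => ?_
  · refine (measure_mono fun ω hω => ?_).trans key
    refine ⟨hω.1, ?_⟩
    rw [Set.indicator_of_mem (show _ ∈ s from hω.1.1)]
    refine hω.2.trans_eq ?_
    rw [← Finset.sum_coe_sort J]
  -- For an admissible frozen y this is a centered statistic of a difference of scores bounded by K
  -- r; otherwise the event is empty.
  · by_cases hy : y ∈ Θ ∧ ‖y - ϑ₀‖ < r
    · have hd : ∀ t, ‖T.indicator (score lam y) t - T.indicator (score lam ϑ₀) t‖ ≤ K * r :=
        fun t => (hM.norm_indicator_score_sub_le hy.1 hM.mem t).trans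
          (mul_le_mul_of_nonneg_left hy.2.le hM.bounds.nonneg)
      refine (measure_mono fun ω hω => ?_).trans
        (IsPoissonPath.measure_le_norm_sum_centeredStat hX hind
          ((hM.measurable_indicator_score hy.1).sub (hM.measurable_indicator_score hM.mem))
          hd J ha)
      have h2 := hω.2
      rw [Set.indicator_of_mem (show _ ∈ s from hω.1.1)] at h2
      refine h2.trans_eq ?_
      rw [← Finset.sum_coe_sort J]
      exact congrArg norm (Finset.sum_congr rfl fun j _ => hM.scoreStat_sub hy.1 hM.mem _)
    · have : {ω | (y, fun j : J => X j ω) ∈ A} = ∅ :=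
        Set.eq_empty_of_forall_notMem fun ω hω => hy hω.1
      rw [this, measure_empty]
      exact zero_le

end IsBoundedModel

end Decoupling

/-! ### Limit law of the linear term and the convergence rates -/

section LimitLaw

variable {Ω : Type*} [MeasurableSpace Ω] {P : Measure Ω} {d : ℕ}
  {Θ : Set (EuclideanSpace ℝ (Fin d))} {T : Set ℝ}
  {lam : EuclideanSpace ℝ (Fin d) → ℝ → ℝ} {ϑ₀ : EuclideanSpace ℝ (Fin d)} {K c : ℝ}

lemma isHermitian_fisherInfo (T : Set ℝ) (lam : EuclideanSpace ℝ (Fin d) → ℝ → ℝ)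
    (ϑ : EuclideanSpace ℝ (Fin d)) : (fisherInfo T lam ϑ).IsHermitian := by
  ext i j
  simp only [fisherInfo, Matrix.conjTranspose_apply, Matrix.of_apply, star_trivial]
  exact integral_congr_ae (.of_forall fun t => by simp only [mul_comm])

lemma posDef_fisherInfo {ϑ : EuclideanSpace ℝ (Fin d)} (hc : 0 < c)
    (h : ∀ u, c * ‖u‖ ^ 2 ≤ ⟪u, fisherOp T lam ϑ u⟫) : (fisherInfo T lam ϑ).PosDef := by
  refine .of_dotProduct_mulVec_pos (isHermitian_fisherInfo T lam ϑ) fun x hx => ?_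
  have h1 := h (WithLp.toLp 2 x)
  rw [fisherOp, Matrix.inner_toEuclideanCLM] at h1
  have h2 : 0 < ‖WithLp.toLp 2 x‖ := norm_pos_iff.2 fun h0 => hx (by
    have := congrArg WithLp.ofLp h0
    simpa using this)
  rw [star_trivial]
  exact (by positivity : 0 < c * ‖WithLp.toLp 2 x‖ ^ 2).trans_le h1

namespace IsBoundedModel

/-- The Fisher operator is symmetric by its integral form, and its inverse inherits the symmetry. -/
lemma inner_fisherInvOp_comm (hM : IsBoundedModel Θ T lam ϑ₀ K) {ϑ : EuclideanSpace ℝ (Fin d)}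
    (hϑ : ϑ ∈ Θ) (hc : 0 < c) (h : ∀ u, c * ‖u‖ ^ 2 ≤ ⟪u, fisherOp T lam ϑ u⟫)
    (u v : EuclideanSpace ℝ (Fin d)) :
    ⟪u, fisherInvOp T lam ϑ v⟫ = ⟪fisherInvOp T lam ϑ u, v⟫ := by
  have hs : ∀ x y, ⟪x, fisherOp T lam ϑ y⟫ = ⟪y, fisherOp T lam ϑ x⟫ := fun x y => by
    rw [hM.inner_fisherOp hϑ, hM.inner_fisherOp hϑ]
    refine integral_congr_ae (.of_forall fun t => ?_)
    simp only [real_inner_comm _ (score lam ϑ t)]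
    ring
  conv_lhs => rw [← fisherOp_fisherInvOp hc h u, real_inner_comm, hs]
  rw [fisherOp_fisherInvOp hc h]

/-- The covariance of the score normalized by the inverse Fisher information. -/
lemma integral_inner_fisherInvOp_sq (hM : IsBoundedModel Θ T lam ϑ₀ K) (hc : 0 < c)
    (h : ∀ u, c * ‖u‖ ^ 2 ≤ ⟪u, fisherOp T lam ϑ₀ u⟫) (u : EuclideanSpace ℝ (Fin d)) :
    ∫ t, ⟪u, fisherInvOp T lam ϑ₀ (T.indicator (score lam ϑ₀) t)⟫ ^ 2
      ∂(intensityMeasure T (lam ϑ₀)) = u ⬝ᵥ (fisherInfo T lam ϑ₀)⁻¹.mulVec u := by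
  rw [integral_intensityMeasure hM.measurableSet (hM.family.integrable ϑ₀ hM.mem)
    (hM.family.pos ϑ₀ hM.mem), ← Matrix.inner_toEuclideanCLM]
  change _ = ⟪u, fisherInvOp T lam ϑ₀ u⟫
  -- With w = I⁻¹u the right side is ⟨w, I w⟩ = ∫ λ ⟨w, ℓ̇⟩².
  conv_rhs => rw [← fisherOp_fisherInvOp hc h u, fisherInvOp_fisherOp hc h, real_inner_comm,
    hM.inner_fisherOp hM.mem]
  refine setIntegral_congr_fun hM.measurableSet fun t ht => ?_
  simp only [Set.indicator_of_mem ht, smul_eq_mul]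
  rw [hM.inner_fisherInvOp_comm hM.mem hc h u, sq,
    real_inner_comm (fisherInvOp T lam ϑ₀ u) (score lam ϑ₀ t)]

lemma fisherInvOp_scoreStat (hM : IsBoundedModel Θ T lam ϑ₀ K) (x : StieltjesFunction ℝ) :
    fisherInvOp T lam ϑ₀ (scoreStat T lam ϑ₀ ϑ₀ x) =
      centeredStat (intensityMeasure T (lam ϑ₀))
        (fun t => fisherInvOp T lam ϑ₀ (T.indicator (score lam ϑ₀) t)) x :=
  have := hM.isFiniteMeasure_intensityMeasure
  (fisherInvOp T lam ϑ₀).apply_centeredStat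
    (hM.measurable_indicator_score hM.mem).stronglyMeasurable (hM.norm_indicator_score_le hM.mem) x

lemma tendstoInDistribution_sum_fisherInvOp_scoreStat [IsProbabilityMeasure P]
    (hM : IsBoundedModel Θ T lam ϑ₀ K) (hc : 0 < c)
    (h : ∀ u, c * ‖u‖ ^ 2 ≤ ⟪u, fisherOp T lam ϑ₀ u⟫) {X : ℕ → Ω → StieltjesFunction ℝ}
    (hX : ∀ j, IsPoissonPath P (intensityMeasure T (lam ϑ₀)) (X j)) (hind : iIndepFun X P) :
    TendstoInDistribution
      (fun (n : ℕ) ω => (√n)⁻¹ • ∑ j ∈ Finset.range n,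
        fisherInvOp T lam ϑ₀ (scoreStat T lam ϑ₀ ϑ₀ (X j ω))) atTop id
      (fun _ => P) (multivariateGaussian 0 (fisherInfo T lam ϑ₀)⁻¹) := by
  have := hM.isFiniteMeasure_intensityMeasure
  simp only [hM.fisherInvOp_scoreStat]
  exact IsPoissonPath.tendstoInDistribution_sum_centeredStat hX hind
    ((fisherInvOp T lam ϑ₀).measurable.comp (hM.measurable_indicator_score hM.mem))
    (fun t => (norm_fisherInvOp_le hc h _).trans (mul_le_mul_of_nonneg_left
      (hM.norm_indicator_score_le hM.mem t) (inv_nonneg.2 hc.le)))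
    (posDef_fisherInfo hc h).inv.posSemidef (hM.integral_inner_fisherInvOp_sq hc h)

end IsBoundedModel

lemma tendsto_measure_zero_of_eventually_le_ofReal {ι : Type*} {l : Filter ι} {A : ι → Set Ω}
    (h : ∀ η : ℝ, 0 < η → ∀ᶠ n in l, P (A n) ≤ ENNReal.ofReal η) :
    Tendsto (fun n => P (A n)) l (𝓝 0) := by
  refine ENNReal.tendsto_nhds_zero.2 fun ε hε => ?_
  -- Truncation at 1 covers ε = ∞, which is not `ENNReal.ofReal` of a real level.
  have h1 : min ε 1 ≠ ∞ := (min_le_right ε 1).trans_lt ENNReal.one_lt_top |>.ne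
  filter_upwards [h (min ε 1).toReal (ENNReal.toReal_pos (lt_min hε one_pos).ne' h1)] with n hn
  rw [ENNReal.ofReal_toReal h1] at hn
  exact hn.trans (min_le_left _ _)

/-- The three errors are the remainder of the expansion, the score taken at the estimate instead of
ϑ₀, and the inverse information taken there. -/
lemma norm_inv_smul_sub_le {E : Type*} [NormedAddCommGroup E] [NormedSpace ℝ E] {p : ℝ}
    (hp : 0 < p) {w U V : E} {B B₀ : E →L[ℝ] E} {a b e : ℝ} (h₁ : ‖w - B (p • U)‖ ≤ a)
    (h₂ : ‖B (U - V)‖ ≤ b) (h₃ : ‖B V - B₀ V‖ ≤ e) : ‖p⁻¹ • w - B₀ V‖ ≤ p⁻¹ * a + b + e := by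
  have : p⁻¹ • w - B₀ V = p⁻¹ • (w - B (p • U)) + B (U - V) + (B V - B₀ V) := by
    rw [smul_sub, map_smul, inv_smul_smul₀ hp.ne', map_sub]
    abel
  rw [this]
  refine (norm_add₃_le).trans (add_le_add (add_le_add ?_ h₂) h₃)
  rw [norm_smul, norm_inv, Real.norm_of_nonneg hp.le]
  gcongr

lemma tendsto_inv_sqrt_natCast {N : ℕ → ℕ} (hN : Tendsto N atTop atTop) :
    Tendsto (fun n => (√(N n : ℝ))⁻¹) atTop (𝓝 0) :=
  (Real.tendsto_sqrt_atTop.comp (tendsto_natCast_atTop_atTop.comp hN)).inv_tendsto_atTop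

/-- Multiplied out, the only terms with p left in the denominator are q³/p and q · q³/p. -/
lemma tendsto_expansion_rate {p q : ℕ → ℝ} (hp : Tendsto p atTop (𝓝 0))
    (hp0 : ∀ᶠ n in atTop, 0 < p n) (hq0 : ∀ᶠ n in atTop, 0 < q n)
    (hq : Tendsto q atTop (𝓝 0)) (hpq : Tendsto (fun n => p n ^ 2 / q n ^ 2) atTop (𝓝 0))
    (hqp : Tendsto (fun n => q n ^ 3 / p n) atTop (𝓝 0)) :
    Tendsto (fun n => (p n)⁻¹ * ((p n ^ 2 / q n ^ 2 + p n + q n + q n ^ 2) * (p n + q n ^ 2)))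
      atTop (𝓝 0) := by
  have h : Tendsto (fun n => p n ^ 2 / q n ^ 2 + p n + q n + q n ^ 2 + p n + q n ^ 2 +
      q n ^ 3 / p n + q n * (q n ^ 3 / p n)) atTop
      (𝓝 (0 + 0 + 0 + 0 ^ 2 + 0 + 0 ^ 2 + 0 + 0 * 0)) :=
    (((((((hpq.add hp).add hq).add (hq.pow 2)).add hp).add (hq.pow 2)).add hqp).add (hq.mul hqp))
  have h0 : (0 : ℝ) + 0 + 0 + 0 ^ 2 + 0 + 0 ^ 2 + 0 + 0 * 0 = 0 := by norm_num
  rw [h0] at h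
  refine h.congr' ?_
  filter_upwards [hp0, hq0] with n h1 h2
  field_simp
  ring

/-- As N ~ n^δ and k ~ s n, the last two quantities are of orders n^(δ-1) and n^((1-3δ)/2). -/
lemma tendsto_floor_rpow_rates {δ s : ℝ} (hδ : δ ∈ Set.Ioc (1 / 3 : ℝ) (1 / 2))
    (hs : s ∈ Set.Ioc (0 : ℝ) 1) :
    Tendsto (fun n : ℕ => ⌊(n : ℝ) ^ δ⌋₊) atTop atTop ∧
    Tendsto (fun n : ℕ => ⌊s * n⌋₊) atTop atTop ∧
    Tendsto (fun n : ℕ => (⌊(n : ℝ) ^ δ⌋₊ / ⌊s * n⌋₊ : ℝ)) atTop (𝓝 0) ∧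
    Tendsto (fun n : ℕ => √(⌊s * n⌋₊ : ℝ) / (⌊(n : ℝ) ^ δ⌋₊ * √(⌊(n : ℝ) ^ δ⌋₊ : ℝ))) atTop
      (𝓝 0) := by
  obtain ⟨hδ1, hδ2⟩ := hδ
  have hδ0 : 0 < δ := lt_trans (by norm_num) hδ1
  have hcast : Tendsto (fun n : ℕ => (n : ℝ)) atTop atTop := tendsto_natCast_atTop_atTop
  have hpow : Tendsto (fun n : ℕ => (n : ℝ) ^ δ) atTop atTop := (tendsto_rpow_atTop hδ0).comp hcast
  have hNr : Tendsto (fun n : ℕ => (⌊(n : ℝ) ^ δ⌋₊ : ℝ) / (n : ℝ) ^ δ) atTop (𝓝 1) :=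
    (tendsto_nat_floor_div_atTop (R := ℝ)).comp hpow
  have hkr : Tendsto (fun n : ℕ => (⌊s * n⌋₊ : ℝ) / n) atTop (𝓝 s) :=
    (tendsto_nat_floor_mul_div_atTop hs.1.le).comp hcast
  refine ⟨tendsto_nat_floor_atTop.comp hpow,
    tendsto_nat_floor_atTop.comp (hcast.const_mul_atTop hs.1), ?_, ?_⟩
  · have h1 : Tendsto (fun n : ℕ => (n : ℝ) ^ (-(1 - δ))) atTop (𝓝 0) :=
      (tendsto_rpow_neg_atTop (by linarith)).comp hcast
    have h2 := (hNr.div hkr hs.1.ne').mul h1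
    rw [mul_zero] at h2
    refine h2.congr' ?_
    filter_upwards [eventually_gt_atTop 0] with n hn
    have hn' : (0 : ℝ) < n := Nat.cast_pos.2 hn
    have e : (n : ℝ) ^ (-(1 - δ)) = (n : ℝ) ^ δ / n := by
      rw [neg_sub, Real.rpow_sub_one hn'.ne']
    simp only [Pi.div_apply]
    rw [e]
    have := (Real.rpow_pos_of_pos hn' δ).ne'
    field_simp
  · have h1 : Tendsto (fun n : ℕ => (n : ℝ) ^ (-((3 * δ - 1) / 2))) atTop (𝓝 0) :=
      (tendsto_rpow_neg_atTop (by linarith)).comp hcast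
    have h2 := (hkr.sqrt.div (hNr.mul hNr.sqrt) (by simp)).mul h1
    rw [mul_zero] at h2
    refine h2.congr' ?_
    filter_upwards [eventually_gt_atTop 0] with n hn
    have hn' : (0 : ℝ) < n := Nat.cast_pos.2 hn
    have hp := Real.rpow_pos_of_pos hn' δ
    have e : (n : ℝ) ^ (-((3 * δ - 1) / 2)) = √n / ((n : ℝ) ^ δ * √((n : ℝ) ^ δ)) := by
      rw [Real.sqrt_eq_rpow, Real.sqrt_eq_rpow, ← Real.rpow_mul hn'.le, ← Real.rpow_add hn',
        ← Real.rpow_sub hn']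
      congr 1
      ring
    simp only [Pi.div_apply]
    rw [e, Real.sqrt_div (Nat.cast_nonneg _), Real.sqrt_div (Nat.cast_nonneg _)]
    have := (Real.sqrt_pos.2 hp).ne'
    have := (Real.sqrt_pos.2 hn').ne'
    have := hp.ne'
    field_simp

end LimitLaw

/-! ### Asymptotic linearity of the two-step estimate -/

section TwoStep

variable {Ω : Type*} [MeasurableSpace Ω] {P : Measure Ω} [IsProbabilityMeasure P] {d : ℕ}
  {Θ : Set (EuclideanSpace ℝ (Fin d))} {T : Set ℝ}
  {lam : EuclideanSpace ℝ (Fin d) → ℝ → ℝ} {ϑ₀ : EuclideanSpace ℝ (Fin d)} {K c : ℝ}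

lemma le_norm_inv_sqrt_smul_iff {E : Type*} [NormedAddCommGroup E] [NormedSpace ℝ E] {k : ℕ}
    (hk : 0 < k) (a : ℝ) (v : E) : a ≤ ‖(√(k : ℝ))⁻¹ • v‖ ↔ a * √(k : ℝ) ≤ ‖v‖ := by
  have hs : 0 < √(k : ℝ) := Real.sqrt_pos.2 (Nat.cast_pos.2 hk)
  rw [norm_smul, norm_inv, Real.norm_of_nonneg hs.le, ← div_eq_inv_mul, le_div_iff₀ hs]

lemma natCast_mul_div_mul_sqrt_sq {k : ℕ} (m : ℕ) (B a : ℝ) :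
    m * B / (a * √(k : ℝ)) ^ 2 = (m / k : ℝ) * (B / a ^ 2) := by
  rw [mul_pow, Real.sq_sqrt (Nat.cast_nonneg _), mul_comm (a ^ 2), mul_div_mul_comm]

namespace IsBoundedModel

lemma measure_le_norm_inv_sqrt_smul_sum_scoreStat (hM : IsBoundedModel Θ T lam ϑ₀ K)
    {X : ℕ → Ω → StieltjesFunction ℝ}
    (hX : ∀ j, IsPoissonPath P (intensityMeasure T (lam ϑ₀)) (X j)) (hind : iIndepFun X P)
    (J : Finset ℕ) {k : ℕ} (hk : 0 < k) {a : ℝ} (ha : 0 < a) :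
    P {ω | a ≤ ‖(√(k : ℝ))⁻¹ • ∑ j ∈ J, scoreStat T lam ϑ₀ ϑ₀ (X j ω)‖} ≤ ENNReal.ofReal
      ((J.card / k : ℝ) * (K ^ 2 * (intensityMeasure T (lam ϑ₀)).real Set.univ / a ^ 2)) := by
  simp only [le_norm_inv_sqrt_smul_iff hk]
  rw [← natCast_mul_div_mul_sqrt_sq]
  exact hM.measure_le_norm_sum_scoreStat hX hind J
    (mul_pos ha (Real.sqrt_pos.2 (Nat.cast_pos.2 hk)))

lemma measure_le_norm_inv_sqrt_smul_sum_scoreStat_sub (hM : IsBoundedModel Θ T lam ϑ₀ K)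
    {X : ℕ → Ω → StieltjesFunction ℝ}
    (hX : ∀ j, IsPoissonPath P (intensityMeasure T (lam ϑ₀)) (X j)) (hind : iIndepFun X P)
    {N : ℕ} {Y : Ω → EuclideanSpace ℝ (Fin d)} (hY : Measurable[observedSigma X N] Y)
    {J : Finset ℕ} (hJ : Disjoint (Finset.range N) J) {k : ℕ} (hk : 0 < k) {r a : ℝ}
    (ha : 0 < a) :
    P {ω | (Y ω ∈ Θ ∧ ‖Y ω - ϑ₀‖ < r) ∧ a ≤ ‖(√(k : ℝ))⁻¹ • ∑ j ∈ J,
      (scoreStat T lam ϑ₀ (Y ω) (X j ω) - scoreStat T lam ϑ₀ ϑ₀ (X j ω))‖} ≤ ENNReal.ofReal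
      ((J.card / k : ℝ) *
        ((K * r) ^ 2 * (intensityMeasure T (lam ϑ₀)).real Set.univ / a ^ 2)) := by
  simp only [le_norm_inv_sqrt_smul_iff hk]
  rw [← natCast_mul_div_mul_sqrt_sq]
  exact hM.measure_le_norm_sum_scoreStat_sub hX hind hY hJ
    (mul_pos ha (Real.sqrt_pos.2 (Nat.cast_pos.2 hk)))

/-- The two-step estimate is asymptotically linear: with probability tending to one both
preliminary estimates are in `Θ`, and the normalized error of the two-step estimate is close to
the normalized score statistic at `ϑ₀`. -/
lemma tendsto_measure_not_expansion (hM : IsBoundedModel Θ T lam ϑ₀ K) (hc : 0 < c)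
    (h : ∀ ϑ ∈ Θ, ∀ u, c * ‖u‖ ^ 2 ≤ ⟪u, fisherOp T lam ϑ u⟫)
    {X : ℕ → Ω → StieltjesFunction ℝ}
    (hX : ∀ j, IsPoissonPath P (intensityMeasure T (lam ϑ₀)) (X j)) (hind : iIndepFun X P)
    {ϑbar : ℕ → Ω → EuclideanSpace ℝ (Fin d)} (hprelim : IsPreliminaryEstimator P X ϑbar ϑ₀)
    {N k : ℕ → ℕ} (hN : Tendsto N atTop atTop) (hk : Tendsto k atTop atTop)
    (hNk : Tendsto (fun n => (N n / k n : ℝ)) atTop (𝓝 0))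
    (hrate : Tendsto (fun n => √(k n : ℝ) / (N n * √(N n : ℝ))) atTop (𝓝 0))
    {ε : ℝ} (hε : 0 < ε) :
    Tendsto (fun n => P {ω | ¬(ϑbar (N n) ω ∈ Θ ∧
      secondPreliminary Θ T lam (N n) (k n) (fun j => X j ω) (ϑbar (N n) ω) ∈ Θ ∧
      ‖√(k n : ℝ) • (twoStepMLE Θ T lam (N n) (k n) (fun j => X j ω) (ϑbar (N n) ω) - ϑ₀) -
        fisherInvOp T lam ϑ₀ ((√(k n : ℝ))⁻¹ • ∑ j ∈ Finset.Ico (N n) (k n),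
          scoreStat T lam ϑ₀ ϑ₀ (X j ω))‖ < ε)}) atTop (𝓝 0) := by
  refine tendsto_measure_zero_of_eventually_le_ofReal fun η hη => ?_
  have := hM.isFiniteMeasure_intensityMeasure
  set L := (intensityMeasure T (lam ϑ₀)).real Set.univ with hL
  have hη4 : 0 < η / 4 := by positivity
  -- the level of the stochastic bounds
  obtain ⟨M₁, hM₁⟩ := hprelim.bounded_in_prob (η / 4) hη4
  obtain ⟨M, hMM₁, hM0, hMη⟩ : ∃ M, M₁ ≤ M ∧ 0 < M ∧ K ^ 2 * L / M ^ 2 ≤ η / 4 := by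
    have ht : Tendsto (fun M : ℝ => K ^ 2 * L / M ^ 2) atTop (𝓝 0) :=
      (tendsto_pow_atTop two_ne_zero).const_div_atTop _
    exact ((eventually_ge_atTop M₁).and ((eventually_gt_atTop 0).and
      ((ht.eventually_lt_const hη4).mono fun _ => le_of_lt))).exists
  -- The level is M + 1 because the statistic at the estimate will differ from the one at ϑ₀ by less
  -- than ρ ≤ 1.
  obtain ⟨C, hC0, hC⟩ := hM.exists_expansion_bound hc h (M := M + 1) (by positivity)
  obtain ⟨R, hR, hRΘ⟩ := Metric.isOpen_iff.1 hM.isOpen ϑ₀ hM.mem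
  -- ρ is the tolerated change of the normalized statistic; the inverse information magnifies it by
  -- at most 1/c.
  obtain ⟨ρ, hρ, hρ1, hρε⟩ : ∃ ρ, 0 < ρ ∧ ρ ≤ 1 ∧ c⁻¹ * ρ < ε / 3 := by
    have ht : Tendsto (fun ρ : ℝ => c⁻¹ * ρ) (𝓝[>] 0) (𝓝 (c⁻¹ * 0)) :=
      (tendsto_nhdsWithin_of_tendsto_nhds tendsto_id).const_mul _
    rw [mul_zero] at ht
    exact ((eventually_mem_nhdsWithin).and (((eventually_le_nhds one_pos).filter_mono
      nhdsWithin_le_nhds).and (ht.eventually_lt_const (by positivity)))).exists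
  set D := c⁻¹ * c⁻¹ * (3 * K ^ 3 * ∫ t in T, lam ϑ₀ t) with hD
  -- r localizes the first estimate: within r of ϑ₀ it lies in Θ, changing the inverse information
  -- costs less than ε/3, and the statistic moves by ρ or more with probability below η/4.
  obtain ⟨r, hr, hrR, hrε, hrη⟩ : ∃ r, 0 < r ∧ r ≤ R ∧ D * r * M < ε / 3 ∧
      (K * r) ^ 2 * L / ρ ^ 2 < η / 4 := by
    have h1 : Tendsto (fun r : ℝ => r) (𝓝[>] 0) (𝓝 0) :=
      tendsto_nhdsWithin_of_tendsto_nhds tendsto_id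
    have h2 : Tendsto (fun r : ℝ => D * r * M) (𝓝[>] 0) (𝓝 (D * 0 * M)) :=
      (h1.const_mul _).mul_const _
    have h3 : Tendsto (fun r : ℝ => (K * r) ^ 2 * L / ρ ^ 2) (𝓝[>] 0)
        (𝓝 ((K * 0) ^ 2 * L / ρ ^ 2)) :=
      (((h1.const_mul _).pow 2).mul_const _).div_const _
    simp only [mul_zero, zero_mul, ne_eq, OfNat.ofNat_ne_zero, not_false_eq_true, zero_pow,
      zero_div] at h2 h3
    exact ((eventually_mem_nhdsWithin).and (((eventually_le_nhds hR).filter_mono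
      nhdsWithin_le_nhds).and ((h2.eventually_lt_const (by positivity)).and
      (h3.eventually_lt_const hη4)))).exists
  -- the deterministic rates
  have hp := tendsto_inv_sqrt_natCast hk
  have hq := tendsto_inv_sqrt_natCast hN
  have hratio : ∀ n, (√(k n : ℝ))⁻¹ ^ 2 / (√(N n : ℝ))⁻¹ ^ 2 = (N n / k n : ℝ) := fun n => by
    rw [inv_pow, inv_pow, Real.sq_sqrt (Nat.cast_nonneg _), Real.sq_sqrt (Nat.cast_nonneg _),
      inv_div_inv]
  have hpos : ∀ {m : ℕ}, 0 < m → 0 < (√(m : ℝ))⁻¹ := fun hm =>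
    inv_pos.2 (Real.sqrt_pos.2 (Nat.cast_pos.2 hm))
  have hrate' := (tendsto_expansion_rate hp
    ((hk.eventually_gt_atTop 0).mono fun n => hpos) ((hN.eventually_gt_atTop 0).mono fun n => hpos)
    hq (by simpa only [hratio] using hNk) (by
      refine hrate.congr fun n => ?_
      rw [div_inv_eq_mul, inv_pow, pow_succ, Real.sq_sqrt (Nat.cast_nonneg _),
        div_eq_inv_mul])).const_mul C
  have hdev : Tendsto (fun n => C * ((√(k n : ℝ))⁻¹ + (√(N n : ℝ))⁻¹ ^ 2)) atTop
      (𝓝 (C * (0 + 0 ^ 2))) := (hp.add (hq.pow 2)).const_mul C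
  simp only [ne_eq, OfNat.ofNat_ne_zero, not_false_eq_true, zero_pow, add_zero, mul_zero]
    at hrate' hdev
  have hcons := (hprelim.consistent.comp hN) (ENNReal.ofReal r) (ENNReal.ofReal_pos.2 hr)
  filter_upwards [hk.eventually_gt_atTop 0, hN.eventually_gt_atTop 0,
    hNk.eventually_lt_const one_pos, hrate'.eventually_lt_const (by positivity : 0 < ε / 3),
    hdev.eventually_lt_const hR, hcons.eventually_le_const (ENNReal.ofReal_pos.2 hη4)]
    with n hk0 hN0 hNk1 hrn hdn hcn
  have hkR : (0 : ℝ) < k n := Nat.cast_pos.2 hk0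
  have hNkn : N n ≤ k n := by
    rw [div_lt_one hkR] at hNk1
    exact_mod_cast hNk1.le
  set p := (√(k n : ℝ))⁻¹ with hpdef
  set q := (√(N n : ℝ))⁻¹ with hqdef
  have hp0 : 0 < p := hpos hk0
  have hq0 : 0 < q := hpos hN0
  have hpq : p ≤ q := inv_anti₀ (Real.sqrt_pos.2 (Nat.cast_pos.2 hN0))
    (Real.sqrt_le_sqrt (Nat.cast_le.2 hNkn))
  set J := Finset.Ico (N n) (k n) with hJ
  have hcard : (J.card / k n : ℝ) ≤ 1 := by
    rw [div_le_one hkR, hJ, Nat.card_Ico]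
    exact_mod_cast Nat.sub_le _ _
  have hLn : 0 ≤ L := measureReal_nonneg
  -- Exceptional events: a null set of paths of infinite mass and four events of probability at most
  -- η/4. Off their union the argument is deterministic.
  have b₁ : P {ω | ¬∀ j, (X j ω).measure Set.univ < ∞} = 0 :=
    ae_iff.1 (ae_all_iff.2 fun j => (hX j).ae_measure_univ_lt_top)
  have b₂ := (hM.measure_le_norm_inv_sqrt_smul_sum_scoreStat hX hind J hk0 hM0).trans
    (ENNReal.ofReal_le_ofReal ((mul_le_of_le_one_left (by positivity) hcard).trans hMη))
  have b₃ := hM₁ (N n)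
  have b₄ : P {ω | r ≤ ‖ϑbar (N n) ω - ϑ₀‖} ≤ ENNReal.ofReal (η / 4) := by
    refine (measure_mono fun ω hω => ?_).trans hcn
    rw [Set.mem_ofPred_eq, Function.comp_apply, edist_dist, dist_eq_norm]
    exact ENNReal.ofReal_le_ofReal hω
  have b₅ := (hM.measure_le_norm_inv_sqrt_smul_sum_scoreStat_sub hX hind
    (hprelim.measurable (N n)) (J := J) (by
      rw [hJ, Finset.range_eq_Ico]
      exact Finset.Ico_disjoint_Ico_consecutive 0 (N n) (k n)) hk0 (r := r) hρ).trans
    (ENNReal.ofReal_le_ofReal ((mul_le_of_le_one_left (by positivity) hcard).trans hrη.le))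
  have hsum : (0 : ℝ≥0∞) + (ENNReal.ofReal (η / 4) + (ENNReal.ofReal (η / 4) +
      (ENNReal.ofReal (η / 4) + ENNReal.ofReal (η / 4)))) = ENNReal.ofReal η := by
    rw [zero_add, ← ENNReal.ofReal_add hη4.le hη4.le, ← ENNReal.ofReal_add hη4.le (by positivity),
      ← ENNReal.ofReal_add hη4.le (by positivity)]
    congr 1
    ring
  rw [← hsum]
  refine le_trans (measure_mono fun ω hω => ?_) ((measure_union_le _ _).trans
    (add_le_add b₁.le ((measure_union_le _ _).trans (add_le_add b₂
    ((measure_union_le _ _).trans (add_le_add b₃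
    ((measure_union_le _ _).trans (add_le_add b₄ b₅))))))))
  by_contra hcon
  simp only [Set.mem_union, Set.mem_ofPred_eq, not_or, not_not, not_le, not_lt, not_and] at hcon
  obtain ⟨hfin, hV, hϑN, hϑr, hUV⟩ := hcon
  refine hω ?_
  have hϑ : ϑbar (N n) ω ∈ Θ := hRΘ (by
    rw [Metric.mem_ball, dist_eq_norm]
    exact hϑr.trans_le hrR)
  have hUV := hUV ⟨hϑ, hϑr⟩
  set ϑ := ϑbar (N n) ω with hϑdef
  set V := p • ∑ j ∈ J, scoreStat T lam ϑ₀ ϑ₀ (X j ω) with hVdef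
  set U := p • ∑ j ∈ J, scoreStat T lam ϑ₀ ϑ (X j ω) with hUdef
  have hUVe : p • ∑ j ∈ J, (scoreStat T lam ϑ₀ ϑ (X j ω) - scoreStat T lam ϑ₀ ϑ₀ (X j ω)) =
      U - V := by
    rw [Finset.sum_sub_distrib, smul_sub]
  rw [hUVe] at hUV
  have hUn : ‖U‖ ≤ M + 1 := by
    have := norm_add_le (U - V) V
    rw [sub_add_cancel] at this
    linarith
  have hpU : (1 / (k n : ℝ)) • ∑ j ∈ J, scoreStat T lam ϑ₀ ϑ (X j ω) = p • U := by
    rw [hUdef, smul_smul, hpdef, ← mul_inv, Real.mul_self_sqrt hkR.le, one_div]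
  obtain ⟨e₁, e₂⟩ := hC (N n) (k n) p q (fun j => X j ω) ϑ hNkn hk0 hp0 hpq (hratio n).symm
    hfin hϑ (by
      rw [hpU, norm_smul, Real.norm_of_nonneg hp0.le, mul_comm]
      gcongr) (by
      rw [hqdef, ← div_eq_mul_inv, le_div_iff₀ (Real.sqrt_pos.2 (Nat.cast_pos.2 hN0)), mul_comm]
      linarith)
  have hϑ₂ : secondPreliminary Θ T lam (N n) (k n) (fun j => X j ω) ϑ ∈ Θ := hRΘ (by
    rw [Metric.mem_ball, dist_eq_norm]
    exact e₁.trans_lt hdn)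
  refine ⟨hϑ, hϑ₂, ?_⟩
  have e₃ := e₂ hϑ₂
  rw [hpU] at e₃
  have hpinv : √(k n : ℝ) = p⁻¹ := (inv_inv _).symm
  rw [hpinv]
  -- Each of the three errors is below ε/3.
  refine (norm_inv_smul_sub_le (B := fisherInvOp T lam ϑ) (B₀ := fisherInvOp T lam ϑ₀) hp0 e₃
    (b := c⁻¹ * ρ) (e := D * r * M) ?_ ?_).trans_lt ?_
  · exact (norm_fisherInvOp_le hc (h ϑ hϑ) _).trans
      (mul_le_mul_of_nonneg_left hUV.le (inv_nonneg.2 hc.le))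
  · refine (norm_fisherInvOp_sub_le hM hc h hM.mem hϑ V).trans ?_
    have hK := hM.bounds.nonneg
    have hI := hM.integral_lam_nonneg
    gcongr
  · have : p⁻¹ * (C * (p ^ 2 / q ^ 2 + p + q + q ^ 2) * (p + q ^ 2)) =
        C * (p⁻¹ * ((p ^ 2 / q ^ 2 + p + q + q ^ 2) * (p + q ^ 2))) := by ring
    rw [this]
    linarith

end IsBoundedModel

end TwoStep

/-! ### Passage to the limit -/

section AsymptoticNormality

variable {Ω : Type*} [MeasurableSpace Ω] {P : Measure Ω} [IsProbabilityMeasure P] {d : ℕ}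
  {Θ : Set (EuclideanSpace ℝ (Fin d))} {T : Set ℝ}
  {lam : EuclideanSpace ℝ (Fin d) → ℝ → ℝ} {ϑ₀ : EuclideanSpace ℝ (Fin d)} {K : ℝ}

/-- Asymptotic normality of the two-step estimate for general sizes of the learning sample and of
the whole sample. -/
lemma IsBoundedModel.asymptotics_twoStepMLE (hM : IsBoundedModel Θ T lam ϑ₀ K)
    {X : ℕ → Ω → StieltjesFunction ℝ}
    (hX : ∀ j, IsPoissonPath P (intensityMeasure T (lam ϑ₀)) (X j)) (hind : iIndepFun X P)
    {ϑbar : ℕ → Ω → EuclideanSpace ℝ (Fin d)} (hprelim : IsPreliminaryEstimator P X ϑbar ϑ₀)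
    {N k : ℕ → ℕ} (hN : Tendsto N atTop atTop) (hk : Tendsto k atTop atTop)
    (hNk : Tendsto (fun n => (N n / k n : ℝ)) atTop (𝓝 0))
    (hrate : Tendsto (fun n => √(k n : ℝ) / (N n * √(N n : ℝ))) atTop (𝓝 0)) :
    TendstoInDistribution
      (fun (n : ℕ) (ω : Ω) => √(k n : ℝ) •
        (twoStepMLE Θ T lam (N n) (k n) (fun j => X j ω) (ϑbar (N n) ω) - ϑ₀))
      atTop id (fun _ => P) (multivariateGaussian 0 (fisherInfo T lam ϑ₀)⁻¹) ∧
    Tendsto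
      (fun n : ℕ => P {ω | ϑbar (N n) ω ∈ Θ ∧
        secondPreliminary Θ T lam (N n) (k n) (fun j => X j ω) (ϑbar (N n) ω) ∈ Θ})
      atTop (𝓝 1) := by
  obtain ⟨c, hc, h⟩ := hM.regular.exists_le_inner_fisherOp
  have hXm := fun j => (hX j).measurable
  have hfin := hM.isFiniteMeasure_intensityMeasure
  have hexp := fun {ε : ℝ} (hε : 0 < ε) =>
    hM.tendsto_measure_not_expansion hc h hX hind hprelim hN hk hNk hrate hε
  constructor
  · have hclt := hM.tendstoInDistribution_sum_fisherInvOp_scoreStat hc (h ϑ₀ hM.mem) hX hind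
    have hclt' : TendstoInDistribution
        (fun (n : ℕ) ω => (√(k n : ℝ))⁻¹ • ∑ j ∈ Finset.range (k n),
          fisherInvOp T lam ϑ₀ (scoreStat T lam ϑ₀ ϑ₀ (X j ω))) atTop id
        (fun _ => P) (multivariateGaussian 0 (fisherInfo T lam ϑ₀)⁻¹) :=
      ⟨fun n => hclt.forall_aemeasurable (k n), hclt.aemeasurable_limit, hclt.tendsto.comp hk⟩
    refine tendstoInDistribution_of_tendstoInMeasure_sub _ _ hclt' ?_ fun n =>
      AEMeasurable.const_smul ((hM.aemeasurable_twoStepMLE hc h hXm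
        (ae_all_iff.2 fun j => (hX j).ae_measure_univ_lt_top) (N n) (k n)
        ((hprelim.measurable (N n)).mono (observedSigma_le hXm _) le_rfl)).sub_const ϑ₀)
        (√(k n : ℝ))
    rw [tendstoInMeasure_iff_norm]
    intro ε hε
    -- The central limit theorem sums from the first observation, the estimate from number N + 1.
    -- The initial block has variance of order N/k; the threshold c ε/2 becomes ε/2 after the
    -- inverse information, whose norm is at most 1/c.
    have hb : 0 < c * (ε / 2) := by positivity
    set L := K ^ 2 * (intensityMeasure T (lam ϑ₀)).real Set.univ / (c * (ε / 2)) ^ 2 with hL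
    have hinit : Tendsto (fun n => P {ω | c * (ε / 2) ≤ ‖(√(k n : ℝ))⁻¹ •
        ∑ j ∈ Finset.range (N n), scoreStat T lam ϑ₀ ϑ₀ (X j ω)‖}) atTop (𝓝 0) := by
      have hlim : Tendsto (fun n => ENNReal.ofReal ((N n / k n : ℝ) * L)) atTop (𝓝 0) := by
        have := ENNReal.tendsto_ofReal (hNk.mul_const L)
        rwa [zero_mul, ENNReal.ofReal_zero] at this
      refine tendsto_of_tendsto_of_tendsto_of_le_of_le' tendsto_const_nhds hlim
        (.of_forall fun _ => zero_le) ?_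
      filter_upwards [hk.eventually_gt_atTop 0] with n hn
      refine (hM.measure_le_norm_inv_sqrt_smul_sum_scoreStat hX hind _ hn hb).trans_eq ?_
      rw [Finset.card_range]
    have hsum := (hexp (half_pos hε)).add hinit
    rw [add_zero] at hsum
    refine tendsto_of_tendsto_of_tendsto_of_le_of_le' tendsto_const_nhds hsum
      (.of_forall fun _ => zero_le) ?_
    filter_upwards [hk.eventually_gt_atTop 0, hNk.eventually_lt_const one_pos] with n hk0 hNk1
    have hNkn : N n ≤ k n := by
      rw [div_lt_one (Nat.cast_pos.2 hk0)] at hNk1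
      exact_mod_cast hNk1.le
    refine (measure_mono fun ω hω => ?_).trans (measure_union_le _ _)
    by_contra hcon
    simp only [Set.mem_union, Set.mem_ofPred_eq, not_or, not_not, not_le] at hcon
    obtain ⟨⟨-, -, h₁⟩, h₂⟩ := hcon
    have h₃ := norm_fisherInvOp_le hc (h ϑ₀ hM.mem) ((√(k n : ℝ))⁻¹ •
      ∑ j ∈ Finset.range (N n), scoreStat T lam ϑ₀ ϑ₀ (X j ω))
    have h₄ := h₃.trans_lt (mul_lt_mul_of_pos_left h₂ (inv_pos.2 hc))
    rw [inv_mul_cancel_left₀ hc.ne'] at h₄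
    refine (not_lt.2 (show ε ≤ _ from hω)) ?_
    simp only [Pi.sub_apply, Pi.zero_apply, sub_zero]
    rw [← Finset.sum_range_add_sum_Ico _ hNkn, smul_add, ← map_sum, ← map_sum, ← map_smul,
      ← map_smul, add_comm, ← sub_sub]
    refine (norm_sub_le _ _).trans_lt ?_
    linarith
  -- Subadditivity of `P` gives 1 ≤ P(good) + P(exceptional), so measurability of the events is not
  -- needed.
  · have hlim := ENNReal.Tendsto.sub (tendsto_const_nhds (x := (1 : ℝ≥0∞))) (hexp one_pos)
      (Or.inl ENNReal.one_ne_top)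
    rw [tsub_zero] at hlim
    refine tendsto_of_tendsto_of_tendsto_of_le_of_le hlim tendsto_const_nhds (fun n => ?_)
      fun n => prob_le_one
    refine tsub_le_iff_right.2 ?_
    rw [← measure_univ (μ := P)]
    refine (measure_mono fun ω _ => ?_).trans (measure_union_le _ _)
    by_contra hcon
    simp only [Set.mem_union, Set.mem_ofPred_eq, not_or, not_not] at hcon
    exact hcon.1 ⟨hcon.2.1, hcon.2.2.1⟩

end AsymptoticNormality

end

theorem theorem4 {d : ℕ} {Ω : Type*} [MeasurableSpace Ω] (P : Measure Ω) [IsProbabilityMeasure P]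
    (Θ : Set (EuclideanSpace ℝ (Fin d))) (hΘo : IsOpen Θ) (hΘc : Convex ℝ Θ)
    (hΘb : Bornology.IsBounded Θ)
    (T : Set ℝ) (hT : T.OrdConnected)
    (lam : EuclideanSpace ℝ (Fin d) → ℝ → ℝ) (hlam : IsIntensityFamily Θ T lam)
    (hreg : IsRegularModel Θ T lam)
    (ϑ₀ : EuclideanSpace ℝ (Fin d)) (hϑ₀ : ϑ₀ ∈ Θ)
    (X : ℕ → Ω → StieltjesFunction ℝ)
    (hX : ∀ j, IsPoissonProcess P T (lam ϑ₀) (X j))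
    (hXindep : iIndepFun (fun (j : ℕ) (ω : Ω) (t : ℝ) => X j ω t) P)
    (ϑbar : ℕ → Ω → EuclideanSpace ℝ (Fin d))
    (hprelim : IsPreliminaryEstimator P X ϑbar ϑ₀)
    (δ : ℝ) (hδ : δ ∈ Set.Ioc (1 / 3 : ℝ) (1 / 2)) (s : ℝ) (hs : s ∈ Set.Ioc (0 : ℝ) 1) :
    TendstoInDistribution
      (fun (n : ℕ) (ω : Ω) =>
        √(⌊s * n⌋₊ : ℝ) •
          (twoStepMLE Θ T lam ⌊(n : ℝ) ^ δ⌋₊ ⌊s * n⌋₊ (fun j => X j ω)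
            (ϑbar ⌊(n : ℝ) ^ δ⌋₊ ω) - ϑ₀))
      atTop id (fun _ => P) (multivariateGaussian 0 (fisherInfo T lam ϑ₀)⁻¹) ∧
    Tendsto
      (fun n : ℕ => P {ω | ϑbar ⌊(n : ℝ) ^ δ⌋₊ ω ∈ Θ ∧
        secondPreliminary Θ T lam ⌊(n : ℝ) ^ δ⌋₊ ⌊s * n⌋₊ (fun j => X j ω)
          (ϑbar ⌊(n : ℝ) ^ δ⌋₊ ω) ∈ Θ})
      atTop (𝓝 1) := by
  obtain ⟨K, hK⟩ := hreg.exists_scoreBounds hlam hΘo hΘc hΘb hϑ₀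
  have hM : IsBoundedModel Θ T lam ϑ₀ K := ⟨hΘo, hϑ₀, hT.measurableSet, hlam, hreg, hK⟩
  obtain ⟨hN, hk, hNk, hrate⟩ := tendsto_floor_rpow_rates hδ hs
  exact hM.asymptotics_twoStepMLE
    (fun j => (hX j).isPoissonPath hT.measurableSet (hlam.integrable ϑ₀ hϑ₀) (hlam.pos ϑ₀ hϑ₀))
    (StieltjesFunction.iIndepFun_of_paths hXindep) hprelim hN hk hNk hrate
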